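/- $\mathsf{WKL}_0$ proves Cousin's lemma for continuous gauges on the unit interval and on Cantor space. That is, the following sentences of second-order arithmetic hold in every model of $\mathsf{WKL}_0$ (every structure for the two-sorted language, with an arbitrary, possibly nonstandard, number part and an arbitrary nonempty family of subsets of it as range of the set variables, which satisfies the basic arithmetical axioms, $\Sigma^0_1$-induction, $\Delta^0_1$-comprehension and weak K\H{o}nig's lemma; by the completeness theorem this is the same as being provable in $\mathsf{WKL}_0$). 1. Let $X=[0,1]$ or $X=2^{\mathbb N}$, where $d(x,y)=2^{-n}$ for the largest $n$ with $x{\restriction}n=y{\restriction}n$ if $x\ne y$. For every code of a continuous function $\delta\colon X\to\mathbb R$ with $\delta(x)>0$ for all $x\in X$ there is a $\delta$-fine cover of $X$: a finite set $P\subseteq X$ and positive real numbers $r_p$ ($p\in P$) such that $r_p\le\delta(p)$ for all $p\in P$ and $X=\bigcup_{p\in P}B(p,r_p)$, where $B(p,r)=\{x\in X : d(x,p)<r\}$. 2. For every code of a continuous function $\delta\colon[0,1]\to\mathbb R$ with $\delta(x)>0$ for all $x\in[0,1]$ there is a $\delta$-fine tagged partition of $[0,1]$: points $0=x_0\le\xi_0\le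 x_1\le\xi_1\le\dots\le\xi_{n-1}\le x_n=1$ with $x_{i+1}-x_i\le\delta(\xi_i)$ for all $i<n$. Here real numbers are coded by sequences of rationals $(q_k)$ with $|q_k-q_{k+i}|\le 2^{-k}$; a continuous function is coded by a set of quintuples $(n,a,r,b,s)$ (abbreviated $(a,r)\,\Phi\,(b,s)$), saying that the ball $B(a,r)$ about an element $a$ of the standard countable dense set is mapped into the closed ball about $b\in\mathbb Q$ of radius $s$, with the usual consistency and monotonicity conditions; and finite sets of points or of reals are given as finite sequences, coded by a single set. -/

import Mathlib

/-! # Second-order arithmetic and Cousin's lemma for coded continuous gauges -/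

universe u

namespace SOA

/-! ## The language of second-order arithmetic

Number variables and set variables are named by natural numbers (two separate stocks of names). -/

/-- Numerical terms. -/
inductive Tm : Type
  | var (n : ℕ)
  | zero
  | one
  | add (s t : Tm)
  | mul (s t : Tm)

instance : Zero Tm := ⟨Tm.zero⟩
instance : One Tm := ⟨Tm.one⟩
instance : Add Tm := ⟨Tm.add⟩
instance : Mul Tm := ⟨Tm.mul⟩

/-- Formulas; `all`, `ex` bind a number variable and `allS`, `exS` bind a set variable. -/
inductive Fml : Type
  | eq (s t : Tm)
  | lt (s t : Tm)
  | mem (t : Tm) (X : ℕ)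
  | neg (φ : Fml)
  | and (φ ψ : Fml)
  | or (φ ψ : Fml)
  | imp (φ ψ : Fml)
  | all (x : ℕ) (φ : Fml)
  | ex (x : ℕ) (φ : Fml)
  | allS (X : ℕ) (φ : Fml)
  | exS (X : ℕ) (φ : Fml)

/-- Number variables of a term. -/
def Tm.vars : Tm → Set ℕ
  | .var n => {n}
  | .zero => ∅
  | .one => ∅
  | .add s t => s.vars ∪ t.vars
  | .mul s t => s.vars ∪ t.vars

/-- Number variables occurring (free or bound) in a formula. -/
def Fml.numVars : Fml → Set ℕ
  | .eq s t => s.vars ∪ t.vars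
  | .lt s t => s.vars ∪ t.vars
  | .mem t _ => t.vars
  | .neg φ => φ.numVars
  | .and φ ψ => φ.numVars ∪ ψ.numVars
  | .or φ ψ => φ.numVars ∪ ψ.numVars
  | .imp φ ψ => φ.numVars ∪ ψ.numVars
  | .all x φ => {x} ∪ φ.numVars
  | .ex x φ => {x} ∪ φ.numVars
  | .allS _ φ => φ.numVars
  | .exS _ φ => φ.numVars

/-- Set variables occurring (free or bound) in a formula. -/
def Fml.setVars : Fml → Set ℕ
  | .eq _ _ => ∅
  | .lt _ _ => ∅
  | .mem _ X => {X}
  | .neg φ => φ.setVars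
  | .and φ ψ => φ.setVars ∪ ψ.setVars
  | .or φ ψ => φ.setVars ∪ ψ.setVars
  | .imp φ ψ => φ.setVars ∪ ψ.setVars
  | .all _ φ => φ.setVars
  | .ex _ φ => φ.setVars
  | .allS X φ => {X} ∪ φ.setVars
  | .exS X φ => {X} ∪ φ.setVars

/-! ## Structures and truth -/

/-- Structures for the language: a first-order part, and a nonempty family of subsets of it over
which the set variables range. The number part may be nonstandard. -/
structure Model : Type (u + 1) where
  N : Type u
  zero : N
  one : N
  add : N → N → N
  mul : N → N → N
  lt : N → N → Prop
  sets : Set (Set N)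
  sets_nonempty : sets.Nonempty

/-- Value of a term under an assignment. -/
def Tm.eval (M : Model.{u}) (v : ℕ → M.N) : Tm → M.N
  | .var n => v n
  | .zero => M.zero
  | .one => M.one
  | .add s t => M.add (s.eval M v) (t.eval M v)
  | .mul s t => M.mul (s.eval M v) (t.eval M v)

/-- Satisfaction of a formula under an assignment. -/
def Fml.Realize (M : Model.{u}) : Fml → (ℕ → M.N) → (ℕ → M.sets) → Prop
  | .eq s t, v, _ => s.eval M v = t.eval M v
  | .lt s t, v, _ => M.lt (s.eval M v) (t.eval M v)
  | .mem t X, v, V => t.eval M v ∈ (V X : Set M.N)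
  | .neg φ, v, V => ¬ φ.Realize M v V
  | .and φ ψ, v, V => φ.Realize M v V ∧ ψ.Realize M v V
  | .or φ ψ, v, V => φ.Realize M v V ∨ ψ.Realize M v V
  | .imp φ ψ, v, V => φ.Realize M v V → ψ.Realize M v V
  | .all x φ, v, V => ∀ a : M.N, φ.Realize M (Function.update v x a) V
  | .ex x φ, v, V => ∃ a : M.N, φ.Realize M (Function.update v x a) V
  | .allS X φ, v, V => ∀ A : M.sets, φ.Realize M v (Function.update V X A)
  | .exS X φ, v, V => ∃ A : M.sets, φ.Realize M v (Function.update V X A)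

/-- `M` satisfies the universal closure of `φ`. -/
def Model.Satisfies (M : Model.{u}) (φ : Fml) : Prop :=
  ∀ (v : ℕ → M.N) (V : ℕ → M.sets), φ.Realize M v V

/-- Logical consequence: `φ` holds in every model of `T`. -/
def Entails (T : Set Fml) (φ : Fml) : Prop :=
  ∀ M : Model.{u}, (∀ ψ ∈ T, M.Satisfies ψ) → M.Satisfies φ

/-! ## Writing formulas

A `Bld` is a formula that still has to be told the first unused number variable `d` and the first
unused set variable `e`. A quantifier binds the first unused variable. A `Cls` is a definable
class of numbers; set variables, and slices of them, are classes. -/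

abbrev Bld : Type := ℕ → ℕ → Fml
abbrev Cls : Type := Tm → Bld

def eqB (s t : Tm) : Bld := fun _ _ => .eq s t
def ltB (s t : Tm) : Bld := fun _ _ => .lt s t
def negB (A : Bld) : Bld := fun d e => .neg (A d e)
def andB (A B : Bld) : Bld := fun d e => .and (A d e) (B d e)
def orB (A B : Bld) : Bld := fun d e => .or (A d e) (B d e)
def impB (A B : Bld) : Bld := fun d e => .imp (A d e) (B d e)

infix:50 " ≐ " => eqB
infix:50 " ≺ " => ltB
infixr:35 " ⋏ " => andB
infixr:30 " ⋎ " => orB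
infixr:25 " ⟹ " => impB

def iffB (A B : Bld) : Bld := (A ⟹ B) ⋏ (B ⟹ A)
def leB (s t : Tm) : Bld := s ≺ t ⋎ s ≐ t

infix:50 " ≼ " => leB
infix:20 " ⟺ " => iffB

/-- Quantifiers over numbers. -/
def allN (f : Tm → Bld) : Bld := fun d e => .all d (f (.var d) (d + 1) e)
def exN (f : Tm → Bld) : Bld := fun d e => .ex d (f (.var d) (d + 1) e)

/-- Quantifiers over sets. -/
def allS (f : Cls → Bld) : Bld := fun d e => .allS e (f (fun t _ _ => .mem t e) d (e + 1))
def exS (f : Cls → Bld) : Bld := fun d e => .exS e (f (fun t _ _ => .mem t e) d (e + 1))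

/-- The sentence obtained when no variable has been used yet. -/
def close (A : Bld) : Fml := A 0 0

/-! ## The axioms -/

/-- The basic axioms (discretely ordered semiring axioms in the form of recursion equations). -/
def basicAxioms : Set Fml :=
  { close (allN fun n => negB (n + 1 ≐ 0)),
    close (allN fun m => allN fun n => (m + 1 ≐ n + 1) ⟹ (m ≐ n)),
    close (allN fun m => m + 0 ≐ m),
    close (allN fun m => allN fun n => m + (n + 1) ≐ (m + n) + 1),
    close (allN fun m => m * 0 ≐ 0),
    close (allN fun m => allN fun n => m * (n + 1) ≐ m * n + m),
    close (allN fun m => negB (m ≺ 0)),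
    close (allN fun m => allN fun n => (m ≺ n + 1) ⟺ ((m ≺ n) ⋎ (m ≐ n))) }

/-- Bounded-quantifier formulas (set parameters are allowed, set quantifiers are not). -/
inductive IsDelta0 : Fml → Prop
  | eq (s t : Tm) : IsDelta0 (.eq s t)
  | lt (s t : Tm) : IsDelta0 (.lt s t)
  | mem (t : Tm) (X : ℕ) : IsDelta0 (.mem t X)
  | neg {φ : Fml} : IsDelta0 φ → IsDelta0 (.neg φ)
  | and {φ ψ : Fml} : IsDelta0 φ → IsDelta0 ψ → IsDelta0 (.and φ ψ)
  | or {φ ψ : Fml} : IsDelta0 φ → IsDelta0 ψ → IsDelta0 (.or φ ψ)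
  | imp {φ ψ : Fml} : IsDelta0 φ → IsDelta0 ψ → IsDelta0 (.imp φ ψ)
  | ball {x : ℕ} {t : Tm} {φ : Fml} : x ∉ t.vars → IsDelta0 φ →
      IsDelta0 (.all x (.imp (.lt (.var x) t) φ))
  | bex {x : ℕ} {t : Tm} {φ : Fml} : x ∉ t.vars → IsDelta0 φ →
      IsDelta0 (.ex x (.and (.lt (.var x) t) φ))

def IsSigma1 (φ : Fml) : Prop := ∃ (x : ℕ) (θ : Fml), IsDelta0 θ ∧ φ = .ex x θ
def IsPi1 (φ : Fml) : Prop := ∃ (x : ℕ) (θ : Fml), IsDelta0 θ ∧ φ = .all x θ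

/-- Induction for `φ` in the variable `x`. Here `φ(0)` is written `∀ x (x = 0 → φ)`, and
`φ(x + 1)` is written `∀ y (y = x + 1 → ∀ x (x = y → φ))`, with `y` a new variable. -/
def inductionAx (φ : Fml) (x y : ℕ) : Fml :=
  .imp
    (.and
      (.all x (.imp (.eq (.var x) 0) φ))
      (.all x (.imp φ
        (.all y (.imp (.eq (.var y) (.var x + 1)) (.all x (.imp (.eq (.var x) (.var y)) φ)))))))
    (.all x φ)

/-- `∀ x (φ ↔ ψ) → ∃ X ∀ x (x ∈ X ↔ φ)`. -/
def comprehensionAx (φ ψ : Fml) (x X : ℕ) : Fml :=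
  .imp
    (.all x (.and (.imp φ ψ) (.imp ψ φ)))
    (.exS X (.all x (.and (.imp (.mem (.var x) X) φ) (.imp φ (.mem (.var x) X)))))

/-- Recursive comprehension: basic axioms, `Σ⁰₁`-induction, `Δ⁰₁`-comprehension. -/
def RCA0 : Set Fml :=
  basicAxioms ∪
  {χ | ∃ (φ : Fml) (x y : ℕ), IsSigma1 φ ∧ y ≠ x ∧ y ∉ φ.numVars ∧ χ = inductionAx φ x y} ∪
  {χ | ∃ (φ ψ : Fml) (x X : ℕ), IsSigma1 φ ∧ IsPi1 ψ ∧ X ∉ φ.setVars ∧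
    χ = comprehensionAx φ ψ x X}

/-- The pairing `(i, j) = (i + j)² + i`. -/
def pair (i j : Tm) : Tm := (i + j) * (i + j) + i

/-- The `i`-th member of the sequence of sets coded by `P`. -/
def slice (P : Cls) (i : Tm) : Cls := fun t => P (pair i t)

/-- Triples of numbers; they code rational numbers as well as finite binary strings. -/
structure Trip : Type where
  a : Tm
  b : Tm
  c : Tm

def Trip.code (q : Trip) : Tm := pair (pair q.a q.b) q.c

def allT (f : Trip → Bld) : Bld := allN fun a => allN fun b => allN fun c => f ⟨a, b, c⟩
def exT (f : Trip → Bld) : Bld := exN fun a => exN fun b => exN fun c => f ⟨a, b, c⟩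

/-! Finite binary strings: the triple `⟨l, m, n⟩` codes the string of length `l` whose `i`-th entry
is `1` if and only if `m (i + 1) + 1` divides `n`. -/

def bit (s : Trip) (i : Tm) : Bld := exN fun q => q * (s.b * (i + 1) + 1) ≐ s.c

/-- `T` is a tree of binary strings: closed under initial segments (in particular, membership
does not depend on the chosen code of a string). -/
def isTree (T : Cls) : Bld :=
  allT fun s => allT fun t => T s.code ⟹ (t.a ≼ s.a) ⟹
    (allN fun i => (i ≺ t.a) ⟹ (bit t i ⟺ bit s i)) ⟹ T t.code

/-- `T` is infinite, that is, has strings of every length. -/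
def isInfiniteTree (T : Cls) : Bld := allN fun k => exT fun s => (s.a ≐ k) ⋏ T s.code

/-- All finite initial segments of (the characteristic function of) `X` are in `T`. -/
def isPath (T X : Cls) : Bld :=
  allN fun k => exT fun s => (s.a ≐ k) ⋏ T s.code ⋏ (allN fun i => (i ≺ k) ⟹ (X i ⟺ bit s i))

/-- Weak Kőnig's lemma: every infinite binary tree has a path. -/
def weakKonig : Fml :=
  close (allS fun T => isTree T ⟹ isInfiniteTree T ⟹ exS fun X => isPath T X)

def WKL0 : Set Fml := RCA0 ∪ {weakKonig}

/-! ## Rational numbers: the triple `⟨a, b, c⟩` codes `(a - b) / (c + 1)` -/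

def qzero : Trip := ⟨0, 0, 0⟩
def qone : Trip := ⟨1, 0, 0⟩
def recip (c : Tm) : Trip := ⟨1, 0, c⟩
def qadd (p q : Trip) : Trip :=
  ⟨p.a * (q.c + 1) + q.a * (p.c + 1), p.b * (q.c + 1) + q.b * (p.c + 1), p.c * q.c + p.c + q.c⟩
def qneg (p : Trip) : Trip := ⟨p.b, p.a, p.c⟩
def qsub (p q : Trip) : Trip := qadd p (qneg q)
def qle (p q : Trip) : Bld :=
  p.a * (q.c + 1) + q.b * (p.c + 1) ≼ q.a * (p.c + 1) + p.b * (q.c + 1)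
def qlt (p q : Trip) : Bld :=
  p.a * (q.c + 1) + q.b * (p.c + 1) ≺ q.a * (p.c + 1) + p.b * (q.c + 1)

/-- `|p - q| ≤ s`. -/
def qdistLe (p q s : Trip) : Bld := qle p (qadd q s) ⋏ qle q (qadd p s)
/-- `|p - q| < s`. -/
def qdistLt (p q s : Trip) : Bld := qlt p (qadd q s) ⋏ qlt q (qadd p s)

/-- `y = 2 ^ k`: some function `E` satisfies `E 0 = 1`, `E (i + 1) = 2 E i` and `E k = y`. -/
def pow2 (k y : Tm) : Bld :=
  exS fun E =>
    E (pair 0 1) ⋏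
    (allN fun i => allN fun z => E (pair i z) ⟹ E (pair (i + 1) (z + z))) ⋏
    (allN fun i => allN fun z => allN fun w => E (pair i z) ⟹ E (pair i w) ⟹ (z ≐ w)) ⋏
    E (pair k y)

/-- `f(2 ^ (-k))`. -/
def withHalfPow (k : Tm) (f : Trip → Bld) : Bld :=
  exN fun c => pow2 k (c + 1) ⋏ f (recip c)

/-! ## Real numbers: sequences of rationals with `|q_k - q_{k+i}| ≤ 2 ^ (-k)` -/

/-- The `k`-th term of the sequence `X` is the rational (code) `q`. -/
def term (X : Cls) (k : Tm) (q : Trip) : Bld := X (pair k q.code)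

def isReal (X : Cls) : Bld :=
  (allN fun k => exT fun q => term X k q) ⋏
  (allN fun k => allT fun p => allT fun q => term X k p ⟹ term X k q ⟹ (p.code ≐ q.code)) ⋏
  (allN fun k => allN fun i => allT fun p => allT fun q =>
    term X k p ⟹ term X (k + i) q ⟹ withHalfPow k fun ε => qdistLe p q ε)

/-- `x ≤ y`: for all `k`, `x_k ≤ y_k + 2 ^ (-k + 1)`. -/
def realLe (X Y : Cls) : Bld :=
  allN fun k => allT fun p => allT fun q =>
    term X k p ⟹ term Y k q ⟹ withHalfPow k fun ε => qle p (qadd q (qadd ε ε))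

def realLt (X Y : Cls) : Bld := negB (realLe Y X)
def realEq (X Y : Cls) : Bld := realLe X Y ⋏ realLe Y X

/-- The constant sequence `q`. -/
def ratReal (q : Trip) : Cls := fun t => exN fun k => t ≐ pair k q.code

/-- `(x + y)_k = x_{k+1} + y_{k+1}`. -/
def realAdd (X Y : Cls) : Cls := fun t =>
  exN fun k => exT fun p => exT fun q =>
    term X (k + 1) p ⋏ term Y (k + 1) q ⋏ (t ≐ pair k (qadd p q).code)

def realZero : Cls := ratReal qzero
def realOne : Cls := ratReal qone

/-! ## The unit interval and Cantor space as complete separable metric spaces -/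

/-- Points are coded by sets; the elements of a countable dense set are coded by triples. -/
structure Space : Type where
  /-- `x` is (a code of) a point. -/
  point : Cls → Bld
  /-- Equality of points. -/
  same : Cls → Cls → Bld
  /-- `a` codes an element of the dense set. -/
  base : Trip → Bld
  /-- The point given by an element of the dense set. -/
  embed : Trip → Cls
  /-- `d(x, y) < r` for points `x`, `y` and a real `r`. -/
  distLt : Cls → Cls → Cls → Bld

/-- `[0, 1]`, with dense set the rationals in `[0, 1]`. -/
def interval : Space where
  point X := isReal X ⋏ realLe realZero X ⋏ realLe X realOne
  same := realEq
  base a := qle qzero a ⋏ qle a qone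
  embed := ratReal
  distLt X Y r := realLt X (realAdd Y r) ⋏ realLt Y (realAdd X r)

/-- `2^ℕ`, with dense set the finite binary strings followed by zeros. Points are all sets, taken
as characteristic functions; `d(x, y) = 2 ^ (-n)` for the first `n` at which `x` and `y` differ,
and `d(x, x) = 0`. -/
def cantor : Space where
  point _ := 0 ≐ 0
  same X Y := allN fun i => X i ⟺ Y i
  base _ := 0 ≐ 0
  embed s := fun i => (i ≺ s.a) ⋏ bit s i
  distLt X Y r :=
    ((allN fun i => X i ⟺ Y i) ⋏ realLt realZero r) ⋎
    (exN fun n => (allN fun i => (i ≺ n) ⟹ (X i ⟺ Y i)) ⋏ negB (X n ⟺ Y n) ⋏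
      withHalfPow n fun ε => realLt (ratReal ε) r)

/-! ## Codes of continuous functions from a space to the reals -/

/-- `(a, r) Φ (b, s)`: some `(n, a, r, b, s)` is in `Φ`. It says that the ball `B(a, r)` is mapped
into the closed ball about `b` of radius `s`. -/
def rel (Φ : Cls) (a r b s : Trip) : Bld :=
  exN fun n => Φ (pair (pair (pair (pair n a.code) r.code) b.code) s.code)

def isContCode (S : Space) (Φ : Cls) : Bld :=
  (allT fun a => allT fun r => allT fun b => allT fun s =>
    rel Φ a r b s ⟹ S.base a ⋏ qlt qzero r ⋏ qlt qzero s) ⋏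
  (allT fun a => allT fun r => allT fun b => allT fun s => allT fun b' => allT fun s' =>
    rel Φ a r b s ⟹ rel Φ a r b' s' ⟹ qdistLe b b' (qadd s s')) ⋏
  (allT fun a => allT fun r => allT fun b => allT fun s => allT fun a' => allT fun r' =>
    rel Φ a r b s ⟹ S.base a' ⟹ qlt qzero r' ⟹
      S.distLt (S.embed a') (S.embed a) (ratReal (qsub r r')) ⟹ rel Φ a' r' b s) ⋏
  (allT fun a => allT fun r => allT fun b => allT fun s => allT fun b' => allT fun s' =>
    rel Φ a r b s ⟹ qlt qzero s' ⟹ qdistLt b b' (qsub s' s) ⟹ rel Φ a r b' s')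

/-- The point `x` is in the domain of the function coded by `Φ`. -/
def inDom (S : Space) (Φ x : Cls) : Bld :=
  allT fun ε => qlt qzero ε ⟹
    exT fun a => exT fun r => exT fun b => exT fun s =>
      rel Φ a r b s ⋏ S.distLt x (S.embed a) (ratReal r) ⋏ qlt s ε

/-- The function coded by `Φ` is defined at `x`, and has the value `y` there. -/
def value (S : Space) (Φ x y : Cls) : Bld :=
  inDom S Φ x ⋏ isReal y ⋏
  (allT fun a => allT fun r => allT fun b => allT fun s =>
    rel Φ a r b s ⟹ S.distLt x (S.embed a) (ratReal r) ⟹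
      realLe y (ratReal (qadd b s)) ⋏ realLe (ratReal b) (realAdd y (ratReal s)))

/-- `Φ` codes a continuous gauge: a total continuous function with positive values. -/
def isGauge (S : Space) (Φ : Cls) : Bld :=
  isContCode S Φ ⋏
  (allS fun x => S.point x ⟹
    inDom S Φ x ⋏ (allS fun y => value S Φ x y ⟹ realLt realZero y))

/-! ## Cousin's lemma -/

/-- There is a fine cover for the gauge coded by `Φ`: a finite set of points `p_i` (`i < n`),
enumerated without repetition, and positive reals `r_i`, each at most the value of the gauge
at `p_i`, such that the open balls `B(p_i, r_i)` cover the space. -/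
def hasFineCover (S : Space) (Φ : Cls) : Bld :=
  exN fun n => exS fun P => exS fun R =>
    (allN fun i => (i ≺ n) ⟹
      S.point (slice P i) ⋏ isReal (slice R i) ⋏ realLt realZero (slice R i) ⋏
      (exS fun y => value S Φ (slice P i) y ⋏ realLe (slice R i) y)) ⋏
    (allN fun i => allN fun j => (i ≺ j) ⟹ (j ≺ n) ⟹ negB (S.same (slice P i) (slice P j))) ⋏
    (allS fun x => S.point x ⟹ exN fun i => (i ≺ n) ⋏ S.distLt x (slice P i) (slice R i))

/-- There is a fine tagged partition `0 = x_0 ≤ ξ_0 ≤ x_1 ≤ ⋯ ≤ ξ_{n-1} ≤ x_n = 1` of the unit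
interval: `x_{i+1} - x_i` is at most the value at `ξ_i` of the gauge coded by `Φ`. -/
def hasFinePartition (Φ : Cls) : Bld :=
  exN fun n => exS fun X => exS fun Z =>
    (allN fun i => (i ≼ n) ⟹ interval.point (slice X i)) ⋏
    realEq (slice X 0) realZero ⋏ realEq (slice X n) realOne ⋏
    (allN fun i => (i ≺ n) ⟹
      interval.point (slice Z i) ⋏
      realLe (slice X i) (slice Z i) ⋏ realLe (slice Z i) (slice X (i + 1)) ⋏
      (exS fun y => value interval Φ (slice Z i) y ⋏
        realLe (slice X (i + 1)) (realAdd (slice X i) y)))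

/-- Cousin's lemma for continuous gauges on the space `S`, as a sentence. -/
def cousin (S : Space) : Fml := close (allS fun Φ => isGauge S Φ ⟹ hasFineCover S Φ)

/-- The version with tagged partitions, on the unit interval. -/
def cousinPartition : Fml := close (allS fun Φ => isGauge interval Φ ⟹ hasFinePartition Φ)

end SOA

namespace SOA

/-! ## Renaming and coincidence -/

/-! The heart of the matter is that a continuous gauge on either space is bounded below by a
positive rational. Once this is known, no tags have to be selected: evenly spread points with one
constant radius form a fine cover, and equal subintervals tagged at their left ends form a fine
partition.

For the bound, fix a model of `WKL0`. At every point `x` the gauge has a value (`exists_value`), and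
this value is positive, so some condition `(a, r) Φ (b, s)` with `s < b` has `x` in `B(a, r)`
(`IsGauge.exists_rel`); the gauge is at least `b - s` on all of that ball (`Value.le`). Call a
binary string of length `k` secured if a member of `Φ` with code below `k` is such a condition and
its ball contains the dyadic interval, or the cone, of the string. The restriction on the code makes
this property `Δ⁰₁` and inherited by longer strings, and every infinite binary sequence has a
secured initial segment. By weak Kőnig's lemma in the form `WeakKonig.exists_uniform`, all strings
of some length `K` are secured. The denominators of `b` and `s` are then at most `K`, whence `b - s
≥ 1 / K²` (`QCode.le_sub_of_lt`). So the restriction on codes also yields the uniform bound, and no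
minimum over finitely many conditions is formed.

Two devices connect this argument with the formal system. `Delta0` and `Sigma1` describe
definability over a model semantically, with parameters, so that instance search checks the
hypotheses of induction and comprehension; on this basis the numbers become an ordered semiring,
with codes of finite sets, powers of two and a field of fractions. `BldR` evaluates the sentences in
a model, also by instance search. -/

def Tm.ren (ρ : ℕ → ℕ) : Tm → Tm
  | .var n => .var (ρ n)
  | .zero => .zero
  | .one => .one
  | .add s t => .add (s.ren ρ) (t.ren ρ)
  | .mul s t => .mul (s.ren ρ) (t.ren ρ)

def Fml.ren (ρ σ : ℕ → ℕ) : Fml → Fml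
  | .eq s t => .eq (s.ren ρ) (t.ren ρ)
  | .lt s t => .lt (s.ren ρ) (t.ren ρ)
  | .mem t X => .mem (t.ren ρ) (σ X)
  | .neg φ => .neg (φ.ren ρ σ)
  | .and φ ψ => .and (φ.ren ρ σ) (ψ.ren ρ σ)
  | .or φ ψ => .or (φ.ren ρ σ) (ψ.ren ρ σ)
  | .imp φ ψ => .imp (φ.ren ρ σ) (ψ.ren ρ σ)
  | .all x φ => .all (ρ x) (φ.ren ρ σ)
  | .ex x φ => .ex (ρ x) (φ.ren ρ σ)
  | .allS X φ => .allS (σ X) (φ.ren ρ σ)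
  | .exS X φ => .exS (σ X) (φ.ren ρ σ)

theorem Tm.eval_ren (M : Model.{u}) (ρ : ℕ → ℕ) (v : ℕ → M.N) (t : Tm) :
    (t.ren ρ).eval M v = t.eval M (v ∘ ρ) := by
  induction t <;> simp_all [Tm.ren, Tm.eval]

theorem Tm.vars_ren (ρ : ℕ → ℕ) (t : Tm) : (t.ren ρ).vars = ρ '' t.vars := by
  induction t <;> simp_all [Tm.ren, Tm.vars, Set.image_union]

theorem update_comp_injective {α : Type*} {ρ : ℕ → ℕ} (hρ : ρ.Injective) (v : ℕ → α) (x : ℕ)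
    (a : α) : Function.update v (ρ x) a ∘ ρ = Function.update (v ∘ ρ) x a := by
  funext i
  by_cases h : i = x
  · subst h; simp
  · simp [h, hρ.ne h]

/-- Bound variables are renamed along with the free ones, so injectivity is what prevents capture.
-/
theorem Fml.realize_ren (M : Model.{u}) {ρ σ : ℕ → ℕ} (hρ : ρ.Injective) (hσ : σ.Injective)
    (φ : Fml) : ∀ (v : ℕ → M.N) (V : ℕ → M.sets),
      (φ.ren ρ σ).Realize M v V ↔ φ.Realize M (v ∘ ρ) (V ∘ σ) := by
  induction φ <;> intro v V <;>
    simp_all [Fml.ren, Fml.Realize, Tm.eval_ren, update_comp_injective]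

theorem IsDelta0.ren {ρ : ℕ → ℕ} (hρ : ρ.Injective) (σ : ℕ → ℕ) {φ : Fml} (h : IsDelta0 φ) :
    IsDelta0 (φ.ren ρ σ) := by
  induction h with
  | eq s t => exact .eq _ _
  | lt s t => exact .lt _ _
  | mem t X => exact .mem _ _
  | neg _ ih => exact .neg ih
  | and _ _ ih ih' => exact .and ih ih'
  | or _ _ ih ih' => exact .or ih ih'
  | imp _ _ ih ih' => exact .imp ih ih'
  | ball hx _ ih => exact .ball (by rwa [Tm.vars_ren, hρ.mem_set_image]) ih
  | bex hx _ ih => exact .bex (by rwa [Tm.vars_ren, hρ.mem_set_image]) ih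

theorem Tm.eval_congr (M : Model.{u}) {v w : ℕ → M.N} (t : Tm) (h : ∀ i ∈ t.vars, v i = w i) :
    t.eval M v = t.eval M w := by
  induction t with
  | var n => exact h n rfl
  | zero => rfl
  | one => rfl
  | add s t ihs iht =>
    simp only [Tm.eval, ihs fun i hi => h i (.inl hi), iht fun i hi => h i (.inr hi)]
  | mul s t ihs iht =>
    simp only [Tm.eval, ihs fun i hi => h i (.inl hi), iht fun i hi => h i (.inr hi)]

theorem eqOn_update {α β : Type*} [DecidableEq α] {s : Set α} {v w : α → β} {x : α} (a : β)
    (h : ∀ i ∈ s, v i = w i) :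
    ∀ i ∈ s, Function.update v x a i = Function.update w x a i := by
  intro i hi
  by_cases hx : i = x
  · subst hx; simp
  · simp [hx, h i hi]

/-- Agreement is required on bound variables too. This spares a notion of free variable, and the
side conditions of the axioms are stated with the same sets. -/
theorem Fml.realize_congr (M : Model.{u}) (φ : Fml) :
    ∀ {v w : ℕ → M.N} {V W : ℕ → M.sets}, (∀ i ∈ φ.numVars, v i = w i) →
      (∀ i ∈ φ.setVars, V i = W i) → (φ.Realize M v V ↔ φ.Realize M w W) := by
  induction φ with
  | eq s t =>
    intro v w V W h _
    simp only [Fml.Realize, Tm.eval_congr M s fun i hi => h i (.inl hi),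
      Tm.eval_congr M t fun i hi => h i (.inr hi)]
  | lt s t =>
    intro v w V W h _
    simp only [Fml.Realize, Tm.eval_congr M s fun i hi => h i (.inl hi),
      Tm.eval_congr M t fun i hi => h i (.inr hi)]
  | mem t X =>
    intro v w V W h H
    simp only [Fml.Realize, Tm.eval_congr M t h, H X rfl]
  | neg φ ih => intro v w V W h H; exact not_congr (ih h H)
  | and φ ψ ih ih' =>
    intro v w V W h H
    exact and_congr (ih (fun i hi => h i (.inl hi)) fun i hi => H i (.inl hi))
      (ih' (fun i hi => h i (.inr hi)) fun i hi => H i (.inr hi))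
  | or φ ψ ih ih' =>
    intro v w V W h H
    exact or_congr (ih (fun i hi => h i (.inl hi)) fun i hi => H i (.inl hi))
      (ih' (fun i hi => h i (.inr hi)) fun i hi => H i (.inr hi))
  | imp φ ψ ih ih' =>
    intro v w V W h H
    exact imp_congr (ih (fun i hi => h i (.inl hi)) fun i hi => H i (.inl hi))
      (ih' (fun i hi => h i (.inr hi)) fun i hi => H i (.inr hi))
  | all x φ ih =>
    intro v w V W h H
    exact forall_congr' fun a => ih (eqOn_update a fun i hi => h i (.inr hi)) H
  | ex x φ ih =>
    intro v w V W h H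
    exact exists_congr fun a => ih (eqOn_update a fun i hi => h i (.inr hi)) H
  | allS X φ ih =>
    intro v w V W h H
    exact forall_congr' fun a => ih h (eqOn_update a fun i hi => H i (.inr hi))
  | exS X φ ih =>
    intro v w V W h H
    exact exists_congr fun a => ih h (eqOn_update a fun i hi => H i (.inr hi))

theorem Tm.vars_finite (t : Tm) : t.vars.Finite := by
  induction t <;> simp_all [Tm.vars]

theorem Fml.numVars_finite (φ : Fml) : φ.numVars.Finite := by
  induction φ <;> simp_all [Fml.numVars, Tm.vars_finite]

theorem Fml.setVars_finite (φ : Fml) : φ.setVars.Finite := by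
  induction φ <;> simp_all [Fml.setVars]

/-! ## Interleaved assignments -/

/-- Two sequences merged into one. -/
def mix {α : Type*} (v u : ℕ → α) (n : ℕ) : α := if n % 2 = 0 then v (n / 2) else u (n / 2)

@[simp] theorem mix_even {α : Type*} (v u : ℕ → α) (i : ℕ) : mix v u (2 * i) = v i := by
  simp [mix]

@[simp] theorem mix_odd {α : Type*} (v u : ℕ → α) (i : ℕ) : mix v u (2 * i + 1) = u i := by
  simp only [mix, show (2 * i + 1) / 2 = i by omega]
  simp

theorem ext_even_odd {α : Type*} {f g : ℕ → α} (h₀ : ∀ i, f (2 * i) = g (2 * i))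
    (h₁ : ∀ i, f (2 * i + 1) = g (2 * i + 1)) : f = g := by
  funext n
  obtain ⟨k, rfl | rfl⟩ : ∃ k, n = 2 * k ∨ n = 2 * k + 1 := ⟨n / 2, by omega⟩
  exacts [h₀ k, h₁ k]

/-- The renaming `2 i ↦ 2 i`, `2 j + 1 ↦ 2 (g j) + 1`. -/
def oddRen (g : ℕ → ℕ) : ℕ → ℕ := mix (fun i => 2 * i) (fun j => 2 * g j + 1)

theorem oddRen_injective {g : ℕ → ℕ} (hg : g.Injective) : (oddRen g).Injective := by
  intro a b hab
  obtain ⟨k, rfl | rfl⟩ : ∃ k, a = 2 * k ∨ a = 2 * k + 1 := ⟨a / 2, by omega⟩ <;>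
  obtain ⟨l, rfl | rfl⟩ : ∃ k, b = 2 * k ∨ b = 2 * k + 1 := ⟨b / 2, by omega⟩ <;>
  simp only [oddRen, mix_even, mix_odd] at hab
  · exact hab
  · omega
  · omega
  · rw [hg (show g k = g l by omega)]

theorem mix_comp_oddRen {α : Type*} (v w : ℕ → α) (g : ℕ → ℕ) :
    mix v w ∘ oddRen g = mix v (w ∘ g) :=
  ext_even_odd (by simp [oddRen]) (by simp [oddRen])

theorem mix_comp_two_mul {α : Type*} (u u' : ℕ → α) : (mix u u' ∘ fun j => 2 * j) = u := by
  funext j; simp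

theorem mix_comp_two_mul_add_one {α : Type*} (u u' : ℕ → α) :
    (mix u u' ∘ fun j => 2 * j + 1) = u' := by
  funext j; simp

theorem two_mul_injective : Function.Injective (fun j : ℕ => 2 * j) := fun a b h => by
  simp only at h; omega

theorem two_mul_add_one_injective : Function.Injective (fun j : ℕ => 2 * j + 1) := fun a b h => by
  simp only at h; omega

theorem update_mix_even {α : Type*} (v u : ℕ → α) (i : ℕ) (a : α) :
    Function.update (mix v u) (2 * i) a = mix (Function.update v i a) u := by
  refine ext_even_odd (fun j => ?_) (fun j => ?_)
  · by_cases h : j = i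
    · subst h; simp
    · simp [h]
  · rw [Function.update_of_ne (by omega)]; simp

/-- The sequence `a, v 0, v 1, …`. -/
def push {α : Type*} (a : α) (v : ℕ → α) : ℕ → α
  | 0 => a
  | i + 1 => v i

@[simp] theorem push_zero {α : Type*} (a : α) (v : ℕ → α) : push a v 0 = a := rfl
@[simp] theorem push_succ {α : Type*} (a : α) (v : ℕ → α) (i : ℕ) : push a v (i + 1) = v i := rfl

@[simp] theorem update_push_zero {α : Type*} (a b : α) (v : ℕ → α) :
    Function.update (push a v) 0 b = push b v := by
  funext i; cases i <;> simp

@[simp] theorem update_push_succ {α : Type*} (a b : α) (v : ℕ → α) (i : ℕ) :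
    Function.update (push a v) (i + 1) b = push a (Function.update v i b) := by
  funext j
  cases j with
  | zero => simp
  | succ j =>
    by_cases h : j = i
    · subst h; simp
    · simp [h]

/-! ## Semantic definability

Functions and predicates of assignments, with arbitrary number and set parameters. -/

/-- Declared as a class, like `Delta0` and `Sigma1`, so that definability is found by instance
search. -/
class inductive TermFn (M : Model.{u}) : ((ℕ → M.N) → M.N) → Prop
  | var (i : ℕ) : TermFn M fun v => v i
  | const (c : M.N) : TermFn M fun _ => c
  | add {f g : (ℕ → M.N) → M.N} : TermFn M f → TermFn M g → TermFn M fun v => M.add (f v) (g v)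
  | mul {f g : (ℕ → M.N) → M.N} : TermFn M f → TermFn M g → TermFn M fun v => M.mul (f v) (g v)

/-- Variables are positional: in `ball` the bound variable takes place `0`, the others move up by
one, and the bound is read outside the quantifier. The remaining connectives are derived
classically. -/
class inductive Delta0 (M : Model.{u}) : ((ℕ → M.N) → Prop) → Prop
  | eq {f g : (ℕ → M.N) → M.N} : TermFn M f → TermFn M g → Delta0 M fun v => f v = g v
  | lt {f g : (ℕ → M.N) → M.N} : TermFn M f → TermFn M g → Delta0 M fun v => M.lt (f v) (g v)
  | mem {f : (ℕ → M.N) → M.N} (A : M.sets) : TermFn M f → Delta0 M fun v => f v ∈ A.1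
  | neg {P : (ℕ → M.N) → Prop} : Delta0 M P → Delta0 M fun v => ¬ P v
  | and {P Q : (ℕ → M.N) → Prop} : Delta0 M P → Delta0 M Q → Delta0 M fun v => P v ∧ Q v
  | ball {f : (ℕ → M.N) → M.N} {P : (ℕ → M.N) → Prop} : TermFn M f → Delta0 M P →
      Delta0 M fun v => ∀ x, M.lt x (f v) → P (push x v)

section Definability

variable {M : Model.{u}}

theorem TermFn.subst {f : (ℕ → M.N) → M.N} (hf : TermFn M f) {σ : ℕ → (ℕ → M.N) → M.N}
    (hσ : ∀ i, TermFn M (σ i)) : TermFn M fun v => f fun i => σ i v := by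
  induction hf with
  | var i => exact hσ i
  | const c => exact .const c
  | add _ _ ih ih' => exact .add ih ih'
  | mul _ _ ih ih' => exact .mul ih ih'

theorem Delta0.subst {P : (ℕ → M.N) → Prop} (hP : Delta0 M P) :
    ∀ {σ : ℕ → (ℕ → M.N) → M.N}, (∀ i, TermFn M (σ i)) → Delta0 M fun v => P fun i => σ i v := by
  induction hP with
  | eq hf hg => intro σ hσ; exact .eq (hf.subst hσ) (hg.subst hσ)
  | lt hf hg => intro σ hσ; exact .lt (hf.subst hσ) (hg.subst hσ)
  | mem A hf => intro σ hσ; exact .mem A (hf.subst hσ)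
  | neg _ ih => intro σ hσ; exact .neg (ih hσ)
  | and _ _ ih ih' => intro σ hσ; exact .and (ih hσ) (ih' hσ)
  | @ball f P hf _ ih =>
    intro σ hσ
    -- Below the quantifier the substitution fixes variable `0` and applies `σ` to the shifted
    -- assignment.
    have h := ih (σ := fun i => Nat.casesOn i (fun v => v 0) fun i v => σ i fun j => v (j + 1)) (by
      rintro (_ | i)
      · exact .var 0
      · exact (hσ i).subst fun j => .var (j + 1))
    convert Delta0.ball (hf.subst hσ) h using 7 with _ _ _ i
    cases i <;> rfl

/-- A term representing a function, with parameters at the odd variables. -/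
theorem TermFn.exists_tm {f : (ℕ → M.N) → M.N} (hf : TermFn M f) :
    ∃ (t : Tm) (u : ℕ → M.N), ∀ v, f v = t.eval M (mix v u) := by
  induction hf with
  | var i => exact ⟨.var (2 * i), fun _ => M.zero, fun v => by simp [Tm.eval]⟩
  | const c => exact ⟨.var (2 * 0 + 1), fun _ => c, fun v => by simp only [Tm.eval, mix_odd]⟩
  | @add f g _ _ ih ih' =>
    obtain ⟨s, u, hs⟩ := ih
    obtain ⟨t, u', ht⟩ := ih'
    refine ⟨.add (s.ren (oddRen fun j => 2 * j)) (t.ren (oddRen fun j => 2 * j + 1)), mix u u',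
      fun v => ?_⟩
    simp only [Tm.eval, Tm.eval_ren, mix_comp_oddRen, mix_comp_two_mul, mix_comp_two_mul_add_one,
      hs, ht]
  | @mul f g _ _ ih ih' =>
    obtain ⟨s, u, hs⟩ := ih
    obtain ⟨t, u', ht⟩ := ih'
    refine ⟨.mul (s.ren (oddRen fun j => 2 * j)) (t.ren (oddRen fun j => 2 * j + 1)), mix u u',
      fun v => ?_⟩
    simp only [Tm.eval, Tm.eval_ren, mix_comp_oddRen, mix_comp_two_mul, mix_comp_two_mul_add_one,
      hs, ht]

/-- `φ` represents `P`, with number parameters `u` at the odd variables, set parameters `V`. -/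
def Represents (φ : Fml) (u : ℕ → M.N) (V : ℕ → M.sets) (P : (ℕ → M.N) → Prop) : Prop :=
  IsDelta0 φ ∧ ∀ v, P v ↔ φ.Realize M (mix v u) V

/-- The parameters of one formula move to the even parameter places and those of the other to the
odd ones, so a single assignment serves both. -/
theorem Represents.merge {φ ψ : Fml} {u u' : ℕ → M.N} {V V' : ℕ → M.sets}
    {P Q : (ℕ → M.N) → Prop} (hP : Represents φ u V P) (hQ : Represents ψ u' V' Q) :
    ∃ φ' ψ' u'' V'', Represents φ' u'' V'' P ∧ Represents ψ' u'' V'' Q := by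
  have h0 := oddRen_injective two_mul_injective
  have h1 := oddRen_injective two_mul_add_one_injective
  refine ⟨φ.ren (oddRen fun j => 2 * j) (fun j => 2 * j),
    ψ.ren (oddRen fun j => 2 * j + 1) (fun j => 2 * j + 1), mix u u', mix V V',
    ⟨hP.1.ren h0 _, fun v => ?_⟩, ⟨hQ.1.ren h1 _, fun v => ?_⟩⟩
  · rw [Fml.realize_ren M h0 two_mul_injective, mix_comp_oddRen, mix_comp_two_mul,
      mix_comp_two_mul, hP.2]
  · rw [Fml.realize_ren M h1 two_mul_add_one_injective, mix_comp_oddRen, mix_comp_two_mul_add_one,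
      mix_comp_two_mul_add_one, hQ.2]

/-- Makes room for a new bound variable, named `1`. -/
def bindRen : ℕ → ℕ := mix (push 1 fun i => 2 * i) (fun j => 2 * (2 * j + 2) + 1)

theorem bindRen_injective : bindRen.Injective := by
  intro a b hab
  obtain ⟨k, rfl | rfl⟩ : ∃ k, a = 2 * k ∨ a = 2 * k + 1 := ⟨a / 2, by omega⟩ <;>
  obtain ⟨l, rfl | rfl⟩ : ∃ k, b = 2 * k ∨ b = 2 * k + 1 := ⟨b / 2, by omega⟩ <;>
  simp only [bindRen, mix_even, mix_odd] at hab
  · cases k <;> cases l <;> simp_all; omega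
  · cases k <;> simp_all; omega
  · cases l <;> simp_all; omega
  · omega

theorem Delta0.exists_represents {P : (ℕ → M.N) → Prop} (hP : Delta0 M P) :
    ∃ φ u V, Represents φ u V P := by
  have V₀ : ℕ → M.sets := fun _ => ⟨_, M.sets_nonempty.choose_spec⟩
  induction hP with
  | @eq f g hf hg =>
    obtain ⟨s, u, hs⟩ := hf.exists_tm
    obtain ⟨t, u', ht⟩ := hg.exists_tm
    refine ⟨.eq (s.ren (oddRen fun j => 2 * j)) (t.ren (oddRen fun j => 2 * j + 1)), mix u u', V₀,
      .eq _ _, fun v => ?_⟩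
    simp only [Fml.Realize, Tm.eval_ren, mix_comp_oddRen, mix_comp_two_mul,
      mix_comp_two_mul_add_one, hs, ht]
  | @lt f g hf hg =>
    obtain ⟨s, u, hs⟩ := hf.exists_tm
    obtain ⟨t, u', ht⟩ := hg.exists_tm
    refine ⟨.lt (s.ren (oddRen fun j => 2 * j)) (t.ren (oddRen fun j => 2 * j + 1)), mix u u', V₀,
      .lt _ _, fun v => ?_⟩
    simp only [Fml.Realize, Tm.eval_ren, mix_comp_oddRen, mix_comp_two_mul,
      mix_comp_two_mul_add_one, hs, ht]
  | @mem f A hf =>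
    obtain ⟨t, u, ht⟩ := hf.exists_tm
    exact ⟨.mem t 0, u, fun _ => A, .mem _ _, fun v => by simp only [Fml.Realize, ht]⟩
  | neg _ ih =>
    obtain ⟨φ, u, V, h⟩ := ih
    exact ⟨.neg φ, u, V, .neg h.1, fun v => not_congr (h.2 v)⟩
  | and _ _ ih ih' =>
    obtain ⟨φ, u, V, h⟩ := ih
    obtain ⟨ψ, u', V', h'⟩ := ih'
    obtain ⟨φ, ψ, u, V, h, h'⟩ := h.merge h'
    exact ⟨.and φ ψ, u, V, .and h.1 h'.1, fun v => and_congr (h.2 v) (h'.2 v)⟩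
  | @ball f P hf _ ih =>
    obtain ⟨t, u, ht⟩ := hf.exists_tm
    obtain ⟨φ, u', V, h⟩ := ih
    -- Variable `1` is parameter place `0`, vacated for the bound variable and filled with a dummy.
    -- The parameters `u` of the bounding term then occupy the odd places, and the parameters `u'`
    -- of the matrix the even places from `2` on.
    refine ⟨.all 1 (.imp (.lt (.var 1) (t.ren (oddRen fun j => 2 * j + 1)))
      (φ.ren bindRen id)), push M.zero (mix u u'), V,
      .ball ?_ (h.1.ren bindRen_injective _), fun v => ?_⟩
    · rw [Tm.vars_ren]
      rintro ⟨n, -, hn⟩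
      obtain ⟨k, rfl | rfl⟩ : ∃ k, n = 2 * k ∨ n = 2 * k + 1 := ⟨n / 2, by omega⟩ <;>
      simp only [oddRen, mix_even, mix_odd] at hn <;> omega
    · simp only [Fml.Realize]
      refine forall_congr' fun a => ?_
      rw [Fml.realize_ren M bindRen_injective Function.injective_id, Tm.eval_ren, h.2, ht, Tm.eval]
      have h1 : Function.update (mix v (push M.zero (mix u u'))) 1 a
          = mix v (push a (mix u u')) := by
        refine ext_even_odd (fun j => ?_) (fun j => ?_)
        · rw [Function.update_of_ne (by omega)]; simp
        · cases j with
          | zero => exact (Function.update_self ..).trans rfl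
          | succ j => rw [Function.update_of_ne (by omega)]; simp
      have h2 : mix v (push a (mix u u')) ∘ bindRen = mix (push a v) u' := by
        refine ext_even_odd (fun j => ?_) (fun j => ?_)
        · cases j with
          | zero => exact mix_odd v _ 0
          | succ j => simp [bindRen]
        · simp only [bindRen, Function.comp, mix_odd]
          exact mix_odd u u' j
      have h3 : mix v (push a (mix u u')) ∘ (oddRen fun j => 2 * j + 1) = mix v u := by
        rw [mix_comp_oddRen]
        congr 1
        funext j
        exact mix_even u u' j
      rw [h1, h2, h3, Function.comp_id]
      exact Iff.rfl

/-- `P` is definable by a formula with one unbounded existential quantifier. -/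
class Sigma1 (M : Model.{u}) (P : (ℕ → M.N) → Prop) : Prop where
  out : ∃ Q, Delta0 M Q ∧ ∀ v, P v ↔ ∃ x, Q (push x v)

theorem Delta0.of_iff {P Q : (ℕ → M.N) → Prop} (hP : Delta0 M P) (h : ∀ v, Q v ↔ P v) :
    Delta0 M Q := by
  rwa [show Q = P from funext fun v => propext (h v)]

theorem Sigma1.of_iff {P Q : (ℕ → M.N) → Prop} (hP : Sigma1 M P) (h : ∀ v, Q v ↔ P v) :
    Sigma1 M Q := by
  rwa [show Q = P from funext fun v => propext (h v)]

instance (priority := 100) Sigma1.of_delta0 (P : (ℕ → M.N) → Prop) [hP : Delta0 M P] :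
    Sigma1 M P :=
  ⟨_, hP.subst (σ := fun i v => v (i + 1)) fun _ => .var _,
    fun _ => ⟨fun h => ⟨M.zero, h⟩, fun ⟨_, h⟩ => h⟩⟩

/-- The quantifier binds the variable that holds `b`, so `b` is a mere placeholder. -/
theorem Represents.realize_ex {φ : Fml} {u : ℕ → M.N} {V : ℕ → M.sets} {Q : (ℕ → M.N) → Prop}
    (h : Represents φ u V Q) (b : M.N) (v : ℕ → M.N) :
    (Fml.ex 0 φ).Realize M (mix (push b v) u) V ↔ ∃ x, Q (push x v) := by
  refine exists_congr fun a => ?_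
  rw [show (0 : ℕ) = 2 * 0 from rfl, update_mix_even, update_push_zero, h.2]

end Definability

/-! ## Models of `RCA₀` -/

class IsRCA0 (M : Model.{u}) : Prop where
  satisfies : ∀ ψ ∈ RCA0, M.Satisfies ψ

section RCA0

variable {M : Model.{u}} [hM : IsRCA0 M]

theorem sigma1_induction_raw {P : M.N → Prop} (hP : Sigma1 M fun v => P (v 0)) (h0 : P M.zero)
    (hs : ∀ x, P x → P (M.add x M.one)) (x : M.N) : P x := by
  obtain ⟨Q, hQ, hPQ⟩ := hP
  obtain ⟨φ, u, V, h⟩ := hQ.exists_represents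
  obtain ⟨y, hy⟩ := (((Fml.ex 0 φ).numVars_finite).union (Set.finite_singleton 2)).exists_notMem
  have hy2 : y ≠ 2 := fun h => hy (.inr h)
  have hyφ : y ∉ (Fml.ex 0 φ).numVars := fun h => hy (.inl h)
  have hax := hM.satisfies (inductionAx (.ex 0 φ) 2 y)
    (.inl (.inr ⟨_, 2, y, ⟨0, φ, h.1, rfl⟩, hy2, hyφ, rfl⟩))
  have key : ∀ a, (Fml.ex 0 φ).Realize M
      (Function.update (mix (push M.zero fun _ => M.zero) u) 2 a) V ↔ P a := fun a => by
    rw [show (2 : ℕ) = 2 * (0 + 1) from rfl, update_mix_even, update_push_succ, h.realize_ex,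
      ← hPQ]
    simp
  -- The axiom reaches `φ(x + 1)` by rebinding variable `2` below `y`. As `y` does not occur in the
  -- formula, only the last update matters.
  have key' : ∀ a b c, (Fml.ex 0 φ).Realize M (Function.update (Function.update
      (Function.update (mix (push M.zero fun _ => M.zero) u) 2 a) y b) 2 c) V ↔ P c :=
      fun a b c => by
    rw [← key c]
    refine Fml.realize_congr M _ (fun i hi => ?_) fun _ _ => rfl
    have hiy : i ≠ y := fun h => hyφ (h ▸ hi)
    by_cases h2 : i = 2
    · subst h2; simp
    · simp [h2, hiy]
  have hax := hax (mix (push M.zero fun _ => M.zero) u) V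
  unfold inductionAx at hax
  rw [Fml.Realize] at hax
  refine (key x).1 (hax ⟨fun a ha => ?_, fun a ha b hb c hc => ?_⟩ x)
  · rw [key]
    have : a = M.zero := by simpa [Fml.Realize, Tm.eval] using ha
    rwa [this]
  · rw [key']
    have hc : c = b := by simpa [Fml.Realize, Tm.eval, hy2] using hc
    have hb : b = M.add a M.one := by
      have hb : Function.update (Function.update (mix (push M.zero fun _ => M.zero) u) 2 a) y b y
        = M.add (Function.update (Function.update (mix (push M.zero fun _ => M.zero) u) 2 a) y b 2)
          M.one := hb
      simpa [hy2.symm] using hb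
    rw [hc, hb]
    exact hs a ((key a).1 ha)

/-- `Δ⁰₁`-comprehension. -/
theorem exists_set_of_sigma1 (P : M.N → Prop) [hP : Sigma1 M fun v => P (v 0)]
    [hP' : Sigma1 M fun v => ¬ P (v 0)] : ∃ A : M.sets, ∀ x, x ∈ A.1 ↔ P x := by
  obtain ⟨Q, hQ, hPQ⟩ := hP
  obtain ⟨Q', hQ', hPQ'⟩ := hP'
  obtain ⟨φ, u, V, h⟩ := hQ.exists_represents
  obtain ⟨ψ, u', V', h'⟩ := hQ'.exists_represents
  obtain ⟨φ, ψ, u, V, h, h'⟩ := h.merge h'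
  obtain ⟨X, hX⟩ := (Fml.ex 0 φ).setVars_finite.exists_notMem
  -- The `Σ⁰₁` definition of the complement, negated, is the `Π⁰₁` form that the axiom asks for.
  have hax := hM.satisfies (comprehensionAx (.ex 0 φ) (.all 0 (.neg ψ)) 2 X)
    (.inr ⟨_, _, 2, X, ⟨0, φ, h.1, rfl⟩, ⟨0, .neg ψ, .neg h'.1, rfl⟩, hX, rfl⟩)
  have hax := hax (mix (push M.zero fun _ => M.zero) u) V
  have key : ∀ a, (Fml.ex 0 φ).Realize M
      (Function.update (mix (push M.zero fun _ => M.zero) u) 2 a) V ↔ P a := fun a => by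
    rw [show (2 : ℕ) = 2 * (0 + 1) from rfl, update_mix_even, update_push_succ, h.realize_ex,
      ← hPQ]
    simp
  have key' : ∀ a, (Fml.all 0 (.neg ψ)).Realize M
      (Function.update (mix (push M.zero fun _ => M.zero) u) 2 a) V ↔ P a := fun a => by
    have : (Fml.ex 0 ψ).Realize M
      (Function.update (mix (push M.zero fun _ => M.zero) u) 2 a) V ↔ ¬ P a := by
      rw [show (2 : ℕ) = 2 * (0 + 1) from rfl, update_mix_even, update_push_succ, h'.realize_ex,
        ← hPQ']
      simp
    rw [← not_iff_comm.1 this.symm]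
    simp only [Fml.Realize, not_exists]
  obtain ⟨A, hA⟩ := hax fun a => ⟨fun ha => (key' a).2 ((key a).1 ha),
    fun ha => (key a).2 ((key' a).1 ha)⟩
  refine ⟨A, fun a => ?_⟩
  have h1 := hA a
  have h2 : ∀ w, (Fml.ex 0 φ).Realize M w (Function.update V X A) ↔ (Fml.ex 0 φ).Realize M w V :=
    fun w => Fml.realize_congr M _ (fun _ _ => rfl) fun i hi => by
      rw [Function.update_of_ne]; exact fun h => hX (h ▸ hi)
  rw [← key a, ← h2]
  have h3 : (Fml.mem (.var 2) X).Realize M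
      (Function.update (mix (push M.zero fun _ => M.zero) u) 2 a) (Function.update V X A) ↔
      a ∈ A.1 := by
    simp [Fml.Realize, Tm.eval]
  rw [← h3]
  exact ⟨h1.1, h1.2⟩

end RCA0

end SOA


namespace SOA

/-! ### Closure properties of definability as instances -/

section

variable {M : Model.{u}} {f g : (ℕ → M.N) → M.N} {P Q : (ℕ → M.N) → Prop}

instance (i : ℕ) : TermFn M fun v => v i := .var i
instance (c : M.N) : TermFn M fun _ => c := .const c

instance [hf : TermFn M f] [hg : TermFn M g] : TermFn M fun v => M.add (f v) (g v) := hf.add hg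
instance [hf : TermFn M f] [hg : TermFn M g] : TermFn M fun v => M.mul (f v) (g v) := hf.mul hg

/-- Needed below quantifiers, where the outer variables appear shifted. -/
instance TermFn.comp [hf : TermFn M f] (s : ℕ → ℕ) : TermFn M fun v => f fun i => v (s i) :=
  hf.subst fun i => .var (s i)

instance [hf : TermFn M f] [hg : TermFn M g] : Delta0 M fun v => f v = g v := .eq hf hg
instance [hf : TermFn M f] [hg : TermFn M g] : Delta0 M fun v => M.lt (f v) (g v) := .lt hf hg
instance Delta0.mem_set [hf : TermFn M f] (A : M.sets) : Delta0 M fun v => f v ∈ A.1 := .mem A hf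
instance [hP : Delta0 M P] : Delta0 M fun v => ¬ P v := hP.neg
instance [hP : Delta0 M P] [hQ : Delta0 M Q] : Delta0 M fun v => P v ∧ Q v := hP.and hQ
instance [hP : Delta0 M P] [hQ : Delta0 M Q] : Delta0 M fun v => P v ∨ Q v :=
  (hP.neg.and hQ.neg).neg.of_iff fun v => by tauto
instance [hP : Delta0 M P] [hQ : Delta0 M Q] : Delta0 M fun v => P v → Q v :=
  (hP.and hQ.neg).neg.of_iff fun v => by tauto
instance [hP : Delta0 M P] [hQ : Delta0 M Q] : Delta0 M fun v => P v ↔ Q v :=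
  (((hP.and hQ.neg).neg).and ((hQ.and hP.neg).neg)).of_iff fun v => by tauto

instance Sigma1.ex_delta0 {P : (ℕ → M.N) → M.N → Prop}
    [hP : Delta0 M fun v => P (fun i => v (i + 1)) (v 0)] : Sigma1 M fun v => ∃ x, P v x :=
  ⟨_, hP, fun _ => Iff.rfl⟩

end

/-! ## The ordered semiring of numbers -/

section RawArithmetic

variable {M : Model.{u}} [hM : IsRCA0 M]

namespace Model

theorem satisfies_basic {A : Bld} (h : close A ∈ basicAxioms) :
    ∃ V : ℕ → M.sets, (close A).Realize M (fun _ => M.zero) V :=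
  ⟨fun _ => ⟨_, M.sets_nonempty.choose_spec⟩, hM.satisfies _ (.inl (.inl h)) _ _⟩

theorem add_one_ne_zero (a : M.N) : M.add a M.one ≠ M.zero :=
  have ⟨_, h⟩ := satisfies_basic (M := M) (.inl rfl)
  h a

theorem add_one_cancel {a b : M.N} : M.add a M.one = M.add b M.one → a = b :=
  have ⟨_, h⟩ := satisfies_basic (M := M) (.inr (.inl rfl))
  h a b

theorem add_zero_raw (a : M.N) : M.add a M.zero = a :=
  have ⟨_, h⟩ := satisfies_basic (M := M) (.inr (.inr (.inl rfl)))
  h a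

theorem add_add_one_raw (a b : M.N) : M.add a (M.add b M.one) = M.add (M.add a b) M.one :=
  have ⟨_, h⟩ := satisfies_basic (M := M) (.inr (.inr (.inr (.inl rfl))))
  h a b

theorem mul_zero_raw (a : M.N) : M.mul a M.zero = M.zero :=
  have ⟨_, h⟩ := satisfies_basic (M := M) (.inr (.inr (.inr (.inr (.inl rfl)))))
  h a

theorem mul_add_one_raw (a b : M.N) : M.mul a (M.add b M.one) = M.add (M.mul a b) a :=
  have ⟨_, h⟩ := satisfies_basic (M := M) (.inr (.inr (.inr (.inr (.inr (.inl rfl))))))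
  h a b

theorem not_lt_zero_raw (a : M.N) : ¬ M.lt a M.zero :=
  have ⟨_, h⟩ := satisfies_basic (M := M) (.inr (.inr (.inr (.inr (.inr (.inr (.inl rfl)))))))
  h a

theorem lt_add_one_raw (a b : M.N) : M.lt a (M.add b M.one) ↔ M.lt a b ∨ a = b :=
  have ⟨_, h⟩ := satisfies_basic (M := M) (.inr (.inr (.inr (.inr (.inr (.inr (.inr rfl)))))))
  ⟨(h a b).1, (h a b).2⟩

theorem zero_add_raw (a : M.N) : M.add M.zero a = a := by
  refine sigma1_induction_raw (P := fun a => M.add M.zero a = a) inferInstance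
    (add_zero_raw _) (fun x hx => ?_) a
  rw [add_add_one_raw, hx]

theorem add_one_add_raw (a b : M.N) : M.add (M.add a M.one) b = M.add (M.add a b) M.one := by
  refine sigma1_induction_raw (P := fun b => M.add (M.add a M.one) b = M.add (M.add a b) M.one)
    inferInstance (by simp only [add_zero_raw]) (fun x hx => ?_) b
  rw [add_add_one_raw, hx, add_add_one_raw]

theorem add_comm_raw (a b : M.N) : M.add a b = M.add b a := by
  refine sigma1_induction_raw (P := fun b => M.add a b = M.add b a) inferInstance
    (by rw [add_zero_raw, zero_add_raw]) (fun x hx => ?_) b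
  rw [add_add_one_raw, hx, add_one_add_raw]

theorem add_assoc_raw (a b c : M.N) : M.add (M.add a b) c = M.add a (M.add b c) := by
  refine sigma1_induction_raw (P := fun c => M.add (M.add a b) c = M.add a (M.add b c))
    inferInstance (by simp only [add_zero_raw]) (fun x hx => ?_) c
  rw [add_add_one_raw, hx, add_add_one_raw, add_add_one_raw]

theorem add_cancel_raw {a b c : M.N} (h : M.add a c = M.add b c) : a = b := by
  refine sigma1_induction_raw (P := fun c => M.add a c = M.add b c → a = b) inferInstance
    (by simp only [add_zero_raw]; exact id) (fun x hx h => ?_) c h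
  rw [add_add_one_raw, add_add_one_raw] at h
  exact hx (add_one_cancel h)

theorem zero_mul_raw (a : M.N) : M.mul M.zero a = M.zero := by
  refine sigma1_induction_raw (P := fun a => M.mul M.zero a = M.zero) inferInstance
    (mul_zero_raw _) (fun x hx => ?_) a
  rw [mul_add_one_raw, hx, add_zero_raw]

theorem add_one_mul_raw (a b : M.N) : M.mul (M.add a M.one) b = M.add (M.mul a b) b := by
  refine sigma1_induction_raw (P := fun b => M.mul (M.add a M.one) b = M.add (M.mul a b) b)
    inferInstance (by simp only [mul_zero_raw, add_zero_raw]) (fun x hx => ?_) b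
  rw [mul_add_one_raw, hx, mul_add_one_raw, add_add_one_raw _ x, add_add_one_raw _ a,
    add_assoc_raw _ x a, add_comm_raw x a, ← add_assoc_raw]

theorem mul_comm_raw (a b : M.N) : M.mul a b = M.mul b a := by
  refine sigma1_induction_raw (P := fun b => M.mul a b = M.mul b a) inferInstance
    (by rw [mul_zero_raw, zero_mul_raw]) (fun x hx => ?_) b
  rw [mul_add_one_raw, hx, add_one_mul_raw]

theorem mul_add_raw (a b c : M.N) : M.mul a (M.add b c) = M.add (M.mul a b) (M.mul a c) := by
  refine sigma1_induction_raw (P := fun c => M.mul a (M.add b c) = M.add (M.mul a b) (M.mul a c))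
    inferInstance (by simp only [mul_zero_raw, add_zero_raw]) (fun x hx => ?_) c
  rw [add_add_one_raw, mul_add_one_raw, hx, mul_add_one_raw, add_assoc_raw]

theorem mul_assoc_raw (a b c : M.N) : M.mul (M.mul a b) c = M.mul a (M.mul b c) := by
  refine sigma1_induction_raw (P := fun c => M.mul (M.mul a b) c = M.mul a (M.mul b c))
    inferInstance (by simp only [mul_zero_raw]) (fun x hx => ?_) c
  rw [mul_add_one_raw, hx, mul_add_one_raw, mul_add_raw]

theorem one_eq_raw : M.add M.zero M.one = M.one := zero_add_raw _

theorem mul_one_raw (a : M.N) : M.mul a M.one = a := by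
  rw [← one_eq_raw, mul_add_one_raw, mul_zero_raw, zero_add_raw]

theorem zero_or_add_one (a : M.N) : a = M.zero ∨ ∃ b, a = M.add b M.one :=
  sigma1_induction_raw (P := fun a => a = M.zero ∨ ∃ b, a = M.add b M.one)
    (Sigma1.of_iff (P := fun v => ∃ b, v 0 = M.zero ∨ v 0 = M.add b M.one) inferInstance
      fun v => by simp [exists_or, show Nonempty M.N from ⟨M.zero⟩])
    (.inl rfl) (fun x _ => .inr ⟨x, rfl⟩) a

/-- The axioms fix the order only through `0` and successor. This additive description makes
transitivity and compatibility with the operations a matter of algebra. -/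
theorem lt_iff_raw (a b : M.N) : M.lt a b ↔ ∃ c, b = M.add a (M.add c M.one) := by
  constructor
  · refine sigma1_induction_raw (P := fun b => M.lt a b → ∃ c, b = M.add a (M.add c M.one))
      (Sigma1.of_iff (P := fun v => ∃ c, M.lt a (v 0) → v 0 = M.add a (M.add c M.one))
        inferInstance fun v => ?_) (fun h => (not_lt_zero_raw _ h).elim) (fun x hx h => ?_) b
    · by_cases hv : M.lt a (v 0)
      · simp [hv]
      · simpa [hv] using ⟨M.zero⟩
    · rcases (lt_add_one_raw _ _).1 h with h | rfl
      · obtain ⟨c, rfl⟩ := hx h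
        exact ⟨M.add c M.one, by rw [← add_add_one_raw]⟩
      · exact ⟨M.zero, by rw [one_eq_raw]⟩
  · rintro ⟨c, rfl⟩
    refine sigma1_induction_raw (P := fun c => M.lt a (M.add a (M.add c M.one))) inferInstance ?_
      (fun x hx => ?_) c
    · rw [one_eq_raw, lt_add_one_raw]; exact .inr rfl
    · rw [add_add_one_raw, lt_add_one_raw]; exact .inl hx

theorem lt_irrefl_raw (a : M.N) : ¬ M.lt a a := by
  rw [lt_iff_raw]
  rintro ⟨c, h⟩
  rw [add_comm_raw] at h
  nth_rw 1 [← zero_add_raw a] at h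
  exact add_one_ne_zero _ (add_cancel_raw h).symm

theorem lt_trans_raw {a b c : M.N} (hab : M.lt a b) (hbc : M.lt b c) : M.lt a c := by
  rw [lt_iff_raw] at *
  obtain ⟨d, rfl⟩ := hab
  obtain ⟨e, rfl⟩ := hbc
  exact ⟨M.add (M.add d M.one) e, by rw [add_assoc_raw, ← add_add_one_raw]⟩

theorem lt_trichotomy_raw (a b : M.N) : M.lt a b ∨ a = b ∨ M.lt b a := by
  refine sigma1_induction_raw (P := fun b => M.lt a b ∨ a = b ∨ M.lt b a) inferInstance ?_
      (fun x hx => ?_) b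
  · rcases zero_or_add_one a with rfl | ⟨c, rfl⟩
    · exact .inr (.inl rfl)
    · exact .inr (.inr ((lt_iff_raw _ _).2 ⟨c, by rw [zero_add_raw]⟩))
  · rw [lt_add_one_raw]
    rcases hx with h | h | h
    · exact .inl (.inl h)
    · exact .inl (.inr h)
    · obtain ⟨c, rfl⟩ := (lt_iff_raw _ _).1 h
      rcases zero_or_add_one c with rfl | ⟨c, rfl⟩
      · rw [one_eq_raw]; exact .inr (.inl rfl)
      · refine .inr (.inr ((lt_iff_raw _ _).2 ⟨c, ?_⟩))
        rw [add_one_add_raw x, add_add_one_raw x (M.add _ _)]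

instance : Zero M.N := ⟨M.zero⟩
instance : One M.N := ⟨M.one⟩
instance : Add M.N := ⟨M.add⟩
instance : Mul M.N := ⟨M.mul⟩

instance : CommSemiring M.N where
  nsmul := nsmulRec
  npow := npowRec
  add_assoc := add_assoc_raw
  zero_add := zero_add_raw
  add_zero := add_zero_raw
  add_comm := add_comm_raw
  left_distrib := mul_add_raw
  right_distrib a b c := by
    change M.mul (M.add a b) c = M.add (M.mul a c) (M.mul b c)
    rw [mul_comm_raw, mul_add_raw, mul_comm_raw c a, mul_comm_raw c b]
  zero_mul := zero_mul_raw
  mul_zero := mul_zero_raw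
  mul_assoc := mul_assoc_raw
  one_mul a := (mul_comm_raw _ _).trans (mul_one_raw a)
  mul_one := mul_one_raw
  mul_comm := mul_comm_raw

noncomputable instance : LinearOrder M.N where
  le a b := M.lt a b ∨ a = b
  lt := M.lt
  le_refl a := .inr rfl
  le_trans a b c := by
    rintro (hab | rfl) (hbc | rfl)
    exacts [.inl (lt_trans_raw hab hbc), .inl hab, .inl hbc, .inr rfl]
  lt_iff_le_not_ge a b := by
    constructor
    · refine fun h => ⟨.inl h, ?_⟩
      rintro (h' | rfl)
      exacts [lt_irrefl_raw _ (lt_trans_raw h h'), lt_irrefl_raw _ h]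
    · rintro ⟨h | rfl, h'⟩
      exacts [h, (h' (.inr rfl)).elim]
  le_antisymm a b := by
    rintro (h | rfl) (h' | h')
    exacts [(lt_irrefl_raw _ (lt_trans_raw h h')).elim, h'.symm, rfl, rfl]
  le_total a b := by
    rcases lt_trichotomy_raw a b with h | h | h
    exacts [.inl (.inl h), .inl (.inr h), .inr (.inl h)]
  toDecidableLE := Classical.decRel _

theorem lt_iff_exists_add_one {a b : M.N} : a < b ↔ ∃ c, b = a + (c + 1) := lt_iff_raw a b

theorem lt_add_one_iff {a b : M.N} : a < b + 1 ↔ a ≤ b := lt_add_one_raw a b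

instance : IsStrictOrderedRing M.N :=
  have hadd : ∀ a b c : M.N, a < b → a + c < b + c := fun a b c h => by
    obtain ⟨d, rfl⟩ := lt_iff_exists_add_one.1 h
    exact lt_iff_exists_add_one.2 ⟨d, by ring⟩
  { add_le_add_left := fun a b h c => by
      rcases h.lt_or_eq with h | rfl
      exacts [(hadd _ _ _ h).le, le_rfl]
    le_of_add_le_add_left := fun a b c h => by
      by_contra! h'
      have := hadd _ _ a h'
      rw [add_comm c, add_comm b] at this
      exact absurd h (not_le.2 this)
    zero_le_one := .inl (lt_iff_exists_add_one.2 ⟨0, by ring⟩)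
    exists_pair_ne := ⟨0, 1, fun h => add_one_ne_zero (0 : M.N) (by
      change (0 : M.N) + 1 = 0
      rw [zero_add]; exact h.symm)⟩
    mul_lt_mul_of_pos_left := fun a ha b c h => by
      obtain ⟨d, rfl⟩ := lt_iff_exists_add_one.1 h
      obtain ⟨e, rfl⟩ := lt_iff_exists_add_one.1 ha
      exact lt_iff_exists_add_one.2 ⟨d * e + d + e, by ring⟩
    mul_lt_mul_of_pos_right := fun a ha b c h => by
      obtain ⟨d, rfl⟩ := lt_iff_exists_add_one.1 h
      obtain ⟨e, rfl⟩ := lt_iff_exists_add_one.1 ha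
      exact lt_iff_exists_add_one.2 ⟨d * e + d + e, by ring⟩ }

theorem zero_le' (a : M.N) : 0 ≤ a := not_lt.1 (not_lt_zero_raw a)

theorem add_one_le_iff {a b : M.N} : a + 1 ≤ b ↔ a < b := by
  rw [← lt_add_one_iff, add_lt_add_iff_right]

theorem eq_zero_or_eq_add_one (a : M.N) : a = 0 ∨ ∃ b, a = b + 1 := zero_or_add_one a

instance : CanonicallyOrderedAdd M.N where
  exists_add_of_le {a b} h := by
    rcases h.lt_or_eq with h | rfl
    · obtain ⟨c, rfl⟩ := lt_iff_exists_add_one.1 h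
      exact ⟨_, rfl⟩
    · exact ⟨0, (add_zero _).symm⟩
  le_add_self a b := by have := zero_le' b; grind
  le_self_add a b := by have := zero_le' b; grind

end Model

end RawArithmetic
end SOA


namespace SOA

open Model

variable {M : Model.{u}}

/-! ### Definability in the notation of ordered semirings; closure of `Σ⁰₁` -/

section Instances

variable [IsRCA0 M] {f g h : (ℕ → M.N) → M.N} {P Q : (ℕ → M.N) → Prop}

instance [hf : TermFn M f] [hg : TermFn M g] : TermFn M fun v => f v + g v := hf.add hg
instance [hf : TermFn M f] [hg : TermFn M g] : TermFn M fun v => f v * g v := hf.mul hg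

instance [hf : TermFn M f] [hg : TermFn M g] : Delta0 M fun v => f v < g v := .lt hf hg
instance [hf : TermFn M f] [hg : TermFn M g] : Delta0 M fun v => f v ≤ g v :=
  Delta0.of_iff (P := fun v => f v < g v ∨ f v = g v) inferInstance fun _ => le_iff_lt_or_eq

section Bounded

variable {P : (ℕ → M.N) → M.N → Prop}

instance Delta0.ball_lt [hf : TermFn M f] [hP : Delta0 M fun v => P (fun i => v (i + 1)) (v 0)] :
    Delta0 M fun v => ∀ x, x < f v → P v x := .ball hf hP

instance Delta0.ball_le [hf : TermFn M f] [hP : Delta0 M fun v => P (fun i => v (i + 1)) (v 0)] :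
    Delta0 M fun v => ∀ x, x ≤ f v → P v x :=
  (Delta0.ball (f := fun v => f v + 1) inferInstance hP).of_iff fun v => by
    simp only [← lt_add_one_iff]; exact Iff.rfl

instance Delta0.bex_lt [hf : TermFn M f] [hP : Delta0 M fun v => P (fun i => v (i + 1)) (v 0)] :
    Delta0 M fun v => ∃ x, x < f v ∧ P v x :=
  (Delta0.ball_lt (f := f) (P := fun v x => ¬ P v x)).neg.of_iff fun v => by push Not; rfl

instance Delta0.bex_le [hf : TermFn M f] [hP : Delta0 M fun v => P (fun i => v (i + 1)) (v 0)] :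
    Delta0 M fun v => ∃ x, x ≤ f v ∧ P v x :=
  (Delta0.ball_le (f := f) (P := fun v x => ¬ P v x)).neg.of_iff fun v => by push Not; rfl

end Bounded

omit [IsRCA0 M] in
theorem Delta0.comp_push [hP : Delta0 M P] [hf : TermFn M f] (s : ℕ → ℕ) :
    Delta0 M fun v => P (push (f v) fun i => v (s i)) :=
  (hP.subst (σ := fun i v => push (f v) (fun i => v (s i)) i) (by
    rintro (_ | i)
    exacts [hf, .var _]))

omit [IsRCA0 M] in
theorem Delta0.comp_push_push [hP : Delta0 M P] [hf : TermFn M f] [hg : TermFn M g] (s : ℕ → ℕ) :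
    Delta0 M fun v => P (push (f v) (push (g v) fun i => v (s i))) :=
  (hP.subst (σ := fun i v => push (f v) (push (g v) fun i => v (s i)) i) (by
    rintro (_ | _ | i)
    exacts [hf, hg, .var _]))

attribute [local instance] Delta0.comp_push Delta0.comp_push_push

/-- Two unbounded quantifiers are merged into one that bounds both witnesses, for instance by their
maximum; no pairing function is needed. `Sigma1.ex` uses the same device. -/
instance Sigma1.and [hP : Sigma1 M P] [hQ : Sigma1 M Q] : Sigma1 M fun v => P v ∧ Q v := by
  obtain ⟨P', hP', h⟩ := hP
  obtain ⟨Q', hQ', h'⟩ := hQ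
  refine ⟨fun v => ∃ y, y ≤ v 0 ∧ ∃ z, z ≤ v 0 ∧ P' (push y fun i => v (i + 1)) ∧
    Q' (push z fun i => v (i + 1)), by infer_instance, fun v => ?_⟩
  rw [h, h']
  constructor
  · rintro ⟨⟨y, hy⟩, z, hz⟩
    exact ⟨max y z, y, le_max_left _ _, z, le_max_right _ _, hy, hz⟩
  · rintro ⟨_, y, -, z, -, hy, hz⟩
    exact ⟨⟨y, hy⟩, z, hz⟩

instance Sigma1.or [hP : Sigma1 M P] [hQ : Sigma1 M Q] : Sigma1 M fun v => P v ∨ Q v := by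
  obtain ⟨P', hP', h⟩ := hP
  obtain ⟨Q', hQ', h'⟩ := hQ
  exact ⟨fun v => P' v ∨ Q' v, inferInstance, fun v => by rw [h, h', exists_or]⟩

instance Sigma1.imp [hP : Delta0 M P] [hQ : Sigma1 M Q] : Sigma1 M fun v => P v → Q v :=
  (Sigma1.or (P := fun v => ¬ P v) (Q := Q)).of_iff fun _ => imp_iff_not_or

instance Sigma1.ex {P : (ℕ → M.N) → M.N → Prop}
    [hP : Sigma1 M fun v => P (fun i => v (i + 1)) (v 0)] : Sigma1 M fun v => ∃ x, P v x := by
  obtain ⟨Q, hQ, h⟩ := hP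
  refine ⟨fun v => ∃ y, y ≤ v 0 ∧ ∃ x, x ≤ v 0 ∧ Q (push y (push x fun i => v (i + 1))),
    by infer_instance, fun v => ?_⟩
  constructor
  · rintro ⟨x, hx⟩
    obtain ⟨y, hy⟩ := (h (push x v)).1 hx
    exact ⟨max y x, y, le_max_left _ _, x, le_max_right _ _, hy⟩
  · rintro ⟨_, y, -, x, -, hy⟩
    exact ⟨x, (h (push x v)).2 ⟨y, hy⟩⟩

end Instances

/-! ### Induction principles and coding of finite objects -/

section Induction

variable [IsRCA0 M]

theorem induction_sigma1 {P : M.N → Prop} [hP : Sigma1 M fun v => P (v 0)] (zero : P 0)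
    (succ : ∀ x, P x → P (x + 1)) (x : M.N) : P x :=
  sigma1_induction_raw hP zero succ x

/-- If `P x` fails, `Σ⁰₁`-induction on `t` carries the failure down to `x - t` for every `t ≤ x`,
and finally to `0`. The equation `t + y = x` avoids subtraction. -/
theorem induction_pi1 {P : M.N → Prop} [hP : Sigma1 M fun v => ¬ P (v 0)] (zero : P 0)
    (succ : ∀ x, P x → P (x + 1)) (x : M.N) : P x := by
  by_contra hx
  obtain ⟨Q, hQ, h⟩ := hP
  have h1 : ∀ x, ¬ P x ↔ ∃ y, Q (push y (push x fun _ => 0)) := fun x => h (push x fun _ => 0)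
  have h2 : Sigma1 M fun v => ∃ y, (∃ z, Q (push z (push y fun _ => 0))) ∧ v 0 + y = x := by
    have : Delta0 M fun v => Q (push (v 0) (push (v 1) fun _ => 0)) :=
      hQ.subst (σ := fun i v => push (v 0) (push (v 1) fun _ => 0) i) (by
        rintro (_ | _ | i)
        exacts [.var _, .var _, .const _])
    infer_instance
  have h3 : ∀ t, t ≤ x → ∃ y, (∃ z, Q (push z (push y fun _ => 0))) ∧ t + y = x := by
    refine induction_sigma1 (fun _ => ⟨x, (h1 x).1 hx, zero_add x⟩) fun t ih ht => ?_
    obtain ⟨y, hy, rfl⟩ := ih ((le_self_add).trans ht)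
    rw [← h1] at hy
    rcases eq_zero_or_eq_add_one y with rfl | ⟨y, rfl⟩
    · exact (hy zero).elim
    · exact ⟨y, (h1 y).1 fun h => hy (succ y h), by ring⟩
  obtain ⟨y, hy, hxy⟩ := h3 x le_rfl
  have : y = 0 := by grind
  subst this
  exact (h1 0).2 hy zero

/-- Without a least element, the bounded condition "no element lies below `x`" would be inductive.
-/
theorem exists_least {P : M.N → Prop} [hP : Delta0 M fun v => P (v 0)] (h : ∃ x, P x) :
    ∃ x, P x ∧ ∀ y < x, ¬ P y := by
  by_contra! hc
  obtain ⟨x, hx⟩ := h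
  have : Delta0 M fun v => ∀ y, y < v 0 → ¬ P y :=
    Delta0.ball_lt (P := fun v y => ¬ P y) (hP := hP.neg)
  have key : ∀ x : M.N, ∀ y, y < x → ¬ P y := by
    refine induction_sigma1 (fun y hy => (not_lt_zero_raw y hy).elim) fun x ih y hy hPy => ?_
    obtain ⟨z, hz, hPz⟩ := hc y hPy
    exact ih z (hz.trans_le (lt_add_one_iff.1 hy)) hPz
  exact key (x + 1) x (lt_add_one_iff.2 le_rfl) hx

theorem exists_set (P : M.N → Prop) [hP : Delta0 M fun v => P (v 0)] :
    ∃ A : M.sets, ∀ x, x ∈ A.1 ↔ P x :=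
  exists_set_of_sigma1 P

/-! ## Pairs -/

/-- The pairing of the numbers of a model. -/
def npair (i j : M.N) : M.N := (i + j) * (i + j) + i

instance {f g : (ℕ → M.N) → M.N} [TermFn M f] [TermFn M g] : TermFn M fun v => npair (f v) (g v) := by
  unfold npair; infer_instance

theorem left_le_npair (i j : M.N) : i ≤ npair i j := le_add_self

theorem right_le_npair (i j : M.N) : j ≤ npair i j := by
  rcases eq_zero_or_eq_add_one j with rfl | ⟨j, rfl⟩
  · exact zero_le' _
  · have : npair i (j + 1) = j + 1 + (i * i + 2 * i * j + 2 * i + j * j + j + i) := by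
      unfold npair; ring
    rw [this]
    exact le_self_add

/-- The pair lies between `(i + j)²` and `(i + j + 1)²`, the latter excluded, so it determines `i +
j`; then `i` is found by cancelling the square. -/
theorem npair_inj {i j k l : M.N} : npair i j = npair k l ↔ i = k ∧ j = l := by
  refine ⟨fun h => ?_, by rintro ⟨rfl, rfl⟩; rfl⟩
  have key : ∀ {i j k l : M.N}, i + j < k + l → npair i j < npair k l := by
    intro i j k l h
    obtain ⟨c, hc⟩ := lt_iff_exists_add_one.1 h
    unfold npair
    rw [hc]
    have : (i + j + (c + 1)) * (i + j + (c + 1)) + k =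
      (i + j) * (i + j) + i + (k + j + 1 + 2 * c * (i + j) + c * c + 2 * c + i + j) := by ring
    rw [this]
    refine lt_iff_exists_add_one.2 ⟨k + j + 2 * c * (i + j) + c * c + 2 * c + i + j, by ring⟩
  have hs : i + j = k + l := by
    rcases lt_trichotomy (i + j) (k + l) with h' | h' | h'
    exacts [(key h').ne h |>.elim, h', (key h').ne h.symm |>.elim]
  unfold npair at h
  rw [hs] at h
  have := add_left_cancel h
  exact ⟨this, by grind⟩

/-- The graph of a total `Σ⁰₁` function is `Δ⁰₁`: a number is outside it if it is no pair, a bounded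
condition, or if its second entry differs from the actual value at the first. -/
theorem exists_graph (R : M.N → M.N → Prop) [hR : Sigma1 M fun v => R (v 0) (v 1)]
    (h : ∀ x, ∃! y, R x y) : ∃ A : M.sets, ∀ x y, npair x y ∈ A.1 ↔ R x y := by
  obtain ⟨Q, hQ, hRQ⟩ := hR
  have hRQ' : ∀ x y, R x y ↔ ∃ z, Q (push z (push x (push y fun _ => 0))) := fun x y =>
    hRQ (push x (push y fun _ => 0))
  have hQ3 : ∀ i j k : ℕ, Delta0 M fun v => Q (push (v i) (push (v j) (push (v k) fun _ => 0))) :=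
    fun i j k => hQ.subst (σ := fun n v => push (v i) (push (v j) (push (v k) fun _ => 0)) n) (by
      rintro (_ | _ | _ | n)
      exacts [.var _, .var _, .var _, .const _])
  have h1 : Sigma1 M fun v => ∃ x, ∃ y, v 0 = npair x y ∧ R x y := by
    simp only [hRQ']; infer_instance
  have h2 : Sigma1 M fun v => ¬ ∃ x, ∃ y, v 0 = npair x y ∧ R x y := by
    have : Sigma1 M fun v => (¬ ∃ x, x ≤ v 0 ∧ ∃ y, y ≤ v 0 ∧ v 0 = npair x y) ∨
        ∃ x, ∃ y, ∃ z, v 0 = npair x y ∧ z ≠ y ∧ R x z := by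
      simp only [hRQ']; infer_instance
    refine this.of_iff fun v => ⟨fun hv => ?_, ?_⟩
    · by_cases hp : ∃ x, x ≤ v 0 ∧ ∃ y, y ≤ v 0 ∧ v 0 = npair x y
      · obtain ⟨x, -, y, -, hxy⟩ := hp
        obtain ⟨z, hz, -⟩ := h x
        refine .inr ⟨x, y, z, hxy, ?_, hz⟩
        rintro rfl
        exact hv ⟨x, z, hxy, hz⟩
      · exact .inl hp
    · rintro (hv | ⟨x, y, z, hxy, hzy, hz⟩) ⟨x', y', hxy', hR⟩
      · exact hv ⟨x', hxy' ▸ left_le_npair _ _, y', hxy' ▸ right_le_npair _ _, hxy'⟩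
      · obtain ⟨rfl, rfl⟩ := npair_inj.1 (hxy.symm.trans hxy')
        exact hzy ((h x).unique hz hR)
  obtain ⟨A, hA⟩ := exists_set_of_sigma1 fun a => ∃ x, ∃ y, a = npair x y ∧ R x y
  refine ⟨A, fun x y => ?_⟩
  rw [hA]
  constructor
  · rintro ⟨x', y', h, hR⟩
    obtain ⟨rfl, rfl⟩ := npair_inj.1 h
    exact hR
  · exact fun hR => ⟨x, y, rfl, hR⟩

/-- A function picking, for every `x`, some `y` with `R x y`. -/
theorem exists_choice (R : M.N → M.N → Prop) [hR : Delta0 M fun v => R (v 0) (v 1)]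
    (h : ∀ x, ∃ y, R x y) : ∃ A : M.sets, (∀ x, ∃! y, npair x y ∈ A.1) ∧
      ∀ x y, npair x y ∈ A.1 → R x y := by
  have hR2 : ∀ i j : ℕ, Delta0 M fun v => R (v i) (v j) := fun i j =>
    hR.subst (σ := fun n v => push (v i) (fun _ => v j) n) (by
      rintro (_ | n)
      exacts [.var _, .var _])
  -- Taking the least `y` makes the choice functional while keeping the relation `Δ⁰₀`.
  have hu : ∀ x, ∃! y, R x y ∧ ∀ z, z < y → ¬ R x z := fun x => by
    have : Delta0 M fun v => R x (v 0) :=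
      hR.subst (σ := fun n v => push x (fun _ => v 0) n) (by
        rintro (_ | n)
        exacts [.const _, .var _])
    obtain ⟨y, hy, hy'⟩ := exists_least (h x)
    refine ⟨y, ⟨hy, hy'⟩, fun z hz => ?_⟩
    rcases lt_trichotomy z y with h | h | h
    exacts [(hy' z h hz.1).elim, h, (hz.2 y h hy).elim]
  obtain ⟨A, hA⟩ := exists_graph (fun x y => R x y ∧ ∀ z, z < y → ¬ R x z) hu
  exact ⟨A, fun x => by simpa only [hA] using hu x, fun x y hxy => ((hA x y).1 hxy).1⟩

/-! ## Codes of finite sets -/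

/-- Membership in the finite set coded by `m`, `n`. -/
def nbit (m n i : M.N) : Prop := ∃ q, q * (m * (i + 1) + 1) = n

theorem le_mul_add_one_mul (q m : M.N) : q ≤ q * (m + 1) := by
  rw [mul_add, mul_one]; exact le_add_self

instance {f g h : (ℕ → M.N) → M.N} [TermFn M f] [TermFn M g] [TermFn M h] :
    Delta0 M fun v => nbit (f v) (g v) (h v) :=
  Delta0.of_iff (P := fun v => ∃ q, q ≤ g v ∧ q * (f v * (h v + 1) + 1) = g v) inferInstance
    fun _ => ⟨fun ⟨q, hq⟩ => ⟨q, hq ▸ le_mul_add_one_mul _ _, hq⟩, fun ⟨q, _, hq⟩ => ⟨q, hq⟩⟩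

/-- A substitute for the factorial. The bound on the quotients keeps the induction hypothesis `Σ⁰₁`.
-/
theorem exists_common_multiple (k : M.N) :
    ∃ m : M.N, m ≠ 0 ∧ ∀ i, i < k → ∃ q, q ≤ m ∧ m = (i + 1) * q := by
  refine induction_sigma1 (P := fun k => ∃ m : M.N, m ≠ 0 ∧
    ∀ i, i < k → ∃ q, q ≤ m ∧ m = (i + 1) * q) ?_ (fun k ih => ?_) k
  · exact ⟨1, one_ne_zero, fun i hi => (not_lt_zero_raw i hi).elim⟩
  · obtain ⟨m, hm, h⟩ := ih
    refine ⟨m * (k + 1), mul_ne_zero hm (add_one_ne_zero k), fun i hi => ?_⟩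
    rcases (lt_add_one_iff.1 hi).lt_or_eq with hi | rfl
    · obtain ⟨q, hq, hmq⟩ := h i hi
      exact ⟨q * (k + 1), mul_le_mul_left hq _, by rw [hmq]; ring⟩
    · exact ⟨m, le_mul_add_one_mul _ _, by ring⟩

/-- A difference of two multiples of `d` is a multiple of `d`, stated without subtraction. -/
theorem dvd_of_mul_eq_mul_add {a b d n : M.N} (h : a * d = b * d + n) : ∃ q, q * d = n := by
  rcases le_total a b with hab | hab
  · obtain ⟨c, rfl⟩ := exists_add_of_le hab
    have : n = 0 := by
      have h2 : a * d + (c * d + n) = a * d + 0 := by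
        rw [add_zero]; exact Eq.trans (by ring) h.symm
      exact (add_eq_zero.1 (add_left_cancel h2)).2
    exact ⟨0, by rw [this, zero_mul]⟩
  · obtain ⟨c, rfl⟩ := exists_add_of_le hab
    exact ⟨c, by rw [add_mul] at h; exact add_left_cancel h⟩

/-- This is the coprimality of the moduli of Gödel's β-function: `m (i + 1) + 1` and `m (j + 1) + 1`
are coprime because the difference of `i` and `j` divides `m`. -/
theorem nbit_mul_iff {m n i j : M.N} (hij : i ≠ j) (h : ∀ t : M.N, t + 1 ≤ i ∨ t + 1 ≤ j →
    ∃ r, m = (t + 1) * r) : nbit m (n * (m * (j + 1) + 1)) i ↔ nbit m n i := by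
  constructor
  · rintro ⟨q, hq⟩
    rcases lt_or_gt_of_ne hij with hij | hij <;>
    obtain ⟨t, ht⟩ := lt_iff_exists_add_one.1 hij
    · obtain ⟨r, hr⟩ := h t (.inr (by rw [ht]; exact le_add_self))
      -- Write `D x = m (x + 1) + 1`. Then `(i + 1) r ((j + 1) D i - (i + 1) D j) = (i + 1) m = D i
      -- - 1`. Multiplied by `n`, and with `n D j = q D i`, this makes `n` a difference of multiples
      -- of `D i`. In the other case the roles of the two multiples are exchanged.
      refine dvd_of_mul_eq_mul_add (a := n + (i + 1) * (i + 1) * r * q)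
        (b := (i + 1) * r * n * (j + 1)) ?_
      subst ht
      grind
    · obtain ⟨r, hr⟩ := h t (.inl (by rw [ht]; exact le_add_self))
      refine dvd_of_mul_eq_mul_add (a := n + (i + 1) * r * n * (j + 1))
        (b := (i + 1) * (i + 1) * r * q) ?_
      subst ht
      grind
  · rintro ⟨q, hq⟩
    exact ⟨q * (m * (j + 1) + 1), by rw [← hq]; ring⟩

/-- The number `n` is the product of the moduli `m (i + 1) + 1` over the members `i < k` of `A`,
built up one factor at a time; by `nbit_mul_iff` a new factor affects only its own bit. -/
theorem exists_finite_code (A : M.sets) (k : M.N) :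
    ∃ m n : M.N, ∀ i < k, nbit m n i ↔ i ∈ A.1 := by
  obtain ⟨m, hm, h⟩ := exists_common_multiple k
  have key : ∀ j, j ≤ k → ∃ n, n ≠ 0 ∧ ∀ i, i < k → (nbit m n i ↔ i < j ∧ i ∈ A.1) := by
    refine induction_sigma1 (fun _ => ⟨1, one_ne_zero, fun i _ => ?_⟩) fun j ih hj => ?_
    · refine iff_of_false ?_ fun h => not_lt_zero_raw _ h.1
      rintro ⟨q, hq⟩
      have hq0 : q ≠ 0 := by rintro rfl; rw [zero_mul] at hq; exact zero_ne_one hq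
      obtain ⟨q, rfl⟩ := (eq_zero_or_eq_add_one q).resolve_left hq0
      have h0 : (q + (q + 1) * (m * (i + 1))) + 1 = 0 + 1 := by
        rw [zero_add]; exact Eq.trans (by ring) hq
      have h1 := (add_eq_zero.1 (add_right_cancel h0)).2
      exact mul_ne_zero (add_one_ne_zero q) (mul_ne_zero hm (add_one_ne_zero i)) h1
    · obtain ⟨n, hn, ih⟩ := ih (le_self_add.trans hj)
      have hjk : j < k := add_one_le_iff.1 hj
      by_cases hjA : j ∈ A.1
      · refine ⟨n * (m * (j + 1) + 1), mul_ne_zero hn (add_one_ne_zero _), fun i hi => ?_⟩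
        rcases eq_or_ne i j with rfl | hij
        · exact iff_of_true ⟨n, rfl⟩ ⟨lt_add_one_iff.2 le_rfl, hjA⟩
        · rw [nbit_mul_iff hij, ih i hi, lt_add_one_iff, le_iff_lt_or_eq]
          · simp [hij]
          · intro t ht
            obtain ⟨q, -, hq⟩ := h t (add_one_le_iff.1 (ht.elim (fun h => h.trans hi.le)
              fun h => h.trans hjk.le))
            exact ⟨q, hq⟩
      · refine ⟨n, hn, fun i hi => ?_⟩
        rw [ih i hi, lt_add_one_iff, le_iff_lt_or_eq]
        constructor
        · exact fun h => ⟨.inl h.1, h.2⟩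
        · rintro ⟨h | rfl, h'⟩
          exacts [⟨h, h'⟩, (hjA h').elim]
  obtain ⟨n, -, hn⟩ := key k le_rfl
  exact ⟨m, n, fun i hi => by rw [hn i hi]; simp [hi]⟩

/-! ## Powers of two -/

/-- `y = 2 ^ k`, as witnessed by the coded finite set of pairs `(i, 2 ^ i)`, `i ≤ k`. -/
def ExpCode (m n k y : M.N) : Prop :=
  nbit m n (npair k y) ∧ ∀ i, i ≤ k → ∀ z, z ≤ y → nbit m n (npair i z) →
    (i = 0 ∧ z = 1) ∨ ∃ j, j < i ∧ ∃ w, w ≤ z ∧ i = j + 1 ∧ z = w + w ∧ nbit m n (npair j w)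

/-- Every entry after the first is traced back to an entry one stage earlier. Restricting the
entries to those below `y` and `y'` keeps the induction hypothesis bounded. -/
theorem ExpCode.unique {m n m' n' k y y' : M.N} (h : ExpCode m n k y) (h' : ExpCode m' n' k y') :
    y = y' := by
  have key : ∀ i, i ≤ k → ∀ z, z ≤ y → ∀ z', z' ≤ y' → nbit m n (npair i z) →
      nbit m' n' (npair i z') → z = z' := by
    refine induction_sigma1 (fun hi z hz z' hz' hb hb' => ?_) fun i ih hi z hz z' hz' hb hb' => ?_
    · rcases h.2 _ hi z hz hb with ⟨-, rfl⟩ | ⟨j, hj, -⟩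
      · rcases h'.2 _ hi z' hz' hb' with ⟨-, rfl⟩ | ⟨j, hj, -⟩
        exacts [rfl, (not_lt_zero_raw _ hj).elim]
      · exact (not_lt_zero_raw _ hj).elim
    · rcases h.2 _ hi z hz hb with ⟨h0, -⟩ | ⟨j, -, w, hw, hij, rfl, hb⟩
      · exact (add_one_ne_zero _ h0).elim
      · rcases h'.2 _ hi z' hz' hb' with ⟨h0, -⟩ | ⟨j', -, w', hw', hij', rfl, hb'⟩
        · exact (add_one_ne_zero _ h0).elim
        · obtain rfl := add_right_cancel hij
          obtain rfl := add_right_cancel hij'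
          rw [ih (le_self_add.trans hi) w (hw.trans hz) w' (hw'.trans hz') hb hb']
  exact key k le_rfl y le_rfl y' le_rfl h.1 h'.1

theorem ExpCode.exists_zero : ∃ m n : M.N, ExpCode m n 0 1 := by
  obtain ⟨A, hA⟩ := exists_set (M := M) fun x => x = npair 0 1
  obtain ⟨m, n, h⟩ := exists_finite_code A (npair 0 1 + 1)
  refine ⟨m, n, (h _ (lt_add_one_iff.2 le_rfl)).2 ((hA _).2 rfl), fun i hi z hz hb => ?_⟩
  obtain rfl : i = 0 := le_antisymm hi (zero_le' _)
  have : npair 0 z < npair 0 1 + 1 := lt_add_one_iff.2 (by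
    unfold npair; simp only [zero_add, add_zero, one_mul]
    exact mul_le_one' hz hz)
  exact .inl ⟨rfl, (npair_inj.1 ((hA _).1 ((h _ this).1 hb))).2⟩

theorem npair_le_npair {i j k l : M.N} (h : i ≤ k) (h' : j ≤ l) : npair i j ≤ npair k l := by
  unfold npair; gcongr

theorem ExpCode.exists_succ {m n k y : M.N} (h : ExpCode m n k y) :
    ∃ m' n' : M.N, ExpCode m' n' (k + 1) (y + y) := by
  -- Only the pairs bounded by `k` and `y` are kept, since `ExpCode` says nothing about other
  -- members of the old code.
  obtain ⟨A, hA⟩ := exists_set (M := M) fun x => x = npair (k + 1) (y + y) ∨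
    ∃ i, i ≤ k ∧ ∃ z, z ≤ y ∧ x = npair i z ∧ nbit m n x
  obtain ⟨m', n', h'⟩ := exists_finite_code A (npair (k + 1) (y + y) + 1)
  have hb : ∀ i, i ≤ k + 1 → ∀ z, z ≤ y + y → (nbit m' n' (npair i z) ↔
      (i = k + 1 ∧ z = y + y) ∨ (i ≤ k ∧ z ≤ y ∧ nbit m n (npair i z))) := by
    intro i hi z hz
    rw [h' _ (lt_add_one_iff.2 (npair_le_npair hi hz)), hA, npair_inj]
    refine or_congr Iff.rfl ⟨?_, fun h => ⟨i, h.1, z, h.2.1, rfl, h.2.2⟩⟩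
    rintro ⟨i', hi, z', hz, hp, hb⟩
    obtain ⟨rfl, rfl⟩ := npair_inj.1 hp
    exact ⟨hi, hz, hb⟩
  refine ⟨m', n', (hb _ le_rfl _ le_rfl).2 (.inl ⟨rfl, rfl⟩), fun i hi z hz hbz => ?_⟩
  rcases (hb i hi z hz).1 hbz with ⟨rfl, rfl⟩ | ⟨hik, hzy, hbz⟩
  · exact .inr ⟨k, lt_add_one_iff.2 le_rfl, y, le_self_add, rfl, rfl,
      (hb _ le_self_add _ le_self_add).2 (.inr ⟨le_rfl, le_rfl, h.1⟩)⟩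
  · refine (h.2 i hik z hzy hbz).imp_right ?_
    rintro ⟨j, hj, w, hw, rfl, rfl, hbw⟩
    exact ⟨j, hj, w, hw, rfl, rfl, (hb _ (hj.le.trans hi) _ (hw.trans hz)).2
      (.inr ⟨hj.le.trans hik, hw.trans hzy, hbw⟩)⟩

theorem exists_expCode (k : M.N) : ∃ y m n : M.N, ExpCode m n k y := by
  refine induction_sigma1 (P := fun k => ∃ y m n : M.N, ExpCode m n k y) (hP := ?_) ?_ ?_ k
  · unfold ExpCode; infer_instance
  · exact ⟨1, ExpCode.exists_zero⟩
  · rintro k ⟨y, m, n, h⟩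
    exact ⟨_, h.exists_succ⟩

theorem exists_exp_set (M : Model.{u}) [IsRCA0 M] :
    ∃ E : M.sets, ∀ k y, npair k y ∈ E.1 ↔ ∃ m n, ExpCode m n k y :=
  have : Sigma1 M fun v => ∃ m n, ExpCode m n (v 0) (v 1) := by unfold ExpCode; infer_instance
  exists_graph _ fun k =>
    have ⟨y, m, n, h⟩ := exists_expCode k
    ⟨y, ⟨m, n, h⟩, fun _ ⟨_, _, h'⟩ => h'.unique h⟩

/-- The graph of `2 ^ k`. -/
noncomputable def expSet (M : Model.{u}) [IsRCA0 M] : M.sets := (exists_exp_set M).choose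

/-- `2 ^ k`. -/
noncomputable def pw (k : M.N) : M.N := (exists_expCode k).choose

theorem mem_expSet {k y : M.N} : npair k y ∈ (expSet M).1 ↔ pw k = y := by
  rw [expSet, (exists_exp_set M).choose_spec]
  obtain ⟨m, n, h⟩ := (exists_expCode k).choose_spec
  constructor
  · rintro ⟨m', n', h'⟩
    exact h.unique h'
  · rintro rfl
    exact ⟨m, n, h⟩

@[simp] theorem pw_zero : pw (0 : M.N) = 1 :=
  have ⟨_, _, h⟩ := (exists_expCode (0 : M.N)).choose_spec
  have ⟨_, _, h'⟩ := ExpCode.exists_zero (M := M)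
  h.unique h'

theorem pw_add_one (k : M.N) : pw (k + 1) = pw k + pw k :=
  have ⟨_, _, h⟩ := (exists_expCode (k + 1)).choose_spec
  have ⟨_, _, h'⟩ := (exists_expCode k).choose_spec
  have ⟨_, _, h'⟩ := h'.exists_succ
  h.unique h'

/-- With the graph as a set parameter this is an atomic condition. As `pw` is not built from term
operations, statements about `2 ^ k` are first rewritten with an existential quantifier over its
value. -/
instance {f g : (ℕ → M.N) → M.N} [TermFn M f] [TermFn M g] : Delta0 M fun v => pw (f v) = g v :=
  Delta0.of_iff (P := fun v => npair (f v) (g v) ∈ (expSet M).1) inferInstance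
    fun _ => mem_expSet.symm

theorem pw_pos (k : M.N) : 0 < pw k := by
  refine induction_sigma1 (P := fun k => 0 < pw k) (hP := ?_) ?_ (fun k h => ?_) k
  · exact Sigma1.of_iff (P := fun v => ∃ y, pw (v 0) = y ∧ 0 < y) (by infer_instance)
      fun _ => by simp
  · rw [pw_zero]; exact zero_lt_one
  · rw [pw_add_one]; exact add_pos h h

theorem lt_pw (k : M.N) : k < pw k := by
  refine induction_sigma1 (P := fun k => k < pw k) (hP := ?_) ?_ (fun k h => ?_) k
  · exact Sigma1.of_iff (P := fun v => ∃ y, pw (v 0) = y ∧ v 0 < y) (by infer_instance)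
      fun _ => by simp
  · exact pw_pos _
  · rw [pw_add_one]
    exact (add_one_le_iff.2 h).trans_lt (lt_add_of_pos_right _ (pw_pos _))

theorem pw_add (k l : M.N) : pw (k + l) = pw k * pw l := by
  refine induction_sigma1 (P := fun l => pw (k + l) = pw k * pw l) (hP := ?_) ?_ (fun l h => ?_) l
  · exact Sigma1.of_iff (P := fun v => ∃ y, pw (v 0) = y ∧ pw (k + v 0) = pw k * y)
      (by infer_instance) fun _ => by simp
  · simp
  · rw [← add_assoc, pw_add_one, h, pw_add_one, mul_add]

theorem pw_le_pw {k l : M.N} (h : k ≤ l) : pw k ≤ pw l := by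
  obtain ⟨c, rfl⟩ := exists_add_of_le h
  rw [pw_add]
  exact le_mul_of_one_le_right' (by rw [← zero_add 1, add_one_le_iff]; exact pw_pos _)

end Induction

end SOA


namespace SOA

/-! ## The ordered field of fractions of an ordered semiring of natural-number type -/

section Field

variable (N : Type u) [CommSemiring N] [LinearOrder N] [IsStrictOrderedRing N]
  [CanonicallyOrderedAdd N]

/-- Formal differences. -/
def diffSetoid : Setoid (N × N) where
  r p q := p.1 + q.2 = q.1 + p.2
  iseqv :=
    { refl := fun _ => rfl
      symm := fun h => h.symm
      trans := fun {p q r} h h' => by grind }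

/-- The ring of differences. -/
def DiffRing : Type u := Quotient (diffSetoid N)

variable {N}

omit [CanonicallyOrderedAdd N] in
theorem diff_sound {p q : N × N} (h : p.1 + q.2 = q.1 + p.2) :
    (Quotient.mk (diffSetoid N) p) = Quotient.mk (diffSetoid N) q := Quotient.sound h

instance : Zero (DiffRing N) := ⟨Quotient.mk (diffSetoid N) (0, 0)⟩
instance : One (DiffRing N) := ⟨Quotient.mk (diffSetoid N) (1, 0)⟩
instance : Add (DiffRing N) where
  add := Quotient.map₂ (sc := diffSetoid N) (fun p q => (p.1 + q.1, p.2 + q.2))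
    fun p p' h q q' h' => by
      change p.1 + p'.2 = p'.1 + p.2 at h
      change q.1 + q'.2 = q'.1 + q.2 at h'
      change p.1 + q.1 + (p'.2 + q'.2) = p'.1 + q'.1 + (p.2 + q.2)
      grind
instance : Mul (DiffRing N) where
  mul := Quotient.map₂ (sc := diffSetoid N)
    (fun p q => (p.1 * q.1 + p.2 * q.2, p.1 * q.2 + p.2 * q.1))
    fun p p' h q q' h' => by
      change p.1 + p'.2 = p'.1 + p.2 at h
      change q.1 + q'.2 = q'.1 + q.2 at h'
      change p.1 * q.1 + p.2 * q.2 + (p'.1 * q'.2 + p'.2 * q'.1) =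
        p'.1 * q'.1 + p'.2 * q'.2 + (p.1 * q.2 + p.2 * q.1)
      grind
instance : Neg (DiffRing N) where
  neg := Quotient.map (sb := diffSetoid N) (fun p => (p.2, p.1)) fun p p' h => by
      change p.1 + p'.2 = p'.1 + p.2 at h
      change p.2 + p'.1 = p'.2 + p.1
      grind

instance : CommRing (DiffRing N) where
  nsmul := nsmulRec
  zsmul := zsmulRec
  npow := npowRec
  add_assoc := by rintro ⟨a⟩ ⟨b⟩ ⟨c⟩; exact diff_sound (by ring)
  zero_add := by rintro ⟨a⟩; exact diff_sound (by ring)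
  add_zero := by rintro ⟨a⟩; exact diff_sound (by ring)
  add_comm := by rintro ⟨a⟩ ⟨b⟩; exact diff_sound (by ring)
  left_distrib := by rintro ⟨a⟩ ⟨b⟩ ⟨c⟩; exact diff_sound (by ring)
  right_distrib := by rintro ⟨a⟩ ⟨b⟩ ⟨c⟩; exact diff_sound (by ring)
  zero_mul := by rintro ⟨a⟩; exact diff_sound (by ring)
  mul_zero := by rintro ⟨a⟩; exact diff_sound (by ring)
  mul_assoc := by rintro ⟨a⟩ ⟨b⟩ ⟨c⟩; exact diff_sound (by ring)
  one_mul := by rintro ⟨a⟩; exact diff_sound (by ring)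
  mul_one := by rintro ⟨a⟩; exact diff_sound (by ring)
  mul_comm := by rintro ⟨a⟩ ⟨b⟩; exact diff_sound (by ring)
  neg_add_cancel := by rintro ⟨a⟩; exact diff_sound (by ring)

def toDiff : N →+* DiffRing N where
  toFun a := Quotient.mk (diffSetoid N) (a, 0)
  map_zero' := rfl
  map_one' := rfl
  map_add' a b := diff_sound (by ring)
  map_mul' a b := diff_sound (by ring)

omit [CanonicallyOrderedAdd N] in
theorem toDiff_injective : Function.Injective (toDiff (N := N)) := fun a b h => by
  have h : a + 0 = b + 0 := Quotient.exact h
  simpa using h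

theorem exists_toDiff (x : DiffRing N) : ∃ a : N, x = toDiff a ∨ x = -toDiff a := by
  induction x using Quotient.inductionOn with
  | h p =>
    rcases le_total p.1 p.2 with h | h <;> obtain ⟨c, hc⟩ := exists_add_of_le h
    · exact ⟨c, .inr (diff_sound (by change p.1 + c = 0 + p.2; rw [hc, zero_add]))⟩
    · exact ⟨c, .inl (diff_sound (by change p.1 + 0 = c + p.2; rw [hc]; ring))⟩

instance : IsDomain (DiffRing N) :=
  have : Nontrivial (DiffRing N) := toDiff_injective.nontrivial
  have : NoZeroDivisors (DiffRing N) :=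
    { eq_zero_or_eq_zero_of_mul_eq_zero := fun {x y} h => by
        obtain ⟨a, rfl | rfl⟩ := exists_toDiff x <;> obtain ⟨b, rfl | rfl⟩ := exists_toDiff y <;>
        simp only [neg_mul, mul_neg, neg_neg, neg_eq_zero, ← map_mul,
          map_eq_zero_iff _ toDiff_injective, mul_eq_zero] at h ⊢ <;> exact h }
  NoZeroDivisors.to_isDomain _

variable (N)

/-- The field of fractions. -/
def Frac : Type u := FractionRing (DiffRing N)

noncomputable instance : Field (Frac N) := inferInstanceAs (Field (FractionRing (DiffRing N)))

variable {N}

/-- The inclusion of the semiring. -/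
noncomputable def toFrac : N →+* Frac N := (algebraMap (DiffRing N) (FractionRing (DiffRing N))).comp toDiff

theorem toFrac_injective : Function.Injective (toFrac (N := N)) :=
  (IsFractionRing.injective (DiffRing N) (FractionRing (DiffRing N))).comp toDiff_injective

theorem exists_toFrac (x : Frac N) : ∃ a b : N, b ≠ 0 ∧
    (x = toFrac a / toFrac b ∨ x = -(toFrac a / toFrac b)) := by
  obtain ⟨y, z, hz, hx⟩ := IsFractionRing.div_surjective (A := DiffRing N) (K := FractionRing (DiffRing N)) x
  have hz : z ≠ 0 := nonZeroDivisors.ne_zero hz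
  obtain ⟨a, rfl | rfl⟩ := exists_toDiff y <;> obtain ⟨b, rfl | rfl⟩ := exists_toDiff z <;>
  refine ⟨a, b, by rintro rfl; simp at hz, ?_⟩
  · exact .inl hx.symm
  · exact .inr (hx.symm.trans (by rw [map_neg, div_neg]; rfl))
  · exact .inr (hx.symm.trans (by rw [map_neg, neg_div]; rfl))
  · exact .inl (hx.symm.trans (by rw [map_neg, map_neg, neg_div_neg_eq]; rfl))

/-- The nonnegative fractions. -/
noncomputable def fracCone : RingCone (Frac N) where
  carrier := {x | ∃ a b : N, b ≠ 0 ∧ x = toFrac a / toFrac b}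
  mul_mem' := by
    rintro _ _ ⟨a, b, hb, rfl⟩ ⟨c, d, hd, rfl⟩
    exact ⟨a * c, b * d, mul_ne_zero hb hd, by rw [map_mul, map_mul, div_mul_div_comm]⟩
  one_mem' := ⟨1, 1, one_ne_zero, by simp⟩
  add_mem' := by
    rintro _ _ ⟨a, b, hb, rfl⟩ ⟨c, d, hd, rfl⟩
    have hb' := (map_ne_zero_iff _ (toFrac_injective (N := N))).2 hb
    have hd' := (map_ne_zero_iff _ (toFrac_injective (N := N))).2 hd
    exact ⟨a * d + b * c, b * d, mul_ne_zero hb hd, by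
      rw [map_add, map_mul, map_mul, map_mul, div_add_div _ _ hb' hd']⟩
  zero_mem' := ⟨0, 1, one_ne_zero, by simp⟩
  eq_zero_of_mem_of_neg_mem' := by
    rintro _ ⟨a, b, hb, rfl⟩ ⟨c, d, hd, h⟩
    have hb' := (map_ne_zero_iff _ (toFrac_injective (N := N))).2 hb
    have hd' := (map_ne_zero_iff _ (toFrac_injective (N := N))).2 hd
    have h1 : toFrac (a * d + c * b) = (0 : Frac N) := by
      rw [map_add, map_mul, map_mul]
      field_simp at h
      linear_combination -h
    rw [map_eq_zero_iff _ toFrac_injective] at h1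
    have h2 := (mul_eq_zero.1 (add_eq_zero.1 h1).1).resolve_right hd
    rw [h2, map_zero, zero_div]

instance : HasMemOrNegMem (fracCone (N := N)) where
  mem_or_neg_mem x := by
    obtain ⟨a, b, hb, rfl | rfl⟩ := exists_toFrac x
    · exact .inl ⟨a, b, hb, rfl⟩
    · exact .inr ⟨a, b, hb, by rw [neg_neg]⟩

open Classical in
noncomputable instance : LinearOrder (Frac N) := LinearOrder.mkOfAddGroupCone (fracCone (N := N))

instance : IsStrictOrderedRing (Frac N) :=
  have : IsOrderedRing (Frac N) := IsOrderedRing.mkOfCone (fracCone (N := N))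
  IsOrderedRing.toIsStrictOrderedRing _

instance : IsOrderedRing (Frac N) := IsStrictOrderedRing.toIsOrderedRing
instance : IsOrderedAddMonoid (Frac N) := IsOrderedRing.toIsOrderedAddMonoid
instance : ZeroLEOneClass (Frac N) := IsOrderedRing.toZeroLEOneClass
instance : AddLeftMono (Frac N) := IsOrderedAddMonoid.toAddLeftMono
instance : AddLeftStrictMono (Frac N) := IsLeftCancelAdd.addLeftStrictMono_of_addLeftMono _
instance : PosMulStrictMono (Frac N) := IsStrictOrderedRing.toPosMulStrictMono
instance : MulPosStrictMono (Frac N) := IsStrictOrderedRing.toMulPosStrictMono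

theorem nonneg_frac_iff {x : Frac N} : 0 ≤ x ↔ ∃ a b : N, b ≠ 0 ∧ x = toFrac a / toFrac b := by
  change x - 0 ∈ (fracCone (N := N)) ↔ _
  rw [sub_zero]; rfl

theorem toFrac_nonneg (a : N) : 0 ≤ toFrac a :=
  nonneg_frac_iff.2 ⟨a, 1, one_ne_zero, by simp⟩

theorem toFrac_mono : Monotone (toFrac (N := N)) := fun a b h => by
  obtain ⟨c, rfl⟩ := exists_add_of_le h
  rw [map_add]
  exact le_add_of_nonneg_right (toFrac_nonneg c)

theorem toFrac_strictMono : StrictMono (toFrac (N := N)) :=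
  toFrac_mono.strictMono_of_injective toFrac_injective

end Field

end SOA


namespace SOA

set_option synthInstance.maxSize 2000
set_option synthInstance.maxHeartbeats 400000

/-! ## The meaning of formulas that are built with bound variables

A `World` is a stage in the evaluation of a formula: the numbers of variables used so far, and an
assignment. -/

structure World (M : Model.{u}) where
  d : ℕ
  e : ℕ
  v : ℕ → M.N
  V : ℕ → M.sets

/-- The world `w'` extends `w`. -/
structure Step {M : Model.{u}} (w w' : World M) : Prop where
  d_le : w.d ≤ w'.d
  e_le : w.e ≤ w'.e
  v_eq : ∀ i < w.d, w'.v i = w.v i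
  V_eq : ∀ i < w.e, w'.V i = w.V i

theorem Step.refl {M : Model.{u}} (w : World M) : Step w w :=
  ⟨le_rfl, le_rfl, fun _ _ => rfl, fun _ _ => rfl⟩

theorem Step.trans {M : Model.{u}} {w w' w'' : World M} (h : Step w w') (h' : Step w' w'') :
    Step w w'' :=
  ⟨h.d_le.trans h'.d_le, h.e_le.trans h'.e_le,
    fun i hi => (h'.v_eq i (hi.trans_le h.d_le)).trans (h.v_eq i hi),
    fun i hi => (h'.V_eq i (hi.trans_le h.e_le)).trans (h.V_eq i hi)⟩

section Means

variable {M : Model.{u}}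

/-- The term `t` has the value `a` in `w` and its extensions. -/
class TmR (w : World M) (t : Tm) (a : M.N) : Prop where
  out : ∀ w', Step w w' → t.eval M w'.v = a

/-- The formula `B` is equivalent to `P` in `w`. -/
class BldR (w : World M) (B : Bld) (P : Prop) : Prop where
  out : (B w.d w.e).Realize M w.v w.V ↔ P

/-- The class `C` has the extension `A` in `w` and its extensions. -/
class ClsR (w : World M) (C : Cls) (A : Set M.N) : Prop where
  out : ∀ w', Step w w' → ∀ t a, TmR w' t a → BldR w' (C t) (a ∈ A)

theorem TmR.mono {w w' : World M} {t : Tm} {a : M.N} (h : TmR w t a) (hw : Step w w') :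
    TmR w' t a := ⟨fun w'' h' => h.out w'' (hw.trans h')⟩

theorem ClsR.mono {w w' : World M} {C : Cls} {A : Set M.N} (h : ClsR w C A) (hw : Step w w') :
    ClsR w' C A := ⟨fun w'' h' => h.out w'' (hw.trans h')⟩

/-- A triple of numbers, as a code of a rational number or of a binary string. -/
@[ext] structure QCode (M : Model.{u}) where
  a : M.N
  b : M.N
  c : M.N

class TripR (w : World M) (q : Trip) (q' : QCode M) : Prop where
  a : TmR w q.a q'.a
  b : TmR w q.b q'.b
  c : TmR w q.c q'.c

theorem TripR.mono {w w' : World M} {q : Trip} {q' : QCode M} (h : TripR w q q')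
    (hw : Step w w') : TripR w' q q' := ⟨h.a.mono hw, h.b.mono hw, h.c.mono hw⟩

variable {w w' : World M} {s t : Tm} {x y : M.N} {A B : Bld} {P Q : Prop} {C D : Cls}
  {X Y : Set M.N} {p q r : Trip} {p' q' r' : QCode M}

/-- The world with one more number variable. -/
def World.pushN (w : World M) (a : M.N) : World M :=
  ⟨w.d + 1, w.e, Function.update w.v w.d a, w.V⟩

/-- The world with one more set variable. -/
def World.pushS (w : World M) (A : M.sets) : World M :=
  ⟨w.d, w.e + 1, w.v, Function.update w.V w.e A⟩

/-- The world with three more number variables. -/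
def World.pushT (w : World M) (q : QCode M) : World M := ((w.pushN q.a).pushN q.b).pushN q.c

/-- The first three unused number variables. -/
def World.trip (w : World M) : Trip := ⟨.var w.d, .var (w.d + 1), .var (w.d + 1 + 1)⟩

/-- The first unused set variable. -/
def World.cls (w : World M) : Cls := fun t _ _ => .mem t w.e

theorem World.step_pushN (w : World M) (a : M.N) : Step w (w.pushN a) :=
  ⟨Nat.le_succ _, le_rfl, fun _ hi => Function.update_of_ne hi.ne _ _, fun _ _ => rfl⟩

theorem World.step_pushS (w : World M) (A : M.sets) : Step w (w.pushS A) :=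
  ⟨le_rfl, Nat.le_succ _, fun _ _ => rfl, fun _ hi => Function.update_of_ne hi.ne _ _⟩

theorem World.step_pushT (w : World M) (q : QCode M) : Step w (w.pushT q) :=
  ((w.step_pushN _).trans (World.step_pushN _ _)).trans (World.step_pushN _ _)

instance (a : M.N) : TmR (w.pushN a) (.var w.d) a :=
  ⟨fun _ h => (h.v_eq _ (Nat.lt_succ_self _)).trans (Function.update_self ..)⟩

instance (A : M.sets) : ClsR (w.pushS A) w.cls A.1 :=
  ⟨fun w' h t a ht => ⟨by
    have h1 : w'.V w.e = A :=
      (h.V_eq _ (Nat.lt_succ_self _)).trans (Function.update_self ..)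
    simp only [World.cls, Fml.Realize, h1, ht.out w' (.refl _)]⟩⟩

instance (a : M.N) [h : TmR w t x] : TmR (w.pushN a) t x := h.mono (w.step_pushN a)
instance (a : M.N) [h : ClsR w C X] : ClsR (w.pushN a) C X := h.mono (w.step_pushN a)
instance (a : M.N) [h : TripR w q q'] : TripR (w.pushN a) q q' := h.mono (w.step_pushN a)
instance (A : M.sets) [h : TmR w t x] : TmR (w.pushS A) t x := h.mono (w.step_pushS A)
instance (A : M.sets) [h : ClsR w C X] : ClsR (w.pushS A) C X := h.mono (w.step_pushS A)
instance (a : QCode M) [h : TmR w t x] : TmR (w.pushT a) t x := h.mono (w.step_pushT a)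
instance (a : QCode M) [h : ClsR w C X] : ClsR (w.pushT a) C X := h.mono (w.step_pushT a)
instance (a : QCode M) [h : TripR w q q'] : TripR (w.pushT a) q q' := h.mono (w.step_pushT a)
instance [h : TripR w q q'] : TmR w q.a q'.a := h.a
instance [h : TripR w q q'] : TmR w q.b q'.b := h.b
instance [h : TripR w q q'] : TmR w q.c q'.c := h.c

instance (q : QCode M) : TripR (w.pushT q) w.trip q :=
  ⟨(inferInstance : TmR (((w.pushN q.a).pushN q.b).pushN q.c) (.var w.d) q.a),
    (inferInstance : TmR (((w.pushN q.a).pushN q.b).pushN q.c) (.var (w.pushN q.a).d) q.b),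
    (inferInstance : TmR (((w.pushN q.a).pushN q.b).pushN q.c)
      (.var ((w.pushN q.a).pushN q.b).d) q.c)⟩

/-- The head `C` is arbitrary, so this instance is a last resort. -/
instance (priority := 50) [h : ClsR w C X] [ht : TmR w t x] : BldR w (C t) (x ∈ X) :=
  h.out w (.refl w) t x ht

instance [h : BldR w A P] : BldR w (negB A) (¬ P) := ⟨not_congr h.out⟩
instance [h : BldR w A P] [h' : BldR w B Q] : BldR w (A ⋏ B) (P ∧ Q) :=
  ⟨and_congr h.out h'.out⟩
instance [h : BldR w A P] [h' : BldR w B Q] : BldR w (A ⋎ B) (P ∨ Q) :=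
  ⟨or_congr h.out h'.out⟩
instance [h : BldR w A P] [h' : BldR w B Q] : BldR w (A ⟹ B) (P → Q) :=
  ⟨imp_congr h.out h'.out⟩
instance [h : BldR w A P] [h' : BldR w B Q] : BldR w (A ⟺ B) (P ↔ Q) :=
  ⟨(and_congr (imp_congr h.out h'.out) (imp_congr h'.out h.out)).trans iff_def.symm⟩

instance {f : Tm → Bld} {P : M.N → Prop} [h : ∀ x, BldR (w.pushN x) (f (.var w.d)) (P x)] :
    BldR w (allN f) (∀ x, P x) := ⟨forall_congr' fun a => (h a).out⟩

instance {f : Tm → Bld} {P : M.N → Prop} [h : ∀ x, BldR (w.pushN x) (f (.var w.d)) (P x)] :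
    BldR w (exN f) (∃ x, P x) := ⟨exists_congr fun a => (h a).out⟩

instance {f : Cls → Bld} {P : M.sets → Prop} [h : ∀ A, BldR (w.pushS A) (f w.cls) (P A)] :
    BldR w (allS f) (∀ A, P A) := ⟨forall_congr' fun a => (h a).out⟩

instance {f : Cls → Bld} {P : M.sets → Prop} [h : ∀ A, BldR (w.pushS A) (f w.cls) (P A)] :
    BldR w (exS f) (∃ A, P A) := ⟨exists_congr fun a => (h a).out⟩

theorem BldR.of_iff {P Q : Prop} (h : BldR w A P) (hPQ : Q ↔ P) : BldR w A Q :=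
  ⟨h.out.trans hPQ.symm⟩

instance {f : Trip → Bld} {P : QCode M → Prop} [h : ∀ q, BldR (w.pushT q) (f w.trip) (P q)] :
    BldR w (allT f) (∀ q, P q) :=
  ⟨⟨fun H q => (h q).out.1 (H q.a q.b q.c), fun H a b c => (h ⟨a, b, c⟩).out.2 (H _)⟩⟩

instance {f : Trip → Bld} {P : QCode M → Prop} [h : ∀ q, BldR (w.pushT q) (f w.trip) (P q)] :
    BldR w (exT f) (∃ q, P q) :=
  ⟨⟨fun ⟨a, b, c, H⟩ => ⟨⟨a, b, c⟩, (h ⟨a, b, c⟩).out.1 H⟩,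
    fun ⟨q, H⟩ => ⟨q.a, q.b, q.c, (h q).out.2 H⟩⟩⟩

/-- The meaning `P` does not depend on the world, so truth under one assignment is truth under all.
The hypothesis is supplied by instance search along the syntax of the sentence. -/
theorem Model.satisfies_close_iff {A : Bld} {P : Prop}
    (h : ∀ w : World M, BldR w A P) : M.Satisfies (close A) ↔ P := by
  constructor
  · intro hM
    exact (h ⟨0, 0, fun _ => M.zero, fun _ => ⟨_, M.sets_nonempty.choose_spec⟩⟩).out.1 (hM _ _)
  · exact fun hP v V => (h ⟨0, 0, v, V⟩).out.2 hP

variable [IsRCA0 M]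

instance : TmR w 0 (0 : M.N) := ⟨fun _ _ => rfl⟩
instance : TmR w 1 (1 : M.N) := ⟨fun _ _ => rfl⟩
instance [hs : TmR w s x] [ht : TmR w t y] : TmR w (s + t) (x + y) :=
  ⟨fun w' h => congrArg₂ M.add (hs.out w' h) (ht.out w' h)⟩
instance [hs : TmR w s x] [ht : TmR w t y] : TmR w (s * t) (x * y) :=
  ⟨fun w' h => congrArg₂ M.mul (hs.out w' h) (ht.out w' h)⟩

instance [hs : TmR w s x] [ht : TmR w t y] : BldR w (s ≐ t) (x = y) :=
  ⟨by simp only [eqB, Fml.Realize, hs.out w (.refl w), ht.out w (.refl w)]⟩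
instance [hs : TmR w s x] [ht : TmR w t y] : BldR w (s ≺ t) (x < y) :=
  ⟨by simp only [ltB, Fml.Realize, hs.out w (.refl w), ht.out w (.refl w)]; rfl⟩
instance [hs : TmR w s x] [ht : TmR w t y] : BldR w (s ≼ t) (x ≤ y) :=
  (inferInstance : BldR w (s ≺ t ⋎ s ≐ t) (x < y ∨ x = y)).of_iff le_iff_lt_or_eq

instance [hs : TmR w s x] [ht : TmR w t y] : TmR w (pair s t) (npair x y) := by
  unfold pair npair; infer_instance

/-! ### Triples -/

/-- The number coding a triple. -/
def QCode.code (q : QCode M) : M.N := npair (npair q.a q.b) q.c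

instance [h : TripR w q q'] : TmR w q.code q'.code := by
  unfold Trip.code QCode.code; infer_instance

/-- A set of pairs, as a sequence of sets. -/
def nslice (X : Set M.N) (i : M.N) : Set M.N := {t | npair i t ∈ X}

instance [h : ClsR w C X] [ht : TmR w t x] : ClsR w (slice C t) (nslice X x) :=
  ⟨fun w' hw s a hs => by
    have := h.mono hw
    have := ht.mono hw
    exact inferInstanceAs (BldR w' (C (pair t s)) (npair x a ∈ X))⟩

def QCode.zero : QCode M := ⟨0, 0, 0⟩
def QCode.one : QCode M := ⟨1, 0, 0⟩
def QCode.recip (c : M.N) : QCode M := ⟨1, 0, c⟩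
def QCode.add (p q : QCode M) : QCode M :=
  ⟨p.a * (q.c + 1) + q.a * (p.c + 1), p.b * (q.c + 1) + q.b * (p.c + 1), p.c * q.c + p.c + q.c⟩
def QCode.neg (p : QCode M) : QCode M := ⟨p.b, p.a, p.c⟩
def QCode.sub (p q : QCode M) : QCode M := p.add q.neg
def QCode.Le (p q : QCode M) : Prop :=
  p.a * (q.c + 1) + q.b * (p.c + 1) ≤ q.a * (p.c + 1) + p.b * (q.c + 1)
def QCode.Lt (p q : QCode M) : Prop :=
  p.a * (q.c + 1) + q.b * (p.c + 1) < q.a * (p.c + 1) + p.b * (q.c + 1)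

instance : TripR w qzero (QCode.zero (M := M)) := by
  unfold qzero QCode.zero; exact ⟨inferInstance, inferInstance, inferInstance⟩
instance : TripR w qone (QCode.one (M := M)) := by
  unfold qone QCode.one; exact ⟨inferInstance, inferInstance, inferInstance⟩
instance [ht : TmR w t x] : TripR w (SOA.recip t) (QCode.recip x) := by
  unfold SOA.recip QCode.recip; exact ⟨inferInstance, inferInstance, ht⟩
instance [hp : TripR w p p'] [hq : TripR w q q'] : TripR w (qadd p q) (p'.add q') := by
  unfold qadd QCode.add; constructor <;> dsimp only <;> infer_instance
instance [hp : TripR w p p'] : TripR w (qneg p) p'.neg := ⟨hp.b, hp.a, hp.c⟩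
instance [hp : TripR w p p'] [hq : TripR w q q'] : TripR w (qsub p q) (p'.sub q') := by
  unfold qsub QCode.sub; infer_instance
instance [hp : TripR w p p'] [hq : TripR w q q'] : BldR w (qle p q) (p'.Le q') := by
  unfold qle QCode.Le; infer_instance
instance [hp : TripR w p p'] [hq : TripR w q q'] : BldR w (qlt p q) (p'.Lt q') := by
  unfold qlt QCode.Lt; infer_instance
instance [hp : TripR w p p'] [hq : TripR w q q'] [hr : TripR w r r'] :
    BldR w (qdistLe p q r) (p'.Le (q'.add r') ∧ q'.Le (p'.add r')) := by
  unfold qdistLe; infer_instance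
instance [hp : TripR w p p'] [hq : TripR w q q'] [hr : TripR w r r'] :
    BldR w (qdistLt p q r) (p'.Lt (q'.add r') ∧ q'.Lt (p'.add r')) := by
  unfold qdistLt; infer_instance

/-! ### Weak Kőnig's lemma -/

instance [hp : TripR w p p'] [ht : TmR w t x] : BldR w (bit p t) (nbit p'.b p'.c x) := by
  unfold bit nbit; infer_instance

def IsTree (X : Set M.N) : Prop :=
  ∀ s t : QCode M, s.code ∈ X → t.a ≤ s.a →
    (∀ i, i < t.a → (nbit t.b t.c i ↔ nbit s.b s.c i)) → t.code ∈ X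

def IsInfiniteTree (X : Set M.N) : Prop := ∀ k, ∃ s : QCode M, s.a = k ∧ s.code ∈ X

def IsPath (X Y : Set M.N) : Prop :=
  ∀ k, ∃ s : QCode M, s.a = k ∧ s.code ∈ X ∧ ∀ i, i < k → (i ∈ Y ↔ nbit s.b s.c i)

instance [h : ClsR w C X] : BldR w (isTree C) (IsTree X) := by
  unfold isTree IsTree; infer_instance
instance [h : ClsR w C X] : BldR w (isInfiniteTree C) (IsInfiniteTree X) := by
  unfold isInfiniteTree IsInfiniteTree; infer_instance
instance [h : ClsR w C X] [h : ClsR w D Y] : BldR w (isPath C D) (IsPath X Y) := by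
  unfold isPath IsPath; infer_instance

theorem satisfies_weakKonig_iff : M.Satisfies weakKonig ↔
    ∀ T : M.sets, IsTree T.1 → IsInfiniteTree T.1 → ∃ X : M.sets, IsPath T.1 X.1 :=
  Model.satisfies_close_iff fun _ => inferInstance

/-! ### Real numbers -/

def Pow2 (x y : M.N) : Prop :=
  ∃ E : M.sets, npair 0 1 ∈ E.1 ∧
    (∀ i z, npair i z ∈ E.1 → npair (i + 1) (z + z) ∈ E.1) ∧
    (∀ i z u, npair i z ∈ E.1 → npair i u ∈ E.1 → z = u) ∧ npair x y ∈ E.1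

instance [hs : TmR w s x] [ht : TmR w t y] : BldR w (pow2 s t) (Pow2 x y) := by
  unfold pow2 Pow2; infer_instance

def HalfPow (x : M.N) (P : QCode M → Prop) : Prop := ∃ c, Pow2 x (c + 1) ∧ P (.recip c)

instance [hs : TmR w s x] {f : Trip → Bld} {P : QCode M → Prop}
    [h : ∀ x, BldR (w.pushN x) (f (SOA.recip (.var w.d))) (P (.recip x))] :
    BldR w (withHalfPow s f) (HalfPow x P) := by
  unfold withHalfPow HalfPow; infer_instance

def Term (X : Set M.N) (k : M.N) (q : QCode M) : Prop := npair k q.code ∈ X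

instance [h : ClsR w C X] [ht : TmR w t x] [hq : TripR w q q'] :
    BldR w (term C t q) (Term X x q') := by
  unfold term Term; infer_instance

def IsReal (X : Set M.N) : Prop :=
  (∀ k, ∃ q, Term X k q) ∧
  (∀ k, ∀ p q, Term X k p → Term X k q → p.code = q.code) ∧
  (∀ k i, ∀ p q, Term X k p → Term X (k + i) q →
    HalfPow k fun ε => p.Le (q.add ε) ∧ q.Le (p.add ε))

instance [h : ClsR w C X] : BldR w (isReal C) (IsReal X) := by
  unfold isReal IsReal; infer_instance

def RealLe (X Y : Set M.N) : Prop :=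
  ∀ k, ∀ p q, Term X k p → Term Y k q → HalfPow k fun ε => p.Le (q.add (ε.add ε))

instance [h : ClsR w C X] [h' : ClsR w D Y] : BldR w (realLe C D) (RealLe X Y) := by
  unfold realLe RealLe; infer_instance

def RealLt (X Y : Set M.N) : Prop := ¬ RealLe Y X
def RealEq (X Y : Set M.N) : Prop := RealLe X Y ∧ RealLe Y X

instance [h : ClsR w C X] [h' : ClsR w D Y] : BldR w (realLt C D) (RealLt X Y) := by
  unfold realLt RealLt; infer_instance
instance [h : ClsR w C X] [h' : ClsR w D Y] : BldR w (realEq C D) (RealEq X Y) := by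
  unfold realEq RealEq; infer_instance

def RatReal (q : QCode M) : Set M.N := {t | ∃ k, t = npair k q.code}

instance [h : TripR w q q'] : ClsR w (ratReal q) (RatReal q') :=
  ⟨fun w' hw s a hs => by
    have := h.mono hw
    exact inferInstanceAs (BldR w' (exN fun k => s ≐ pair k q.code) (∃ k, a = npair k q'.code))⟩

def RealAdd (X Y : Set M.N) : Set M.N :=
  {t | ∃ k, ∃ p q, Term X (k + 1) p ∧ Term Y (k + 1) q ∧ t = npair k (p.add q).code}

instance [h : ClsR w C X] [h' : ClsR w D Y] : ClsR w (realAdd C D) (RealAdd X Y) :=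
  ⟨fun w' hw s a hs => by
    have := h.mono hw
    have := h'.mono hw
    exact inferInstanceAs (BldR w' (exN fun k => exT fun p => exT fun q =>
      term C (k + 1) p ⋏ term D (k + 1) q ⋏ (s ≐ pair k (qadd p q).code))
      (∃ k, ∃ p q, Term X (k + 1) p ∧ Term Y (k + 1) q ∧ a = npair k (p.add q).code))⟩

def RealZero : Set M.N := RatReal .zero
def RealOne : Set M.N := RatReal .one

instance : ClsR w realZero (RealZero (M := M)) := by unfold realZero RealZero; infer_instance
instance : ClsR w realOne (RealOne (M := M)) := by unfold realOne RealOne; infer_instance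

/-! ### Spaces -/

structure SSpace (M : Model.{u}) where
  point : Set M.N → Prop
  same : Set M.N → Set M.N → Prop
  base : QCode M → Prop
  embed : QCode M → Set M.N
  distLt : Set M.N → Set M.N → Set M.N → Prop

class SpaceR (S : Space) (S' : outParam (SSpace M)) : Prop where
  point {w : World M} {C X} : ClsR w C X → BldR w (S.point C) (S'.point X)
  same {w : World M} {C X D Y} : ClsR w C X → ClsR w D Y → BldR w (S.same C D) (S'.same X Y)
  base {w : World M} {q q'} : TripR w q q' → BldR w (S.base q) (S'.base q')
  embed {w : World M} {q q'} : TripR w q q' → ClsR w (S.embed q) (S'.embed q')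
  distLt {w : World M} {C X D Y E Z} : ClsR w C X → ClsR w D Y → ClsR w E Z →
    BldR w (S.distLt C D E) (S'.distLt X Y Z)

def Interval (M : Model.{u}) [IsRCA0 M] : SSpace M where
  point X := IsReal X ∧ RealLe RealZero X ∧ RealLe X RealOne
  same := RealEq
  base a := QCode.zero.Le a ∧ a.Le .one
  embed := RatReal
  distLt X Y r := RealLt X (RealAdd Y r) ∧ RealLt Y (RealAdd X r)

def Cantor (M : Model.{u}) [IsRCA0 M] : SSpace M where
  point _ := (0 : M.N) = 0
  same X Y := ∀ i, i ∈ X ↔ i ∈ Y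
  base _ := (0 : M.N) = 0
  embed s := {i | i < s.a ∧ nbit s.b s.c i}
  distLt X Y r :=
    ((∀ i, i ∈ X ↔ i ∈ Y) ∧ RealLt RealZero r) ∨
    (∃ n, (∀ i, i < n → (i ∈ X ↔ i ∈ Y)) ∧ ¬ (n ∈ X ↔ n ∈ Y) ∧
      HalfPow n fun ε => RealLt (RatReal ε) r)

instance : SpaceR interval (Interval M) where
  point _ := by unfold interval Interval; infer_instance
  same _ _ := by unfold interval Interval; infer_instance
  base _ := by unfold interval Interval; infer_instance
  embed _ := by unfold interval Interval; infer_instance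
  distLt _ _ _ := by unfold interval Interval; infer_instance

instance : SpaceR cantor (Cantor M) where
  point _ := by unfold cantor Cantor; infer_instance
  same _ _ := by unfold cantor Cantor; infer_instance
  base _ := by unfold cantor Cantor; infer_instance
  embed {w q q'} h := ⟨fun w' hw s a hs => by
    have := h.mono hw
    exact inferInstanceAs (BldR w' ((s ≺ q.a) ⋏ bit q s) (a < q'.a ∧ nbit q'.b q'.c a))⟩
  distLt _ _ _ := by unfold cantor Cantor; infer_instance

variable {S : Space} {S' : SSpace M} [hS : SpaceR S S']

instance [h : ClsR w C X] : BldR w (S.point C) (S'.point X) := hS.point h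
instance [h : ClsR w C X] [h' : ClsR w D Y] : BldR w (S.same C D) (S'.same X Y) := hS.same h h'
instance [h : TripR w q q'] : BldR w (S.base q) (S'.base q') := hS.base h
instance [h : TripR w q q'] : ClsR w (S.embed q) (S'.embed q') := hS.embed h
instance {E : Cls} {Z : Set M.N} [h : ClsR w C X] [h' : ClsR w D Y] [h'' : ClsR w E Z] :
    BldR w (S.distLt C D E) (S'.distLt X Y Z) := hS.distLt h h' h''

/-! ### Codes of continuous functions -/

def relCode (n : M.N) (a r b s : QCode M) : M.N :=
  npair (npair (npair (npair n a.code) r.code) b.code) s.code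

def Rel (X : Set M.N) (a r b s : QCode M) : Prop := ∃ n, relCode n a r b s ∈ X

instance {s : Trip} {s' : QCode M} [h : ClsR w C X] [hp : TripR w p p'] [hq : TripR w q q']
    [hr : TripR w r r'] [hs : TripR w s s'] : BldR w (rel C p q r s) (Rel X p' q' r' s') := by
  unfold rel Rel relCode; infer_instance

def IsContCode (S' : SSpace M) (X : Set M.N) : Prop :=
  (∀ a r b s, Rel X a r b s → S'.base a ∧ QCode.zero.Lt r ∧ QCode.zero.Lt s) ∧
  (∀ a r b s b' s', Rel X a r b s → Rel X a r b' s' →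
    b.Le (b'.add (s.add s')) ∧ b'.Le (b.add (s.add s'))) ∧
  (∀ a r b s a' r', Rel X a r b s → S'.base a' → QCode.zero.Lt r' →
    S'.distLt (S'.embed a') (S'.embed a) (RatReal (r.sub r')) → Rel X a' r' b s) ∧
  (∀ a r b s b' s', Rel X a r b s → QCode.zero.Lt s' →
    b.Lt (b'.add (s'.sub s)) ∧ b'.Lt (b.add (s'.sub s)) → Rel X a r b' s')

instance [h : ClsR w C X] : BldR w (isContCode S C) (IsContCode S' X) := by
  unfold isContCode IsContCode; infer_instance

def InDom (S' : SSpace M) (X Y : Set M.N) : Prop :=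
  ∀ ε, QCode.zero.Lt ε → ∃ a r b s, Rel X a r b s ∧ S'.distLt Y (S'.embed a) (RatReal r) ∧ s.Lt ε

instance [h : ClsR w C X] [h' : ClsR w D Y] : BldR w (inDom S C D) (InDom S' X Y) := by
  unfold inDom InDom; infer_instance

def Value (S' : SSpace M) (X Y Z : Set M.N) : Prop :=
  InDom S' X Y ∧ IsReal Z ∧ ∀ a r b s, Rel X a r b s → S'.distLt Y (S'.embed a) (RatReal r) →
    RealLe Z (RatReal (b.add s)) ∧ RealLe (RatReal b) (RealAdd Z (RatReal s))

instance {E : Cls} {Z : Set M.N} [h : ClsR w C X] [h' : ClsR w D Y] [h'' : ClsR w E Z] :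
    BldR w (value S C D E) (Value S' X Y Z) := by
  unfold value Value; infer_instance

def IsGauge (S' : SSpace M) (X : Set M.N) : Prop :=
  IsContCode S' X ∧ ∀ Y : M.sets, S'.point Y.1 →
    InDom S' X Y.1 ∧ ∀ Z : M.sets, Value S' X Y.1 Z.1 → RealLt RealZero Z.1

instance [h : ClsR w C X] : BldR w (isGauge S C) (IsGauge S' X) := by
  unfold isGauge IsGauge; infer_instance

def HasFineCover (S' : SSpace M) (X : Set M.N) : Prop :=
  ∃ (n : M.N) (P : M.sets) (R : M.sets),
    (∀ i, i < n → S'.point (nslice P.1 i) ∧ IsReal (nslice R.1 i) ∧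
      RealLt RealZero (nslice R.1 i) ∧
      ∃ y : M.sets, Value S' X (nslice P.1 i) y.1 ∧ RealLe (nslice R.1 i) y.1) ∧
    (∀ i j, i < j → j < n → ¬ S'.same (nslice P.1 i) (nslice P.1 j)) ∧
    (∀ x : M.sets, S'.point x.1 → ∃ i, i < n ∧ S'.distLt x.1 (nslice P.1 i) (nslice R.1 i))

instance [h : ClsR w C X] : BldR w (hasFineCover S C) (HasFineCover S' X) := by
  unfold hasFineCover HasFineCover; infer_instance

def HasFinePartition (Φ : Set M.N) : Prop :=
  ∃ (n : M.N) (X : M.sets) (Z : M.sets),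
    (∀ i, i ≤ n → (Interval M).point (nslice X.1 i)) ∧
    RealEq (nslice X.1 0) RealZero ∧ RealEq (nslice X.1 n) RealOne ∧
    (∀ i, i < n → (Interval M).point (nslice Z.1 i) ∧
      RealLe (nslice X.1 i) (nslice Z.1 i) ∧ RealLe (nslice Z.1 i) (nslice X.1 (i + 1)) ∧
      ∃ y : M.sets, Value (Interval M) Φ (nslice Z.1 i) y.1 ∧
        RealLe (nslice X.1 (i + 1)) (RealAdd (nslice X.1 i) y.1))

instance [h : ClsR w C X] : BldR w (hasFinePartition C) (HasFinePartition X) := by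
  unfold hasFinePartition HasFinePartition; infer_instance

theorem satisfies_cousin_iff (S : Space) (S' : SSpace M) [SpaceR S S'] :
    M.Satisfies (cousin S) ↔ ∀ X : M.sets, IsGauge S' X.1 → HasFineCover S' X.1 :=
  Model.satisfies_close_iff fun _ => inferInstance

theorem satisfies_cousinPartition_iff : M.Satisfies cousinPartition ↔
    ∀ X : M.sets, IsGauge (Interval M) X.1 → HasFinePartition X.1 :=
  Model.satisfies_close_iff fun _ => inferInstance

end Means

end SOA


namespace SOA

open Model

variable {M : Model.{u}} [IsRCA0 M]

/-! ## Values of rational codes -/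

theorem QCode.code_inj {p q : QCode M} : p.code = q.code ↔ p = q := by
  unfold QCode.code
  rw [npair_inj, npair_inj, QCode.ext_iff, and_assoc]

/-- The ordered field of fractions of the numbers of a model. -/
abbrev Model.K (M : Model.{u}) [IsRCA0 M] : Type u := Frac M.N

namespace QCode

/-- The rational number coded by a triple. -/
noncomputable def val (q : QCode M) : M.K := (toFrac q.a - toFrac q.b) / (toFrac q.c + 1)

theorem den_pos (a : M.N) : (0 : M.K) < toFrac a + 1 :=
  add_pos_of_nonneg_of_pos (toFrac_nonneg a) one_pos

@[simp] theorem val_zero : (zero : QCode M).val = 0 := by simp [val, zero]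
@[simp] theorem val_one : (one : QCode M).val = 1 := by simp [val, one]
@[simp] theorem val_recip (c : M.N) : (recip c).val = 1 / (toFrac c + 1) := by simp [val, recip]

@[simp] theorem val_add (p q : QCode M) : (p.add q).val = p.val + q.val := by
  have hp := (den_pos p.c).ne'
  have hq := (den_pos q.c).ne'
  have hpq : toFrac p.c * toFrac q.c + toFrac p.c + toFrac q.c + 1 =
    (toFrac p.c + 1) * (toFrac q.c + 1 : M.K) := by ring
  simp only [val, add, map_add, map_mul, map_one, hpq]
  field_simp
  ring

@[simp] theorem val_neg (p : QCode M) : p.neg.val = -p.val := by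
  simp only [val, neg]; ring

@[simp] theorem val_sub (p q : QCode M) : (p.sub q).val = p.val - q.val := by
  rw [sub, val_add, val_neg, sub_eq_add_neg]

theorem le_iff {p q : QCode M} : p.Le q ↔ p.val ≤ q.val := by
  rw [Le, ← toFrac_strictMono.le_iff_le, val, val, div_le_div_iff₀ (den_pos _) (den_pos _)]
  simp only [map_add, map_mul, map_one]
  constructor <;> intro h <;> linarith

theorem lt_iff {p q : QCode M} : p.Lt q ↔ p.val < q.val := by
  rw [Lt, ← toFrac_strictMono.lt_iff_lt, val, val, div_lt_div_iff₀ (den_pos _) (den_pos _)]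
  simp only [map_add, map_mul, map_one]
  constructor <;> intro h <;> linarith

theorem exists_val_eq (x : M.K) : ∃ q : QCode M, q.val = x := by
  obtain ⟨a, b, hb, rfl | rfl⟩ := exists_toFrac x <;>
  obtain ⟨c, rfl⟩ := (eq_zero_or_eq_add_one b).resolve_left hb
  · exact ⟨⟨a, 0, c⟩, by simp [val]⟩
  · exact ⟨⟨0, a, c⟩, by simp [val, neg_div]⟩

end QCode

/-! ### Negative powers of two -/

/-- `2 ^ (-k)`. -/
noncomputable def hp (k : M.N) : M.K := 1 / toFrac (pw k)

theorem toFrac_pos {a : M.N} (h : 0 < a) : (0 : M.K) < toFrac a := by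
  rw [← map_zero (toFrac (N := M.N))]; exact toFrac_strictMono h

theorem hp_pos (k : M.N) : 0 < hp k := one_div_pos.2 (toFrac_pos (pw_pos k))

theorem hp_add_one (k : M.N) : hp (k + 1) = hp k / 2 := by
  rw [hp, hp, pw_add_one, map_add, ← two_mul, div_div, mul_comm]

theorem hp_anti {k l : M.N} (h : k ≤ l) : hp l ≤ hp k :=
  one_div_le_one_div_of_le (toFrac_pos (pw_pos k)) (toFrac_mono (pw_le_pw h))

theorem exists_le_toFrac (x : M.K) : ∃ a : M.N, x ≤ toFrac a := by
  obtain ⟨a, b, hb, rfl | rfl⟩ := exists_toFrac x <;>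
  obtain ⟨c, rfl⟩ := (eq_zero_or_eq_add_one b).resolve_left hb
  · refine ⟨a, div_le_self (toFrac_nonneg a) ?_⟩
    rw [map_add, map_one]
    exact le_add_of_nonneg_left (toFrac_nonneg c)
  · exact ⟨0, by
      rw [map_zero, neg_nonpos]; exact div_nonneg (toFrac_nonneg _) (toFrac_nonneg _)⟩

/-- The numbers of the model are cofinal in its own field, even if that field is not Archimedean,
and `a < 2 ^ a`. -/
theorem exists_hp_lt {x : M.K} (hx : 0 < x) : ∃ k : M.N, hp k < x := by
  obtain ⟨a, ha⟩ := exists_le_toFrac (1 / x)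
  refine ⟨a, ?_⟩
  rw [hp, one_div_lt (toFrac_pos (pw_pos a)) hx]
  exact ha.trans_lt (toFrac_strictMono (lt_pw a))

theorem pow2_iff {k y : M.N} : Pow2 k y ↔ pw k = y := by
  constructor
  · rintro ⟨E, h0, hs, hu, hk⟩
    have key : npair k (pw k) ∈ E.1 := by
      refine induction_sigma1 (P := fun k => npair k (pw k) ∈ E.1) (hP := ?_) ?_ (fun k h => ?_) k
      · exact Sigma1.of_iff (P := fun v => ∃ y, pw (v 0) = y ∧ npair (v 0) y ∈ E.1)
          (by infer_instance) fun _ => by simp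
      · rwa [pw_zero]
      · rw [pw_add_one]; exact hs _ _ h
    exact hu _ _ _ key hk
  · rintro rfl
    refine ⟨expSet M, mem_expSet.2 pw_zero, fun i z h => ?_, fun i z u h h' => ?_,
      mem_expSet.2 rfl⟩
    · rw [mem_expSet] at h ⊢
      rw [pw_add_one, h]
    · rw [mem_expSet] at h h'
      rw [← h, ← h']

theorem exists_pw_eq (k : M.N) : ∃ c, pw k = c + 1 :=
  (eq_zero_or_eq_add_one (pw k)).resolve_left (pw_pos k).ne'

/-- A code of `2 ^ (-k)`. -/
noncomputable def halfCode (k : M.N) : QCode M := .recip (exists_pw_eq k).choose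

/-- Replaces the code chosen outside the model by a quantified one, which makes the statement
definable. -/
theorem halfCode_iff {k : M.N} {P : QCode M → Prop} :
    P (halfCode k) ↔ ∃ c, pw k = c + 1 ∧ P (.recip c) := by
  have h := (exists_pw_eq k).choose_spec
  constructor
  · exact fun hP => ⟨_, h, hP⟩
  · rintro ⟨c, hc, hP⟩
    rw [halfCode]
    convert hP using 2
    exact add_right_cancel (h.symm.trans hc)

theorem halfPow_iff {k : M.N} {P : QCode M → Prop} : HalfPow k P ↔ P (halfCode k) := by
  simp only [HalfPow, pow2_iff, halfCode_iff (P := P)]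

theorem val_recip_eq {k c : M.N} (h : pw k = c + 1) : (QCode.recip c).val = hp k := by
  rw [QCode.val_recip, hp, h, map_add, map_one]

@[simp] theorem val_halfCode (k : M.N) : (halfCode k).val = hp k :=
  val_recip_eq (exists_pw_eq k).choose_spec

/-! ## Coded real numbers -/

/-- `X` codes the sequence `q`. -/
def IsSeq (X : Set M.N) (q : M.N → QCode M) : Prop := ∀ k p, Term X k p ↔ p = q k

/-- A sequence converging at the rate required of real numbers. -/
def IsRapid (x : M.N → M.K) : Prop := ∀ k i, |x k - x (k + i)| ≤ hp k

theorem IsRapid.sub_le {x : M.N → M.K} (h : IsRapid x) {k l : M.N} (hkl : k ≤ l) :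
    |x k - x l| ≤ hp k := by
  obtain ⟨i, rfl⟩ := exists_add_of_le hkl
  exact h k i

theorem isReal_iff {X : Set M.N} :
    IsReal X ↔ ∃ q, IsSeq X q ∧ IsRapid fun k => (q k).val := by
  have key : ∀ p q ε : QCode M, (p.Le (q.add ε) ∧ q.Le (p.add ε)) ↔ |p.val - q.val| ≤ ε.val := by
    intro p q ε
    rw [QCode.le_iff, QCode.le_iff, QCode.val_add, QCode.val_add, abs_sub_le_iff,
      sub_le_iff_le_add', sub_le_iff_le_add']
  simp only [IsReal, halfPow_iff, key, val_halfCode, QCode.code_inj]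
  constructor
  · rintro ⟨h, hu, hr⟩
    choose q hq using h
    exact ⟨q, fun k p => ⟨fun hp => hu k _ _ hp (hq k), by rintro rfl; exact hq k⟩,
      fun k i => hr k i _ _ (hq k) (hq _)⟩
  · rintro ⟨q, hq, hr⟩
    refine ⟨fun k => ⟨q k, (hq k _).2 rfl⟩, fun k p p' h h' => ?_, fun k i p p' h h' => ?_⟩
    · rw [(hq k _).1 h, (hq k _).1 h']
    · rw [(hq k _).1 h, (hq _ _).1 h']
      exact hr k i

theorem isSeq_ratReal (a : QCode M) : IsSeq (RatReal a) fun _ => a := fun k p => by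
  constructor
  · rintro ⟨l, h⟩
    exact QCode.code_inj.1 (npair_inj.1 h).2
  · rintro rfl
    exact ⟨k, rfl⟩

theorem isReal_ratReal (a : QCode M) : IsReal (RatReal a) :=
  isReal_iff.2 ⟨_, isSeq_ratReal a, fun k i => by simpa using (hp_pos k).le⟩

theorem IsSeq.realAdd {X Y : Set M.N} {p q : M.N → QCode M} (hX : IsSeq X p) (hY : IsSeq Y q) :
    IsSeq (RealAdd X Y) fun k => (p (k + 1)).add (q (k + 1)) := fun k r => by
  constructor
  · rintro ⟨l, p', q', hp', hq', h⟩
    obtain ⟨rfl, hc⟩ := npair_inj.1 h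
    rw [QCode.code_inj.1 hc, (hX _ _).1 hp', (hY _ _).1 hq']
  · rintro rfl
    exact ⟨k, _, _, (hX _ _).2 rfl, (hY _ _).2 rfl, rfl⟩

theorem IsSeq.realLe_iff {X Y : Set M.N} {p q : M.N → QCode M} (hX : IsSeq X p)
    (hY : IsSeq Y q) : RealLe X Y ↔ ∀ k, (p k).val ≤ (q k).val + 2 * hp k := by
  simp only [RealLe, halfPow_iff, QCode.le_iff, QCode.val_add, val_halfCode, hX _ _, hY _ _,
    two_mul]
  exact ⟨fun h k => h k _ _ rfl rfl, fun h k p q hp hq => hp ▸ hq ▸ h k⟩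

theorem IsSeq.realLt_iff {X Y : Set M.N} {p q : M.N → QCode M} (hX : IsSeq X p)
    (hY : IsSeq Y q) : RealLt X Y ↔ ∃ k, (p k).val + 2 * hp k < (q k).val := by
  rw [RealLt, hY.realLe_iff hX]
  push Not
  rfl

/-- Takes the place of passing to the limit in `k`, as `hp k` becomes smaller than any positive
element of the field. -/
theorem le_of_forall_hp {x y c : M.K} (h : ∀ k, x ≤ y + c * hp k) : x ≤ y := by
  by_contra! hlt
  obtain ⟨k, hk⟩ := exists_hp_lt (div_pos (sub_pos.2 hlt) (show 0 < |c| + 1 by positivity))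
  rw [lt_div_iff₀ (by positivity)] at hk
  have h1 := h k
  have h2 : c * hp k ≤ hp k * (|c| + 1) := by
    have := hp_pos k
    nlinarith [le_abs_self c]
  linarith

theorem realLe_ratReal_iff {a b : QCode M} :
    RealLe (RatReal a) (RatReal b) ↔ a.val ≤ b.val := by
  rw [(isSeq_ratReal a).realLe_iff (isSeq_ratReal b)]
  exact ⟨le_of_forall_hp, fun h k => h.trans (by have := hp_pos k; linarith)⟩

theorem realLt_ratReal_iff {a b : QCode M} :
    RealLt (RatReal a) (RatReal b) ↔ a.val < b.val := by
  rw [RealLt, realLe_ratReal_iff, not_le]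

/-! ## Definability with triples -/

class TermQ (f : (ℕ → M.N) → QCode M) : Prop where
  a : TermFn M fun v => (f v).a
  b : TermFn M fun v => (f v).b
  c : TermFn M fun v => (f v).c

section

variable {f g : (ℕ → M.N) → QCode M} {x y z : (ℕ → M.N) → M.N}

instance [hx : TermFn M x] [hy : TermFn M y] [hz : TermFn M z] :
    TermQ fun v => ⟨x v, y v, z v⟩ := ⟨hx, hy, hz⟩
instance (q : QCode M) : TermQ fun _ => q := ⟨inferInstance, inferInstance, inferInstance⟩
instance TermQ.comp [h : TermQ f] (s : ℕ → ℕ) : TermQ fun v => f fun i => v (s i) :=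
  have := h.a; have := h.b; have := h.c
  ⟨TermFn.comp (f := fun v => (f v).a) s, TermFn.comp (f := fun v => (f v).b) s,
    TermFn.comp (f := fun v => (f v).c) s⟩
instance [hx : TermFn M x] : TermQ fun v => .recip (x v) := by
  unfold QCode.recip; infer_instance
instance [hf : TermQ f] [hg : TermQ g] : TermQ fun v => (f v).add (g v) := by
  have := hf.a; have := hf.b; have := hf.c
  have := hg.a; have := hg.b; have := hg.c
  unfold QCode.add; infer_instance
instance [hf : TermQ f] : TermFn M fun v => (f v).code := by
  have := hf.a; have := hf.b; have := hf.c
  unfold QCode.code; infer_instance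
instance [hf : TermQ f] [hg : TermQ g] : Delta0 M fun v => (f v).Le (g v) := by
  have := hf.a; have := hf.b; have := hf.c
  have := hg.a; have := hg.b; have := hg.c
  unfold QCode.Le; infer_instance
instance [hf : TermQ f] [hg : TermQ g] : Delta0 M fun v => (f v).Lt (g v) := by
  have := hf.a; have := hf.b; have := hf.c
  have := hg.a; have := hg.b; have := hg.c
  unfold QCode.Lt; infer_instance
instance (A : M.sets) [hx : TermFn M x] [hf : TermQ f] : Delta0 M fun v => Term A.1 (x v) (f v) := by
  unfold Term; infer_instance
instance {h k : (ℕ → M.N) → QCode M} [TermFn M x] [TermQ f] [TermQ g] [TermQ h] [TermQ k] :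
    TermFn M fun v => relCode (x v) (f v) (g v) (h v) (k v) := by
  unfold relCode; infer_instance
instance {h k : (ℕ → M.N) → QCode M} (A : M.sets) [TermQ f] [TermQ g] [TermQ h] [TermQ k] :
    Sigma1 M fun v => Rel A.1 (f v) (g v) (h v) (k v) := by
  unfold Rel; infer_instance

/-- The components are bound in the order `a`, `b`, `c`, so the last one is variable `0` and the
outer variables are shifted by three. -/
instance Sigma1.ex_triple {P : (ℕ → M.N) → QCode M → Prop}
    [hP : Sigma1 M fun v => P (fun i => v (i + 3)) ⟨v 2, v 1, v 0⟩] :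
    Sigma1 M fun v => ∃ q, P v q :=
  Sigma1.of_iff (P := fun v => ∃ a b c, P v ⟨a, b, c⟩)
    (Sigma1.ex (P := fun v a => ∃ b c, P v ⟨a, b, c⟩)
      (hP := Sigma1.ex (P := fun v b => ∃ c, P (fun i => v (i + 1)) ⟨v 0, b, c⟩)
        (hP := Sigma1.ex (P := fun v c => P (fun i => v (i + 2)) ⟨v 1, v 0, c⟩) (hP := hP))))
    fun _ => ⟨fun ⟨q, h⟩ => ⟨q.a, q.b, q.c, h⟩, fun ⟨_, _, _, h⟩ => ⟨_, h⟩⟩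

instance Delta0.bex_triple {P : (ℕ → M.N) → QCode M → Prop} [hx : TermFn M x]
    [hP : Delta0 M fun v => P (fun i => v (i + 3)) ⟨v 2, v 1, v 0⟩] :
    Delta0 M fun v => ∃ q, q.code ≤ x v ∧ P v q := by
  have h : Delta0 M fun v => (⟨v 2, v 1, v 0⟩ : QCode M).code ≤ x (fun i => v (i + 3)) ∧
      P (fun i => v (i + 3)) ⟨v 2, v 1, v 0⟩ := by infer_instance
  have : Delta0 M fun v => ∃ a, a ≤ x v ∧ ∃ b, b ≤ x v ∧ ∃ c, c ≤ x v ∧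
      (⟨a, b, c⟩ : QCode M).code ≤ x v ∧ P v ⟨a, b, c⟩ :=
    Delta0.bex_le (P := fun v a => ∃ b, b ≤ x v ∧ ∃ c, c ≤ x v ∧
        (⟨a, b, c⟩ : QCode M).code ≤ x v ∧ P v ⟨a, b, c⟩)
      (hP := Delta0.bex_le (f := fun v => x fun i => v (i + 1))
        (P := fun v b => ∃ c, c ≤ x (fun i => v (i + 1)) ∧
        (⟨v 0, b, c⟩ : QCode M).code ≤ x (fun i => v (i + 1)) ∧ P (fun i => v (i + 1)) ⟨v 0, b, c⟩)
        (hP := Delta0.bex_le (f := fun v => x fun i => v (i + 2)) (P := fun v c =>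
          (⟨v 1, v 0, c⟩ : QCode M).code ≤ x (fun i => v (i + 2)) ∧
            P (fun i => v (i + 2)) ⟨v 1, v 0, c⟩) (hP := h)))
  refine this.of_iff fun v => ⟨?_, fun ⟨a, _, b, _, c, _, h⟩ => ⟨_, h⟩⟩
  rintro ⟨q, h, h'⟩
  have h1 : npair q.a q.b ≤ x v := (left_le_npair _ _).trans h
  exact ⟨q.a, (left_le_npair _ _).trans h1, q.b, (right_le_npair _ _).trans h1, q.c,
    (right_le_npair _ _).trans h, h, h'⟩

end

/-- A function picking, for every `x`, some `y` with `R x y`, for a `Σ⁰₁` relation. -/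
theorem exists_choice_sigma1 (R : M.N → M.N → Prop) [hR : Sigma1 M fun v => R (v 0) (v 1)]
    (h : ∀ x, ∃ y, R x y) : ∃ A : M.sets, (∀ x, ∃! y, npair x y ∈ A.1) ∧
      ∀ x y, npair x y ∈ A.1 → R x y := by
  obtain ⟨Q, hQ, hRQ⟩ := hR
  have hRQ' : ∀ x y, R x y ↔ ∃ z, Q (push z (push x (push y fun _ => 0))) := fun x y =>
    hRQ (push x (push y fun _ => 0))
  have hQ3 : ∀ i j k : ℕ, Delta0 M fun v => Q (push (v i) (push (v j) (push (v k) fun _ => 0))) :=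
    fun i j k => hQ.subst (σ := fun n v => push (v i) (push (v j) (push (v k) fun _ => 0)) n) (by
      rintro (_ | _ | _ | n)
      exacts [.var _, .var _, .var _, .const _])
  -- First a pair of a value and a witness of the `Σ⁰₁` formula is chosen, which is a `Δ⁰₀` task;
  -- then the pair is projected to the value.
  obtain ⟨B, hB, hBR⟩ := exists_choice (M := M) (fun x w => ∃ y, y ≤ w ∧ ∃ z, z ≤ w ∧
      w = npair y z ∧ Q (push z (push x (push y fun _ => 0)))) fun x => by
    obtain ⟨y, hy⟩ := h x
    obtain ⟨z, hz⟩ := (hRQ' x y).1 hy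
    exact ⟨npair y z, y, left_le_npair _ _, z, right_le_npair _ _, rfl, hz⟩
  have hu : ∀ x, ∃! y, ∃ w, npair x w ∈ B.1 ∧ ∃ z, w = npair y z := fun x => by
    obtain ⟨w, hw, hw'⟩ := hB x
    obtain ⟨y, -, z, -, rfl, -⟩ := hBR x w hw
    refine ⟨y, ⟨_, hw, z, rfl⟩, ?_⟩
    rintro y' ⟨w', h1, z', rfl⟩
    exact (npair_inj.1 (hw' _ h1)).1
  obtain ⟨A, hA⟩ := exists_graph (fun x y => ∃ w, npair x w ∈ B.1 ∧ ∃ z, w = npair y z) hu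
  refine ⟨A, fun x => by simpa only [hA] using hu x, fun x y hxy => ?_⟩
  obtain ⟨w, hw, z, rfl⟩ := (hA x y).1 hxy
  obtain ⟨y', -, z', -, h1, h2⟩ := hBR x _ hw
  rw [(npair_inj.1 h1).1, hRQ']
  exact ⟨z', h2⟩

end SOA


namespace SOA

open Model

variable {M : Model.{u}} [IsRCA0 M]

omit [IsRCA0 M] in
theorem Sigma1.subst {P : (ℕ → M.N) → Prop} (hP : Sigma1 M P) {σ : ℕ → (ℕ → M.N) → M.N}
    (hσ : ∀ i, TermFn M (σ i)) : Sigma1 M fun v => P fun i => σ i v := by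
  obtain ⟨Q, hQ, h⟩ := hP
  exact ⟨fun v => Q fun i => push (v 0) (fun i => σ i fun j => v (j + 1)) i,
    hQ.subst (σ := fun i v => push (v 0) (fun i => σ i fun j => v (j + 1)) i) (by
      rintro (_ | i)
      exacts [.var _, TermFn.comp (f := σ i) (hf := hσ i) _]), fun v => h _⟩

omit [IsRCA0 M] in
theorem Sigma1.comp₂ {U : M.N → M.N → Prop} (hU : Sigma1 M fun v => U (v 0) (v 1))
    {f g : (ℕ → M.N) → M.N} (hf : TermFn M f) (hg : TermFn M g) :
    Sigma1 M fun v => U (f v) (g v) :=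
  hU.subst (σ := fun | 0 => f | _ => g) (by rintro (_ | i); exacts [hf, hg])

/-! ## Binary digits -/

/-- Saying that no number up to `f v` is the power stays bounded; naming the power would not. -/
instance {f g : (ℕ → M.N) → M.N} [TermFn M f] [TermFn M g] : Delta0 M fun v => f v < pw (g v) :=
  Delta0.of_iff (P := fun v => ¬ ∃ e, e ≤ f v ∧ pw (g v) = e) (by infer_instance) fun v => by
    rw [← not_le]
    exact not_congr ⟨fun h => ⟨_, h, rfl⟩, fun ⟨_, h, h'⟩ => h' ▸ h⟩

/-- Of the `k` binary digits of `w`, the one at place `i`, counted from the most significant one,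
is `1`. -/
def Dig (w k i : M.N) : Prop :=
  ∃ j, j ≤ k ∧ ∃ e, e ≤ w ∧ ∃ q, q ≤ w ∧ ∃ r, r < e ∧
    i + j + 1 = k ∧ pw j = e ∧ w = e * (2 * q + 1) + r

instance {f g h : (ℕ → M.N) → M.N} [TermFn M f] [TermFn M g] [TermFn M h] :
    Delta0 M fun v => Dig (f v) (g v) (h v) := by
  unfold Dig; infer_instance

/-- The bounds in `Dig` only serve to make it `Δ⁰₀`; they hold automatically. -/
theorem dig_iff {w k i : M.N} : Dig w k i ↔
    ∃ j q r, r < pw j ∧ i + j + 1 = k ∧ w = pw j * (2 * q + 1) + r := by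
  constructor
  · rintro ⟨j, -, e, -, q, -, r, hr, h, rfl, h'⟩
    exact ⟨j, q, r, hr, h, h'⟩
  · rintro ⟨j, q, r, hr, rfl, rfl⟩
    refine ⟨j, ?_, _, ?_, q, ?_, r, hr, rfl, rfl, rfl⟩
    · rw [add_right_comm]; exact le_add_self
    · exact (le_mul_of_one_le_right' (by exact le_add_self)).trans le_self_add
    · have h1 : (1 : M.N) ≤ pw j := by rw [← zero_add 1, add_one_le_iff]; exact pw_pos _
      calc q ≤ 2 * q + 1 := by rw [two_mul, add_assoc]; exact le_self_add
        _ ≤ pw j * (2 * q + 1) := le_mul_of_one_le_left' h1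
        _ ≤ _ := le_self_add

theorem two_mul_add_inj {a b c d : M.N} (hb : b ≤ 1) (hd : d ≤ 1) :
    2 * a + b = 2 * c + d ↔ a = c ∧ b = d := by
  have key : ∀ {a b c d : M.N}, b ≤ 1 → 2 * a + b = 2 * c + d → ¬ a < c := by
    intro a b c d hb h hac
    rw [← add_one_le_iff] at hac
    have h1 := toFrac_mono hb
    have h2 := toFrac_mono hac
    have h3 := congrArg toFrac h
    have h4 := toFrac_nonneg d
    simp only [map_add, map_mul, map_ofNat, map_one] at h1 h2 h3
    linarith
  refine ⟨fun h => ?_, by rintro ⟨rfl, rfl⟩; rfl⟩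
  obtain rfl := le_antisymm (not_lt.1 (key hd h.symm)) (not_lt.1 (key hb h))
  exact ⟨rfl, add_left_cancel h⟩

theorem exists_two_mul_add (w : M.N) : ∃ q b, b ≤ 1 ∧ w = 2 * q + b := by
  refine induction_sigma1 (P := fun w => ∃ q b : M.N, b ≤ 1 ∧ w = 2 * q + b)
    ⟨0, 0, zero_le' _, by ring⟩ ?_ w
  rintro w ⟨q, b, hb, rfl⟩
  rcases hb.lt_or_eq with hb | rfl
  · exact ⟨q, b + 1, add_one_le_iff.2 hb, by ring⟩
  · exact ⟨q + 1, 0, zero_le' _, by ring⟩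

theorem two_mul_add_lt {a b c : M.N} (hb : b ≤ 1) : 2 * a + b < c + c ↔ a < c := by
  constructor
  · intro h
    by_contra! h'
    refine h.not_ge ?_
    rw [two_mul]
    exact (add_le_add h' h').trans le_self_add
  · intro h
    calc 2 * a + b < 2 * a + 1 + 1 := by
          rw [lt_add_one_iff]; gcongr
      _ = (a + 1) + (a + 1) := by ring
      _ ≤ c + c := by
        rw [← add_one_le_iff] at h
        gcongr

theorem dig_last {w b k : M.N} (hb : b ≤ 1) : Dig (2 * w + b) (k + 1) k ↔ b = 1 := by
  rw [dig_iff]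
  constructor
  · rintro ⟨j, q, r, hr, hj, h⟩
    obtain rfl : j = 0 := by rw [add_assoc] at hj; grind
    rw [pw_zero] at hr h
    have hr : r = 0 := le_antisymm (lt_add_one_iff.1 (by rwa [zero_add])) (zero_le' _)
    rw [hr, one_mul, add_zero] at h
    exact ((two_mul_add_inj hb le_rfl).1 h).2
  · rintro rfl
    exact ⟨0, w, 0, by rw [pw_zero]; exact zero_lt_one, by ring, by rw [pw_zero]; ring⟩

/-- Appending a digit `b` turns `w` into `2 w + b`. Places are counted from the most significant
digit, so the old ones keep their indices. -/
theorem dig_init {w b k i : M.N} (hb : b ≤ 1) (hi : i < k) :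
    Dig (2 * w + b) (k + 1) i ↔ Dig w k i := by
  rw [dig_iff, dig_iff]
  constructor
  · rintro ⟨j, q, r, hr, hj, h⟩
    obtain ⟨j, rfl⟩ := (eq_zero_or_eq_add_one j).resolve_left (by
      rintro rfl; rw [add_zero] at hj; exact hi.ne (add_right_cancel hj))
    obtain ⟨r, b', hb', rfl⟩ := exists_two_mul_add r
    rw [pw_add_one, two_mul_add_lt hb'] at hr
    refine ⟨j, q, r, hr, by rw [← add_assoc] at hj; exact add_right_cancel hj, ?_⟩
    rw [pw_add_one] at h
    exact ((two_mul_add_inj (c := pw j * (2 * q + 1) + r) hb hb').1 (h.trans (by ring))).1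
  · rintro ⟨j, q, r, hr, rfl, rfl⟩
    exact ⟨j + 1, q, 2 * r + b, by rwa [pw_add_one, two_mul_add_lt hb], by ring,
      by rw [pw_add_one]; ring⟩

/-- The binary digits of `w < 2 ^ k` are the first `k` values of the characteristic function
of `P`. -/
def Matches (P : M.N → Prop) (k w : M.N) : Prop := w < pw k ∧ ∀ i, i < k → (P i ↔ Dig w k i)

instance {P : (ℕ → M.N) → M.N → Prop} {f g : (ℕ → M.N) → M.N} [TermFn M f] [TermFn M g]
    [hP : Delta0 M fun v => P (fun i => v (i + 1)) (v 0)] :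
    Delta0 M fun v => Matches (P v) (f v) (g v) := by
  have : Delta0 M fun v => ∀ i, i < f v → (P v i ↔ Dig (g v) (f v) i) :=
    Delta0.ball_lt (P := fun v i => P v i ↔ Dig (g v) (f v) i)
  unfold Matches; infer_instance

theorem matches_zero (P : M.N → Prop) : Matches P 0 0 :=
  ⟨pw_pos 0, fun i hi => (not_lt_zero_raw i hi).elim⟩

theorem matches_add_one_iff {P : M.N → Prop} {k w b : M.N} (hb : b ≤ 1) :
    Matches P (k + 1) (2 * w + b) ↔ Matches P k w ∧ (P k ↔ b = 1) := by
  unfold Matches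
  rw [pw_add_one, two_mul_add_lt hb, and_assoc]
  refine and_congr_right fun _ => ⟨fun h => ⟨fun i hi => ?_, ?_⟩, ?_⟩
  · rw [h i (lt_add_one_iff.2 hi.le), dig_init hb hi]
  · rw [h k (lt_add_one_iff.2 le_rfl), dig_last hb]
  · rintro ⟨h, h'⟩ i hi
    rcases (lt_add_one_iff.1 hi).lt_or_eq with hi | rfl
    · rw [h i hi, dig_init hb hi]
    · rw [h', dig_last hb]

theorem exists_matches (P : M.N → Prop) [hP : Delta0 M fun v => P (v 0)] (k : M.N) :
    ∃ w, Matches P k w := by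
  have : Delta0 M fun v => P (v 0) := hP
  have : Delta0 M fun v => Matches P (v 1) (v 0) := by
    have : Delta0 M fun v => (fun _ : ℕ → M.N => P) (fun i => v (i + 1)) (v 0) := hP
    infer_instance
  refine induction_sigma1 (P := fun k => ∃ w, Matches P k w) ⟨0, matches_zero P⟩ ?_ k
  rintro k ⟨w, hw⟩
  by_cases hk : P k
  · exact ⟨2 * w + 1, (matches_add_one_iff le_rfl).2 ⟨hw, iff_of_true hk rfl⟩⟩
  · exact ⟨2 * w + 0, (matches_add_one_iff (zero_le' _)).2 ⟨hw, iff_of_false hk zero_ne_one⟩⟩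

theorem Matches.congr {P Q : M.N → Prop} {k w : M.N} (h : Matches P k w)
    (hPQ : ∀ i, i < k → (P i ↔ Q i)) : Matches Q k w :=
  ⟨h.1, fun i hi => (hPQ i hi).symm.trans (h.2 i hi)⟩

/-- The quantifiers over `w` and `w'` make this a `Π⁰₁`-induction; its step strips off the last
digits. -/
theorem dig_ext (k : M.N) : ∀ w w' : M.N, w < pw k → w' < pw k →
    (∀ i, i < k → (Dig w k i ↔ Dig w' k i)) → w = w' := by
  refine induction_pi1 (P := fun k => ∀ w w' : M.N, w < pw k → w' < pw k →
    (∀ i, i < k → (Dig w k i ↔ Dig w' k i)) → w = w') (hP := ?_) ?_ ?_ k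
  · refine Sigma1.of_iff (P := fun v => ∃ w w', w < pw (v 0) ∧ w' < pw (v 0) ∧
      (∀ i, i < v 0 → (Dig w (v 0) i ↔ Dig w' (v 0) i)) ∧ w ≠ w') (by infer_instance) fun v => ?_
    push Not; rfl
  · intro w w' h h' _
    rw [pw_zero, ← zero_add 1, lt_add_one_iff] at h h'
    exact (le_antisymm h (zero_le' _)).trans (le_antisymm h' (zero_le' _)).symm
  · intro k ih w w' hw hw' h
    obtain ⟨w, b, hb, rfl⟩ := exists_two_mul_add w
    obtain ⟨w', b', hb', rfl⟩ := exists_two_mul_add w'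
    have h1 : Matches (Dig (2 * w + b) (k + 1)) (k + 1) (2 * w + b) := ⟨hw, fun _ _ => Iff.rfl⟩
    have h2 : Matches (Dig (2 * w + b) (k + 1)) (k + 1) (2 * w' + b') := ⟨hw', h⟩
    rw [matches_add_one_iff hb] at h1
    rw [matches_add_one_iff hb'] at h2
    obtain rfl := ih w w' h1.1.1 h2.1.1 fun i hi => (h1.1.2 i hi).symm.trans (h2.1.2 i hi)
    have h3 : b = 1 ↔ b' = 1 := h1.2.symm.trans h2.2
    have h4 : ∀ b : M.N, b ≤ 1 → b ≠ 1 → b = 0 := fun b hb hb' =>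
      le_antisymm (lt_add_one_iff.1 (by rw [zero_add]; exact lt_of_le_of_ne hb hb')) (zero_le' _)
    by_cases hb1 : b = 1
    · rw [hb1, h3.1 hb1]
    · rw [h4 b hb hb1, h4 b' hb' fun h => hb1 (h3.2 h)]

theorem Matches.unique {P : M.N → Prop} {k w w' : M.N} (h : Matches P k w)
    (h' : Matches P k w') : w = w' :=
  dig_ext k w w' h.1 h'.1 fun i hi => (h.2 i hi).symm.trans (h'.2 i hi)

/-! ## Compactness of Cantor space -/

/-- Weak Kőnig's lemma. -/
def WeakKonig (M : Model.{u}) [IsRCA0 M] : Prop :=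
  ∀ T : M.sets, IsTree T.1 → IsInfiniteTree T.1 → ∃ X : M.sets, IsPath T.1 X.1

/-- Failure of `U` passes from a string to its initial segments, by `Σ⁰₁`-induction on the number
`d` of digits removed. -/
theorem exists_truncation {U : M.N → M.N → Prop} [hU : Sigma1 M fun v => ¬ U (v 0) (v 1)]
    (hU' : ∀ k w b, b ≤ 1 → U k w → U (k + 1) (2 * w + b)) {k w : M.N} (hw : w < pw k)
    (hkw : ¬ U k w) (d : M.N) : d ≤ k → ∃ l w', l + d = k ∧ w' < pw l ∧ ¬ U l w' ∧
      ∀ i, i < l → (Dig w' l i ↔ Dig w k i) := by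
  have : ∀ i j, Sigma1 M fun v => ¬ U (v i) (v j) := fun i j =>
    Sigma1.comp₂ (U := fun k w => ¬ U k w) hU (.var i) (.var j)
  refine induction_sigma1 (P := fun d => d ≤ k → ∃ l w', l + d = k ∧ w' < pw l ∧ ¬ U l w' ∧
      ∀ i, i < l → (Dig w' l i ↔ Dig w k i)) (hP := ?_) ?_ ?_ d
  · infer_instance
  · exact fun _ => ⟨k, w, add_zero k, hw, hkw, fun _ _ => Iff.rfl⟩
  · intro d ih hd
    obtain ⟨l, w', hl, hw', hU1, h⟩ := ih (le_self_add.trans hd)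
    obtain ⟨l, rfl⟩ := (eq_zero_or_eq_add_one l).resolve_left (by
      rintro rfl
      rw [zero_add] at hl
      exact (add_one_le_iff.1 hd).ne hl)
    obtain ⟨w', b, hb, rfl⟩ := exists_two_mul_add w'
    rw [pw_add_one, two_mul_add_lt hb] at hw'
    refine ⟨l, w', by rw [← hl]; ring, hw', fun h => hU1 (hU' _ _ _ hb h), fun i hi => ?_⟩
    rw [← dig_init hb hi, h i (lt_add_one_iff.2 hi.le)]

/-- If every level contained a string outside `U`, these strings would form an infinite tree, and a
path through it would have no initial segment in `U`. That `U` is `Δ⁰₁` makes the tree a set. The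
translation between the triples of the tree and the numbers `w` is by `Matches`. -/
theorem WeakKonig.exists_uniform (hM : WeakKonig M) (U : M.N → M.N → Prop)
    [hU1 : Sigma1 M fun v => U (v 0) (v 1)] [hU2 : Sigma1 M fun v => ¬ U (v 0) (v 1)]
    (hU : ∀ k w b, b ≤ 1 → U k w → U (k + 1) (2 * w + b))
    (h : ∀ X : M.sets, ∃ k w, Matches (· ∈ X.1) k w ∧ U k w) : ∃ k, ∀ w, w < pw k → U k w := by
  by_contra! hc
  have i1 : ∀ i j, Sigma1 M fun v => ¬ U (v i) (v j) := fun i j =>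
    Sigma1.comp₂ (U := fun k w => ¬ U k w) hU2 (.var i) (.var j)
  have i2 : ∀ i j, Sigma1 M fun v => U (v i) (v j) := fun i j => hU1.comp₂ (.var i) (.var j)
  let P (t : M.N) : Prop := ∃ s : QCode M, ∃ w, s.code = t ∧ Matches (nbit s.b s.c) s.a w ∧ ¬ U s.a w
  have hP1 : Sigma1 M fun v => P (v 0) := by
    refine Sigma1.ex_triple (P := fun v s => ∃ w, s.code = v 0 ∧
      Matches (nbit s.b s.c) s.a w ∧ ¬ U s.a w) (hP := ?_)
    dsimp only
    infer_instance
  -- Each triple has exactly one matching number `w`. Hence "some matching `w` is outside `U`" is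
  -- negated by "some matching `w` is in `U`", which is again `Σ⁰₁`.
  have hmu : ∀ s : QCode M, ∃ w, Matches (nbit s.b s.c) s.a w := fun s => exists_matches _ _
  have hP2 : Sigma1 M fun v => ¬ P (v 0) := by
    have i3 : Delta0 M fun v => ∃ s : QCode M, s.code ≤ v 0 ∧ s.code = v 0 := by
      refine Delta0.bex_triple (x := fun v => v 0) (P := fun v s => s.code = v 0) (hP := ?_)
      infer_instance
    have i4 : Sigma1 M fun v => ∃ s : QCode M, ∃ w, s.code = v 0 ∧
        Matches (nbit s.b s.c) s.a w ∧ U s.a w := by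
      refine Sigma1.ex_triple (P := fun v s => ∃ w, s.code = v 0 ∧
        Matches (nbit s.b s.c) s.a w ∧ U s.a w) (hP := ?_)
      dsimp only
      infer_instance
    refine Sigma1.of_iff (P := fun v => (¬ ∃ s : QCode M, s.code ≤ v 0 ∧ s.code = v 0) ∨
      ∃ s : QCode M, ∃ w, s.code = v 0 ∧ Matches (nbit s.b s.c) s.a w ∧ U s.a w)
      (by infer_instance) fun v => ⟨fun hv => ?_, ?_⟩
    · by_cases hs : ∃ s : QCode M, s.code ≤ v 0 ∧ s.code = v 0
      · obtain ⟨s, -, hs⟩ := hs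
        obtain ⟨w, hw⟩ := hmu s
        exact .inr ⟨s, w, hs, hw, by_contra fun hUw => hv ⟨s, w, hs, hw, hUw⟩⟩
      · exact .inl hs
    · rintro (hv | ⟨s, w, hs, hw, hUw⟩) ⟨s', w', hs', hw', hUw'⟩
      · exact hv ⟨s', hs'.le, hs'⟩
      · obtain rfl := QCode.code_inj.1 (hs.trans hs'.symm)
        exact hUw' (hw.unique hw' ▸ hUw)
  obtain ⟨T, hT⟩ := exists_set_of_sigma1 P
  have hT' : ∀ s : QCode M, s.code ∈ T.1 ↔ ∃ w, Matches (nbit s.b s.c) s.a w ∧ ¬ U s.a w := by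
    intro s
    rw [hT]
    constructor
    · rintro ⟨s', w, hs, h⟩
      obtain rfl := QCode.code_inj.1 hs
      exact ⟨w, h⟩
    · rintro ⟨w, h⟩
      exact ⟨s, w, rfl, h⟩
  have h1 : IsTree T.1 := by
    intro s t hs hts hst
    obtain ⟨w, hw, hsw⟩ := (hT' s).1 hs
    obtain ⟨d, hd⟩ := exists_add_of_le hts
    obtain ⟨l, w', hl, hw', hUl, hwl⟩ := exists_truncation hU hw.1 hsw d (hd ▸ le_add_self)
    obtain rfl : l = t.a := add_right_cancel (hl.trans hd)
    exact (hT' t).2 ⟨w', ⟨hw', fun i hi => by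
      rw [hst i hi, hw.2 i (hi.trans_le hts), hwl i hi]⟩, hUl⟩
  have h2 : IsInfiniteTree T.1 := by
    intro k
    obtain ⟨w, hw, hkw⟩ := hc k
    obtain ⟨A, hA⟩ := exists_set fun i => Dig w k i
    obtain ⟨m, n, hmn⟩ := exists_finite_code A k
    exact ⟨⟨k, m, n⟩, rfl, (hT' _).2 ⟨w, ⟨hw, fun i hi => by rw [hmn i hi, hA]⟩, hkw⟩⟩
  obtain ⟨X, hX⟩ := hM T h1 h2
  obtain ⟨k, w, hw, hkw⟩ := h X
  obtain ⟨s, rfl, hs, hXs⟩ := hX k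
  obtain ⟨w', hw', hkw'⟩ := (hT' s).1 hs
  exact hkw' ((hw.congr hXs).unique hw' ▸ hkw)

end SOA


namespace SOA

open Model

variable {M : Model.{u}} [IsRCA0 M]

/-! ## Values of coded continuous functions -/

instance {f : (ℕ → M.N) → M.N} {P : (ℕ → M.N) → QCode M → Prop} [hf : TermFn M f]
    [hP : Sigma1 M fun v => P (fun i => v (i + 1)) (.recip (v 0))] :
    Sigma1 M fun v => P v (halfCode (f v)) :=
  Sigma1.of_iff (P := fun v => ∃ c, pw (f v) = c + 1 ∧ P v (.recip c)) (by infer_instance)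
    fun _ => halfCode_iff

/-- What is used of a space: at its points, membership in a basic ball is `Σ⁰₁`, and two basic
balls around a point contain a third one formally. -/
structure SSpace.IsRegular (S : SSpace M) : Prop where
  sigma1 (x : M.sets) : S.point x.1 → ∀ f g : (ℕ → M.N) → QCode M, TermQ f → TermQ g →
    Sigma1 M fun v => S.distLt x.1 (S.embed (f v)) (RatReal (g v))
  inter (x : M.sets) : S.point x.1 → ∀ a r a' r' : QCode M,
    S.distLt x.1 (S.embed a) (RatReal r) → S.distLt x.1 (S.embed a') (RatReal r') →
    ∃ a'' r'' : QCode M, S.base a'' ∧ QCode.zero.Lt r'' ∧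
      S.distLt (S.embed a'') (S.embed a) (RatReal (r.sub r'')) ∧
      S.distLt (S.embed a'') (S.embed a') (RatReal (r'.sub r''))

variable {S : SSpace M} {X x : M.sets}

/-- Both conditions are restricted to one smaller ball around a base point, where the consistency of
the code applies. -/
theorem IsContCode.abs_sub_le (hS : S.IsRegular) (hX : IsContCode S X.1) (hx : S.point x.1)
    {a r b s a' r' b' s' : QCode M} (h : Rel X.1 a r b s)
    (hn : S.distLt x.1 (S.embed a) (RatReal r)) (h' : Rel X.1 a' r' b' s')
    (hn' : S.distLt x.1 (S.embed a') (RatReal r')) : |b.val - b'.val| ≤ s.val + s'.val := by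
  obtain ⟨a'', r'', ha, hr, h1, h2⟩ := hS.inter x hx a r a' r' hn hn'
  have := hX.2.1 _ _ _ _ _ _ (hX.2.2.1 _ _ _ _ _ _ h ha hr h1)
    (hX.2.2.1 _ _ _ _ _ _ h' ha hr h2)
  simp only [QCode.le_iff, QCode.val_add] at this
  rw [_root_.abs_sub_le_iff]
  constructor <;> linarith

/-- At stage `k` a condition around `x` with `s < 2 ^ (-(k + 1))` is chosen and its centre `b`
recorded. Two such centres differ by at most the sum of their radii, which is the required rate `2 ^
(-k)`. The choice is possible because membership in basic balls is `Σ⁰₁`. -/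
theorem exists_value (hS : S.IsRegular) (hX : IsContCode S X.1) (hx : S.point x.1)
    (hd : InDom S X.1 x.1) : ∃ y : M.sets, Value S X.1 x.1 y.1 := by
  have hsig := hS.sigma1 x hx
  obtain ⟨A, hA, hAR⟩ := exists_choice_sigma1 (M := M) (fun k c => ∃ a r b s : QCode M,
    Rel X.1 a r b s ∧ S.distLt x.1 (S.embed a) (RatReal r) ∧ s.Lt (halfCode (k + 1)) ∧
      b.code = c) (hR := by
    refine Sigma1.ex_triple (P := fun v a => ∃ r b s : QCode M, Rel X.1 a r b s ∧
      S.distLt x.1 (S.embed a) (RatReal r) ∧ s.Lt (halfCode (v 0 + 1)) ∧ b.code = v 1)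
      (hP := Sigma1.ex_triple (P := fun v r => ∃ b s : QCode M, Rel X.1 ⟨v 2, v 1, v 0⟩ r b s ∧
      S.distLt x.1 (S.embed ⟨v 2, v 1, v 0⟩) (RatReal r) ∧ s.Lt (halfCode (v 3 + 1)) ∧
        b.code = v 4)
      (hP := Sigma1.ex_triple (P := fun v b => ∃ s : QCode M,
        Rel X.1 ⟨v 5, v 4, v 3⟩ ⟨v 2, v 1, v 0⟩ b s ∧
        S.distLt x.1 (S.embed ⟨v 5, v 4, v 3⟩) (RatReal ⟨v 2, v 1, v 0⟩) ∧
        s.Lt (halfCode (v 6 + 1)) ∧ b.code = v 7)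
      (hP := Sigma1.ex_triple (P := fun v s =>
        Rel X.1 ⟨v 8, v 7, v 6⟩ ⟨v 5, v 4, v 3⟩ ⟨v 2, v 1, v 0⟩ s ∧
        S.distLt x.1 (S.embed ⟨v 8, v 7, v 6⟩) (RatReal ⟨v 5, v 4, v 3⟩) ∧
        s.Lt (halfCode (v 9 + 1)) ∧ (⟨v 2, v 1, v 0⟩ : QCode M).code = v 10) (hP := ?_))))
    dsimp only
    have := hsig (fun v => ⟨v 11, v 10, v 9⟩) (fun v => ⟨v 8, v 7, v 6⟩)
      (by infer_instance) (by infer_instance)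
    have i1 : Sigma1 M fun v => QCode.Lt ⟨v 2, v 1, v 0⟩ (halfCode (v 12 + 1)) := by
      infer_instance
    infer_instance) fun k => by
    obtain ⟨a, r, b, s, h⟩ := hd (halfCode (k + 1)) (by simpa [QCode.lt_iff] using hp_pos _)
    exact ⟨_, a, r, b, s, h.1, h.2.1, h.2.2, rfl⟩
  have hq : ∀ k, ∃ b : QCode M, Term A.1 k b ∧ ∃ a r s, Rel X.1 a r b s ∧
      S.distLt x.1 (S.embed a) (RatReal r) ∧ s.val < hp (k + 1) := by
    intro k
    obtain ⟨c, hc, -⟩ := hA k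
    obtain ⟨a, r, b, s, h, h', hs, rfl⟩ := hAR k c hc
    exact ⟨b, hc, a, r, s, h, h', by rwa [QCode.lt_iff, val_halfCode] at hs⟩
  -- This choice is made outside the model. It only enters the estimates; the value itself is the
  -- set `A`.
  choose q hq a r s h hn hs using hq
  have hseq : IsSeq A.1 q := fun k p =>
    ⟨fun hp => QCode.code_inj.1 ((hA k).unique hp (hq k)), by rintro rfl; exact hq k⟩
  have hhp : ∀ k : M.N, 0 < hp k := hp_pos
  refine ⟨A, hd, isReal_iff.2 ⟨q, hseq, fun k i => ?_⟩, fun a' r' b' s' h' hn' => ?_⟩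
  · have h1 := hX.abs_sub_le hS hx (h k) (hn k) (h (k + i)) (hn (k + i))
    have h2 := hs k
    have h3 := hs (k + i)
    have h4 := hp_anti (show k + 1 ≤ k + i + 1 by gcongr; exact le_self_add)
    rw [hp_add_one k] at h2 h4
    linarith
  · have key : ∀ k, |(q k).val - b'.val| ≤ s'.val + hp k := fun k => by
      have h1 := hX.abs_sub_le hS hx (h k) (hn k) h' hn'
      have h2 := hs k
      have h3 := hhp k
      rw [hp_add_one k] at h2
      linarith
    rw [hseq.realLe_iff (isSeq_ratReal _),
      (isSeq_ratReal _).realLe_iff (hseq.realAdd (isSeq_ratReal _))]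
    simp only [QCode.val_add]
    refine ⟨fun k => ?_, fun k => ?_⟩
    · have := (abs_le.1 (key k)).2
      have := hhp k
      linarith
    · have h1 := (abs_le.1 (key (k + 1))).1
      have := hhp k
      rw [hp_add_one k] at h1
      linarith

/-- From `b ≤ y + s`. Since `RealAdd` reads one stage further, stage `k + 1` is used and speaks of
`q (k + 2)`: returning to `q k` costs `hp k`, and `2 * hp (k + 1)` is another `hp k`, together the
tolerance of `RealLe`. -/
theorem Value.le {y : Set M.N} (hy : Value S X.1 x.1 y) {a r b s c : QCode M}
    (h : Rel X.1 a r b s) (hn : S.distLt x.1 (S.embed a) (RatReal r))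
    (hc : c.val ≤ b.val - s.val) : RealLe (RatReal c) y := by
  obtain ⟨q, hq, hr⟩ := isReal_iff.1 hy.2.1
  have h1 := (hy.2.2 _ _ _ _ h hn).2
  rw [(isSeq_ratReal _).realLe_iff (hq.realAdd (isSeq_ratReal _))] at h1
  rw [(isSeq_ratReal _).realLe_iff hq]
  intro k
  have h2 := h1 (k + 1)
  have h3 := (abs_le.1 (hr.sub_le (show k ≤ k + 1 + 1 by
    rw [add_assoc]; exact le_self_add))).1
  have h4 := hp_add_one k
  simp only [QCode.val_add] at h2
  linarith

/-- Positivity of the value is witnessed by `2 * hp k < q k`, so the value is at least `q k - hp k >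
hp k`. A condition with `s < hp k / 2` gives `b + s > hp k > 2 s`, hence `s < b`. -/
theorem IsGauge.exists_rel (hS : S.IsRegular) (hX : IsGauge S X.1) (hx : S.point x.1) :
    ∃ a r b s, Rel X.1 a r b s ∧ S.distLt x.1 (S.embed a) (RatReal r) ∧ s.val < b.val := by
  obtain ⟨hd, hpos⟩ := hX.2 x hx
  obtain ⟨y, hy⟩ := exists_value hS hX.1 hx hd
  obtain ⟨q, hq, hr⟩ := isReal_iff.1 hy.2.1
  have h1 := hpos y hy
  rw [RealZero, (isSeq_ratReal _).realLt_iff hq, QCode.val_zero] at h1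
  obtain ⟨k, hk⟩ := h1
  obtain ⟨a, r, b, s, h, hn, hs⟩ := hd (halfCode (k + 1)) (by
    simpa [QCode.lt_iff] using hp_pos _)
  rw [QCode.lt_iff, val_halfCode, hp_add_one] at hs
  have h2 := (hy.2.2 _ _ _ _ h hn).1
  rw [hq.realLe_iff (isSeq_ratReal _), QCode.val_add] at h2
  have h3 : (q k).val - hp k ≤ b.val + s.val := by
    refine le_of_forall_hp (c := 3) fun m => ?_
    have h4 := (abs_le.1 (hr.sub_le (le_max_left k m))).2
    have h5 := h2 (max k m)
    have h6 := hp_anti (le_max_right k m)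
    have := hp_pos m
    linarith
  refine ⟨a, r, b, s, h, hn, ?_⟩
  linarith

/-- The slices of a set are sets. -/
theorem exists_eq_nslice (A : M.sets) (i : M.N) : ∃ B : M.sets, B.1 = nslice A.1 i := by
  obtain ⟨B, hB⟩ := exists_set fun t => npair i t ∈ A.1
  exact ⟨B, Set.ext hB⟩

end SOA


/-! ### Bounds on codes, and the unit interval as a regular space -/

namespace SOA

open Model

variable {M : Model.{u}} [IsRCA0 M]

theorem QCode.c_le_code (q : QCode M) : q.c ≤ q.code := right_le_npair _ _

theorem codes_le_relCode (n : M.N) (a r b s : QCode M) : n ≤ relCode n a r b s ∧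
    a.code ≤ relCode n a r b s ∧ r.code ≤ relCode n a r b s ∧ b.code ≤ relCode n a r b s ∧
    s.code ≤ relCode n a r b s := by
  have h1 : npair (npair (npair n a.code) r.code) b.code ≤ relCode n a r b s := left_le_npair _ _
  have h2 := (left_le_npair (npair (npair n a.code) r.code) b.code).trans h1
  have h3 := (left_le_npair (npair n a.code) r.code).trans h2
  exact ⟨(left_le_npair _ _).trans h3, (right_le_npair _ _).trans h3,
    (right_le_npair _ _).trans h2, (right_le_npair _ _).trans h1, right_le_npair _ _⟩

/-- Distinct rational numbers with bounded denominators are not too close. -/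
theorem QCode.le_sub_of_lt {p q : QCode M} (h : p.Lt q) {K : M.N} (hp : p.c < K) (hq : q.c < K) :
    1 / toFrac (K * K) ≤ q.val - p.val := by
  have h1 := toFrac_mono (add_one_le_iff.2 h)
  have h2 := toFrac_mono (add_one_le_iff.2 hp)
  have h3 := toFrac_mono (add_one_le_iff.2 hq)
  simp only [map_add, map_mul, map_one] at h1 h2 h3
  have hp := den_pos p.c
  have hq := den_pos q.c
  have hK := toFrac_nonneg K
  calc 1 / toFrac (K * K) ≤ 1 / ((toFrac p.c + 1) * (toFrac q.c + 1)) := by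
        rw [map_mul]
        exact one_div_le_one_div_of_le (mul_pos hp hq) (by gcongr)
    _ ≤ q.val - p.val := by
        rw [val, val, div_sub_div _ _ hq.ne' hp.ne', mul_comm (toFrac p.c + 1)]
        gcongr
        linarith

/-- A sequence of rational numbers, as a sequence of real numbers. -/
theorem exists_nslice_eq_ratReal (f : M.N → QCode M) [hf : TermQ fun v => f (v 0)] :
    ∃ A : M.sets, ∀ i, nslice A.1 i = RatReal (f i) := by
  have : ∀ j, TermQ fun v => f (v j) := fun j => TermQ.comp (f := fun v => f (v 0)) fun _ => j
  obtain ⟨A, hA⟩ := exists_set (M := M) fun z => ∃ i, i ≤ z ∧ ∃ t, t ≤ z ∧ ∃ k, k ≤ t ∧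
    z = npair i t ∧ t = npair k (f i).code
  refine ⟨A, fun i => Set.ext fun t => ?_⟩
  change npair i t ∈ A.1 ↔ ∃ k, t = npair k (f i).code
  rw [hA]
  constructor
  · rintro ⟨i', -, t', -, k, -, h, h'⟩
    obtain ⟨rfl, rfl⟩ := npair_inj.1 h
    exact ⟨k, h'⟩
  · rintro ⟨k, h⟩
    exact ⟨i, left_le_npair _ _, t, right_le_npair _ _, k, h ▸ left_le_npair _ _, rfl, h⟩

theorem exists_eq_ratReal (a : QCode M) : ∃ A : M.sets, A.1 = RatReal a := by
  obtain ⟨A, hA⟩ := exists_nslice_eq_ratReal fun _ => a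
  obtain ⟨B, hB⟩ := exists_eq_nslice A 0
  exact ⟨B, hB.trans (hA 0)⟩

/-! ## The unit interval -/

section Interval

theorem interval_distLt_iff {X : Set M.N} {q : M.N → QCode M} (hX : IsSeq X q) {a r : QCode M} :
    (Interval M).distLt X (RatReal a) (RatReal r) ↔
      (∃ k, (q k).val + 2 * hp k < a.val + r.val) ∧
      ∃ k, a.val + 2 * hp k < (q (k + 1)).val + r.val := by
  change RealLt _ _ ∧ RealLt _ _ ↔ _
  rw [hX.realLt_iff ((isSeq_ratReal a).realAdd (isSeq_ratReal r)),
    (isSeq_ratReal a).realLt_iff (hX.realAdd (isSeq_ratReal r))]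
  simp only [QCode.val_add]

theorem interval_distLt_rat_iff {p a r : QCode M} :
    (Interval M).distLt (RatReal p) (RatReal a) (RatReal r) ↔ |p.val - a.val| < r.val := by
  have key : ∀ x y : M.K, (∃ k : M.N, x + 2 * hp k < y) ↔ x < y := fun x y => by
    constructor
    · rintro ⟨k, hk⟩
      have := hp_pos k
      linarith
    · intro h
      obtain ⟨k, hk⟩ := exists_hp_lt (show 0 < (y - x) / 2 by linarith)
      exact ⟨k, by linarith⟩
  rw [interval_distLt_iff (isSeq_ratReal p), key, key, abs_lt]
  constructor <;> rintro ⟨h1, h2⟩ <;> constructor <;> linarith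

/-- Of the slack `3 * hp j`, two parts pay for the strict inequality of reals and one for moving to
stage `j + 1`, which `RealAdd` reads. -/
theorem interval_distLt_of {X : Set M.N} {q : M.N → QCode M} (hX : IsSeq X q)
    (hr : IsRapid fun k => (q k).val) {a r : QCode M} (j : M.N)
    (h : |(q j).val - a.val| + 3 * hp j < r.val) :
    (Interval M).distLt X (RatReal a) (RatReal r) := by
  have h1 := abs_le.1 (hr j 1)
  have h2 := hp_pos j
  have h3 := le_abs_self ((q j).val - a.val)
  have h4 := neg_abs_le ((q j).val - a.val)
  exact (interval_distLt_iff hX).2 ⟨⟨j, by linarith⟩, j, by linarith [h1.1, h1.2]⟩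

/-- Strict inequality at a single stage leaves room to spare at all later ones. -/
theorem exists_of_interval_distLt {X : Set M.N} {q : M.N → QCode M} (hX : IsSeq X q)
    (hr : IsRapid fun k => (q k).val) {a r : QCode M}
    (h : (Interval M).distLt X (RatReal a) (RatReal r)) :
    ∃ m, ∀ j, m ≤ j → |(q j).val - a.val| < r.val - hp m := by
  obtain ⟨⟨k, hk⟩, l, hl⟩ := (interval_distLt_iff hX).1 h
  refine ⟨max k (l + 1), fun j hj => ?_⟩
  have h1 := (abs_le.1 (hr.sub_le ((le_max_left _ _).trans hj))).1
  have h2 := (abs_le.1 (hr.sub_le ((le_max_right _ _).trans hj))).2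
  have h3 := hp_anti (le_max_left k (l + 1))
  have h4 := hp_anti (le_max_right k (l + 1))
  have h5 := hp_pos l
  rw [hp_add_one] at h2 h4
  rw [abs_lt]
  constructor <;> linarith

/-- The stages of a point may leave `[0, 1]` by up to `2 * hp k`; they are clamped to it. -/
theorem exists_val_near {X : Set M.N} {q : M.N → QCode M} (hX : IsSeq X q)
    (h : (Interval M).point X) (k : M.N) :
    ∃ p : QCode M, 0 ≤ p.val ∧ p.val ≤ 1 ∧ |p.val - (q k).val| ≤ 2 * hp k := by
  have h1 := ((isSeq_ratReal _).realLe_iff hX).1 h.2.1 k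
  have h2 := (hX.realLe_iff (isSeq_ratReal _)).1 h.2.2 k
  rw [QCode.val_zero] at h1
  rw [QCode.val_one] at h2
  have h3 := hp_pos k
  rcases le_total (q k).val 0 with h0 | h0
  · exact ⟨.zero, by simp, by simp, by rw [QCode.val_zero, abs_le]; constructor <;> linarith⟩
  rcases le_total (q k).val 1 with h0' | h0'
  · exact ⟨q k, h0, h0', by rw [sub_self, abs_zero]; linarith⟩
  · exact ⟨.one, by simp, by simp, by rw [QCode.val_one, abs_le]; constructor <;> linarith⟩

theorem interval_base_iff {a : QCode M} : (Interval M).base a ↔ 0 ≤ a.val ∧ a.val ≤ 1 := by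
  change QCode.Le _ _ ∧ QCode.Le _ _ ↔ _
  rw [QCode.le_iff, QCode.le_iff, QCode.val_zero, QCode.val_one]

theorem interval_isRegular : (Interval M).IsRegular where
  sigma1 x hx f g hf hg := by
    obtain ⟨q, hq, -⟩ := isReal_iff.1 hx.1
    have : Sigma1 M fun v => (∃ k c, pw k = c + 1 ∧ ∃ p : QCode M, Term x.1 k p ∧
        (p.add ((QCode.recip c).add (.recip c))).Lt ((f v).add (g v))) ∧
        ∃ k c, pw k = c + 1 ∧ ∃ p : QCode M, Term x.1 (k + 1) p ∧
        ((f v).add ((QCode.recip c).add (.recip c))).Lt (p.add (g v)) := by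
      infer_instance
    refine this.of_iff fun v => ?_
    change (Interval M).distLt _ (RatReal _) _ ↔ _
    rw [interval_distLt_iff hq]
    have key : ∀ {Q : M.N → QCode M → Prop}, (∃ k c, pw k = c + 1 ∧ Q k (.recip c)) ↔
        ∃ k, Q k (halfCode k) := fun {Q} => exists_congr fun k => halfCode_iff.symm
    rw [key (Q := fun k ε => ∃ p : QCode M, Term x.1 k p ∧
      (p.add (ε.add ε)).Lt ((f v).add (g v))), key (Q := fun k ε => ∃ p : QCode M,
      Term x.1 (k + 1) p ∧ ((f v).add (ε.add ε)).Lt (p.add (g v)))]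
    simp only [hq _ _, exists_eq_left, QCode.lt_iff, QCode.val_add, val_halfCode, two_mul]
  inter x hx a r a' r' h h' := by
    obtain ⟨q, hq, hr⟩ := isReal_iff.1 hx.1
    obtain ⟨m, hm⟩ := exists_of_interval_distLt hq hr h
    obtain ⟨m', hm'⟩ := exists_of_interval_distLt hq hr h'
    let l := max m m'
    have h1 := hp_anti (le_max_left m m')
    have h2 := hp_anti (le_max_right m m')
    have hl : l ≤ l + 1 + 1 + 1 := by rw [add_assoc, add_assoc]; exact le_self_add
    obtain ⟨p, hp0, hp1, hpq⟩ := exists_val_near hq hx (l + 1 + 1 + 1)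
    have h3 := hm _ ((le_max_left _ _).trans hl)
    have h4 := hm' _ ((le_max_right _ _).trans hl)
    have h5 := hp_pos l
    rw [hp_add_one, hp_add_one, hp_add_one] at hpq
    rw [abs_lt] at h3 h4
    rw [abs_le] at hpq
    -- Stage `l + 3` puts `p` within `hp l / 4` of a rational that has distance less than `r - hp l`
    -- from `a`; this leaves room for the radius `hp l / 2`. The same holds for the second ball.
    refine ⟨p, halfCode (l + 1), interval_base_iff.2 ⟨hp0, hp1⟩, ?_, ?_, ?_⟩
    · simpa [QCode.lt_iff] using hp_pos _
    · refine interval_distLt_rat_iff.2 ?_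
      rw [QCode.val_sub, val_halfCode, hp_add_one, abs_lt]
      constructor <;> linarith [h3.1, h3.2, hpq.1, hpq.2]
    · refine interval_distLt_rat_iff.2 ?_
      rw [QCode.val_sub, val_halfCode, hp_add_one, abs_lt]
      constructor <;> linarith [h4.1, h4.2, hpq.1, hpq.2]

end Interval

end SOA


/-! ### Dyadic intervals, and Cousin's lemma on the unit interval -/

namespace SOA

open Model

variable {M : Model.{u}} [IsRCA0 M]

/-- `i / (d + 1)`. -/
def QCode.frac (i d : M.N) : QCode M := ⟨i, 0, d⟩

instance {f g : (ℕ → M.N) → M.N} [TermFn M f] [TermFn M g] :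
    TermQ fun v => QCode.frac (f v) (g v) := by
  unfold QCode.frac; infer_instance

@[simp] theorem QCode.val_frac (i d : M.N) :
    (QCode.frac i d).val = toFrac i * (1 / (toFrac d + 1)) := by
  simp [QCode.val, QCode.frac, div_eq_mul_inv]

theorem val_frac_of_pw {k e : M.N} (h : pw k = e + 1) (w : M.N) :
    (QCode.frac w e).val = toFrac w * hp k := by
  rw [QCode.val_frac, hp, h, map_add, map_one]

/-- The least `i` with `p ≤ (i + 1) / (d + 1)` replaces the integer part and never exceeds `d`, so
`p = 1` falls into the last cell. -/
theorem exists_frac_le (p : QCode M) (h0 : 0 ≤ p.val) (h1 : p.val ≤ 1) (d : M.N) :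
    ∃ i, i ≤ d ∧ (QCode.frac i d).val ≤ p.val ∧ p.val ≤ (QCode.frac (i + 1) d).val := by
  have hd := QCode.den_pos d
  obtain ⟨i, hi, hi'⟩ := exists_least (M := M) (P := fun i => p.Le (.frac (i + 1) d)) ⟨d, by
    rw [QCode.le_iff, QCode.val_frac, map_add, map_one, mul_one_div_cancel hd.ne']
    exact h1⟩
  rw [QCode.le_iff] at hi
  refine ⟨i, ?_, ?_, hi⟩
  · by_contra! hdi
    refine hi' d hdi ?_
    rw [QCode.le_iff, QCode.val_frac, map_add, map_one, mul_one_div_cancel hd.ne']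
    exact h1
  · rcases eq_zero_or_eq_add_one i with rfl | ⟨i, rfl⟩
    · rw [QCode.val_frac, map_zero, zero_mul]; exact h0
    · have := hi' i (lt_add_one_iff.2 le_rfl)
      rw [QCode.le_iff, not_le] at this
      exact this.le

/-- The binary expansion given by a set converges to a point of the unit interval. -/
theorem exists_binary_expansion (X : M.sets) : ∃ (x : M.sets) (q : M.N → QCode M),
    (Interval M).point x.1 ∧ IsSeq x.1 q ∧ (IsRapid fun k => (q k).val) ∧
      ∀ k, ∃ w, Matches (· ∈ X.1) k w ∧ (q k).val = toFrac w * hp k := by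
  obtain ⟨x, hx⟩ := exists_graph (M := M) (fun k y => ∃ w e, pw k = e + 1 ∧
      Matches (· ∈ X.1) k w ∧ y = (QCode.frac w e).code) fun k => by
    obtain ⟨w, hw⟩ := exists_matches (· ∈ X.1) k
    obtain ⟨e, he⟩ := exists_pw_eq k
    refine ⟨_, ⟨w, e, he, hw, rfl⟩, ?_⟩
    rintro y ⟨w', e', he', hw', rfl⟩
    rw [hw.unique hw', add_right_cancel (he.symm.trans he')]
  choose w hw using fun k => exists_matches (· ∈ X.1) k
  choose e he using exists_pw_eq (M := M)
  have hseq : IsSeq x.1 fun k => QCode.frac (w k) (e k) := fun k p => by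
    rw [Term, hx]
    constructor
    · rintro ⟨w', e', he', hw', h⟩
      obtain rfl := hw'.unique (hw k)
      obtain rfl := add_right_cancel (he'.symm.trans (he k))
      exact QCode.code_inj.1 h
    · rintro rfl
      exact ⟨_, _, he k, hw k, rfl⟩
  have hval : ∀ k, (QCode.frac (w k) (e k)).val = toFrac (w k) * hp k := fun k =>
    val_frac_of_pw (he k) _
  -- The dyadic interval at stage `k + i` lies inside the one at stage `k`. The variable `e` names
  -- `2 ^ i` to keep the statement `Σ⁰₁`.
  have hnest : ∀ k i, ∃ w' e, Matches (· ∈ X.1) (k + i) w' ∧ pw i = e ∧ w k * e ≤ w' ∧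
      w' + 1 ≤ (w k + 1) * e := by
    intro k
    refine induction_sigma1 (P := fun i => ∃ w' e, Matches (· ∈ X.1) (k + i) w' ∧ pw i = e ∧
      w k * e ≤ w' ∧ w' + 1 ≤ (w k + 1) * e) (hP := ?_) ?_ ?_
    · infer_instance
    · exact ⟨w k, 1, by rw [add_zero]; exact hw k, pw_zero, by rw [mul_one], by rw [mul_one]⟩
    · rintro i ⟨w', _, hw', rfl, h1, h2⟩
      obtain ⟨w'', hw''⟩ := exists_matches (· ∈ X.1) (k + i + 1)
      obtain ⟨w'', b, hb, rfl⟩ := exists_two_mul_add w''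
      obtain rfl := ((matches_add_one_iff hb).1 hw'').1.unique hw'
      refine ⟨_, _, by rw [← add_assoc]; exact hw'', rfl, ?_, ?_⟩
      · rw [pw_add_one, mul_add, two_mul, add_assoc]
        exact add_le_add h1 (h1.trans le_self_add)
      · rw [pw_add_one, mul_add]
        calc 2 * w'' + b + 1 ≤ 2 * w'' + 1 + 1 := by gcongr
          _ = w'' + 1 + (w'' + 1) := by ring
          _ ≤ _ := add_le_add h2 h2
  have hhp : ∀ k : M.N, 0 < hp k := hp_pos
  have hrap : IsRapid fun k => (QCode.frac (w k) (e k)).val := by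
    intro k i
    obtain ⟨w', _, hw', rfl, h1, h2⟩ := hnest k i
    obtain rfl := hw'.unique (hw (k + i))
    have h3 := toFrac_mono h1
    have h4 := toFrac_mono h2
    simp only [map_add, map_mul, map_one] at h3 h4
    have h5 : hp k = toFrac (pw i) * hp (k + i) := by
      rw [hp, hp, pw_add, map_mul]
      have := (toFrac_pos (pw_pos k)).ne'
      have := (toFrac_pos (pw_pos i)).ne'
      field_simp
    have h6 := hhp (k + i)
    simp only [hval]
    rw [h5, abs_le]
    constructor <;> nlinarith
  have hle : ∀ k, toFrac (w k) * hp k ≤ 1 := fun k => by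
    rw [hp, mul_one_div, div_le_one (toFrac_pos (pw_pos k))]
    exact toFrac_mono (hw k).1.le
  refine ⟨x, _, ⟨isReal_iff.2 ⟨_, hseq, hrap⟩, ?_, ?_⟩, hseq, hrap, fun k => ⟨_, hw k, hval k⟩⟩
  · rw [RealZero, (isSeq_ratReal _).realLe_iff hseq]
    intro k
    rw [hval, QCode.val_zero]
    have := mul_nonneg (toFrac_nonneg (w k)) (hhp k).le
    have := hhp k
    linarith
  · rw [RealOne, hseq.realLe_iff (isSeq_ratReal _)]
    intro k
    rw [hval, QCode.val_one]
    have := hle k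
    have := hhp k
    linarith

theorem interval_point_ratReal {p : QCode M} (h0 : 0 ≤ p.val) (h1 : p.val ≤ 1) :
    (Interval M).point (RatReal p) := by
  refine ⟨isReal_ratReal p, ?_, ?_⟩
  · rw [RealZero, realLe_ratReal_iff, QCode.val_zero]; exact h0
  · rw [RealOne, realLe_ratReal_iff, QCode.val_one]; exact h1

/-- `t` codes the information that a function has positive values, bounded from below, on a ball
containing the interval from `w / (c + 1)` to `(w + 1) / (c + 1)`. -/
def IntervalBound (t w c : M.N) : Prop :=
  ∃ n, n ≤ t ∧ ∃ a : QCode M, a.code ≤ t ∧ ∃ r : QCode M, r.code ≤ t ∧ ∃ b : QCode M, b.code ≤ t ∧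
    ∃ s : QCode M, s.code ≤ t ∧ t = relCode n a r b s ∧ s.Lt b ∧
      (QCode.frac (w + 1) c).Lt (a.add r) ∧ a.Lt ((QCode.frac w c).add r)

instance {f g h : (ℕ → M.N) → M.N} [TermFn M f] [TermFn M g] [TermFn M h] :
    Delta0 M fun v => IntervalBound (f v) (g v) (h v) := by
  unfold IntervalBound; infer_instance

/-- A gauge on the unit interval is bounded away from `0`. -/
theorem exists_interval_bound (hM : WeakKonig M) {Φ : M.sets} (hΦ : IsGauge (Interval M) Φ.1) :
    ∃ e : M.N, ∀ p : QCode M, 0 ≤ p.val → p.val ≤ 1 → ∃ y : M.sets,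
      Value (Interval M) Φ.1 (RatReal p) y.1 ∧
      ∀ c : QCode M, c.val ≤ 1 / (toFrac e + 1) → RealLe (RatReal c) y.1 := by
  have hhp : ∀ k : M.N, 0 < hp k := hp_pos
  -- The string `w` of length `k` is secured. The bound `t < k` makes the search for a condition
  -- finite, and `c` is determined by `k`, so the complement is `Σ⁰₁` as well.
  let U (k w : M.N) : Prop := ∃ c, pw k = c + 1 ∧ ∃ t, t < k ∧ t ∈ Φ.1 ∧ IntervalBound t w c
  have i1 : Sigma1 M fun v => U (v 0) (v 1) := by
    dsimp only [U]
    infer_instance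
  have i2 : Sigma1 M fun v => ¬ U (v 0) (v 1) := by
    refine Sigma1.of_iff (P := fun v => ∃ c, pw (v 0) = c + 1 ∧ ¬ ∃ t, t < v 0 ∧ t ∈ Φ.1 ∧
      IntervalBound t (v 1) c) (by infer_instance) fun v => ?_
    obtain ⟨c, hc⟩ := exists_pw_eq (v 0)
    constructor
    · exact fun h => ⟨c, hc, fun h' => h ⟨c, hc, h'⟩⟩
    · rintro ⟨c, hc, h⟩ ⟨c', hc', h'⟩
      obtain rfl := add_right_cancel (hc.symm.trans hc')
      exact h h'
  have hU1 : ∀ k w b, b ≤ 1 → U k w → U (k + 1) (2 * w + b) := by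
    intro k w b hb
    rintro ⟨c, hc, t, htk, ht, n, hn, a, ha, r, hr, b', hb', s, hs, rfl, hsb, h1, h2⟩
    obtain ⟨c', hc'⟩ := exists_pw_eq (k + 1)
    refine ⟨c', hc', _, htk.trans_le le_self_add, ht, n, hn, a, ha, r, hr, b', hb', s, hs, rfl,
      hsb, ?_, ?_⟩
    all_goals
      rw [QCode.lt_iff, QCode.val_add, val_frac_of_pw hc] at *
    all_goals
      rw [val_frac_of_pw hc', hp_add_one]
      have h3 := toFrac_mono hb
      have h4 := toFrac_nonneg b
      have h5 := hhp k
      simp only [map_add, map_mul, map_one, map_ofNat] at *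
      nlinarith
  have hU2 : ∀ X : M.sets, ∃ k w, Matches (· ∈ X.1) k w ∧ U k w := by
    intro X
    obtain ⟨x, q, hx, hq, hr, hxX⟩ := exists_binary_expansion X
    obtain ⟨a, r, b, s, ⟨n, hn⟩, hnear, hsb⟩ := hΦ.exists_rel interval_isRegular hx
    obtain ⟨m, hm⟩ := exists_of_interval_distLt hq hr hnear
    -- The length `m` fits the dyadic interval into the ball; the other length admits the code of
    -- the condition.
    let k := max m (relCode n a r b s + 1)
    obtain ⟨w, hw, hqw⟩ := hxX k
    obtain ⟨c, hc⟩ := exists_pw_eq k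
    have h1 := abs_lt.1 (hm k (le_max_left _ _))
    have h2 := hp_anti (le_max_left m (relCode n a r b s + 1))
    have h3 := hhp m
    have hcode := codes_le_relCode n a r b s
    refine ⟨k, w, hw, c, hc, _, add_one_le_iff.1 (le_max_right _ _), hn, n, hcode.1, a, hcode.2.1,
      r, hcode.2.2.1, b, hcode.2.2.2.1, s, hcode.2.2.2.2, rfl, QCode.lt_iff.2 hsb, ?_, ?_⟩
    · rw [QCode.lt_iff, QCode.val_add, val_frac_of_pw hc, map_add, map_one, add_mul, one_mul, ← hqw]
      change hp k ≤ _ at h2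
      linarith
    · rw [QCode.lt_iff, QCode.val_add, val_frac_of_pw hc, ← hqw]
      linarith
  obtain ⟨K, hK⟩ := hM.exists_uniform U hU1 hU2
  obtain ⟨c, hc⟩ := exists_pw_eq K
  have hK0 : K ≠ 0 := by
    rintro rfl
    obtain ⟨_, _, t, ht, _⟩ := hK 0 (pw_pos 0)
    exact not_lt_zero_raw _ ht
  -- The bound will be `1 / (e + 1) = 1 / K²`.
  obtain ⟨e, he⟩ := (eq_zero_or_eq_add_one (K * K)).resolve_left (mul_ne_zero hK0 hK0)
  refine ⟨e, fun p h0 h1 => ?_⟩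
  obtain ⟨x, hx⟩ := exists_eq_ratReal p
  have hpt : (Interval M).point x.1 := hx ▸ interval_point_ratReal h0 h1
  obtain ⟨y, hy⟩ := exists_value interval_isRegular hΦ.1 hpt (hΦ.2 x hpt).1
  -- The closed dyadic interval around `p` lies in the ball of the condition that secures its
  -- string, end points included, so `p` does too.
  obtain ⟨w, hwc, hw1, hw2⟩ := exists_frac_le p h0 h1 c
  obtain ⟨c', hc', t, htK, ht, n, -, a, -, r, -, b, hb, s, hs, rfl, hsb, h2, h3⟩ :=
    hK w (by rw [hc]; exact lt_add_one_iff.2 hwc)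
  obtain rfl := add_right_cancel (hc.symm.trans hc')
  refine ⟨y, hx ▸ hy, fun d hd => ?_⟩
  have h4 := QCode.le_sub_of_lt hsb ((s.c_le_code.trans hs).trans_lt htK)
    ((b.c_le_code.trans hb).trans_lt htK)
  rw [he, map_add, map_one] at h4
  refine hy.le ⟨n, ht⟩ ?_ (hd.trans h4)
  rw [hx]
  refine interval_distLt_rat_iff.2 ?_
  rw [QCode.lt_iff, QCode.val_add] at h2 h3
  rw [abs_lt]
  constructor <;> linarith

/-- The centres are the multiples of `1 / (d + 1)` in `[0, 1]`, all with radius equal to the lower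
bound of the gauge. -/
theorem interval_hasFineCover (hM : WeakKonig M) {Φ : M.sets}
    (hΦ : IsGauge (Interval M) Φ.1) : HasFineCover (Interval M) Φ.1 := by
  have hhp : ∀ k : M.N, 0 < hp k := hp_pos
  obtain ⟨e, he⟩ := exists_interval_bound hM hΦ
  -- The spacing is half the radius, so the balls overlap; the surplus absorbs the error in
  -- approximating a real.
  let d := 2 * e + 1
  have hd1 : (toFrac d + 1 : M.K) = 2 * (toFrac e + 1) := by
    simp only [d, map_add, map_mul, map_one, map_ofNat]; ring
  have hd : (0 : M.K) < 1 / (toFrac d + 1) := one_div_pos.2 (QCode.den_pos d)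
  have hed : (1 / (toFrac e + 1) : M.K) = 2 * (1 / (toFrac d + 1)) := by
    have := (QCode.den_pos e).ne'
    rw [hd1]; field_simp
  obtain ⟨P, hP⟩ := exists_nslice_eq_ratReal fun i => QCode.frac i d
  obtain ⟨R, hR⟩ := exists_nslice_eq_ratReal fun _ => QCode.recip e
  refine ⟨d + 1 + 1, P, R, fun i hi => ?_, fun i j hij _ h => ?_, fun x hx => ?_⟩
  · have h0 : 0 ≤ (QCode.frac i d).val := by
      rw [QCode.val_frac]; exact mul_nonneg (toFrac_nonneg i) hd.le
    have h1 : (QCode.frac i d).val ≤ 1 := by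
      rw [QCode.val_frac, mul_one_div, div_le_one (QCode.den_pos d)]
      simpa using toFrac_mono (lt_add_one_iff.1 hi)
    obtain ⟨y, hy, hy'⟩ := he _ h0 h1
    rw [hP, hR]
    refine ⟨interval_point_ratReal h0 h1, isReal_ratReal _, ?_, y, hy, hy' _ ?_⟩
    · rw [RealZero, realLt_ratReal_iff, QCode.val_zero, QCode.val_recip]
      exact one_div_pos.2 (QCode.den_pos e)
    · rw [QCode.val_recip]
  · rw [hP, hP] at h
    have h1 := realLe_ratReal_iff.1 h.2
    have h2 := toFrac_strictMono hij
    rw [QCode.val_frac, QCode.val_frac, mul_le_mul_iff_left₀ hd] at h1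
    exact h2.not_ge h1
  · obtain ⟨q, hq, hr⟩ := isReal_iff.1 hx.1
    -- The total error is `5 * hp j`: two parts from clamping stage `j` into `[0, 1]`, three
    -- demanded by `interval_distLt_of`. It has to be smaller than the spacing.
    obtain ⟨j, hj⟩ := exists_hp_lt (div_pos hd (by norm_num : (0 : M.K) < 5))
    obtain ⟨p, hp0, hp1, hpq⟩ := exists_val_near hq hx j
    obtain ⟨i, hi, hi1, hi2⟩ := exists_frac_le p hp0 hp1 d
    refine ⟨i, lt_add_one_iff.2 (hi.trans le_self_add), ?_⟩
    rw [hP, hR]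
    refine interval_distLt_of hq hr j ?_
    rw [QCode.val_recip, hed, ← lt_sub_iff_add_lt, abs_lt]
    simp only [QCode.val_frac, map_add, map_one, add_mul, one_mul] at *
    rw [abs_le] at hpq
    constructor <;> linarith [hpq.1, hpq.2]

/-- Cutting `[0, 1]` into pieces as long as the lower bound of the gauge works with arbitrary tags.
The left ends are taken, so one sequence provides both division points and tags. -/
theorem interval_hasFinePartition (hM : WeakKonig M) {Φ : M.sets}
    (hΦ : IsGauge (Interval M) Φ.1) : HasFinePartition Φ.1 := by
  have hhp : ∀ k : M.N, 0 < hp k := hp_pos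
  obtain ⟨d, he⟩ := exists_interval_bound hM hΦ
  have hd : (0 : M.K) < 1 / (toFrac d + 1) := one_div_pos.2 (QCode.den_pos d)
  obtain ⟨P, hP⟩ := exists_nslice_eq_ratReal fun i => QCode.frac i d
  have h0 : ∀ i, 0 ≤ (QCode.frac i d).val := fun i => by
    rw [QCode.val_frac]; exact mul_nonneg (toFrac_nonneg i) hd.le
  have h1 : ∀ i, i ≤ d + 1 → (QCode.frac i d).val ≤ 1 := fun i hi => by
    rw [QCode.val_frac, mul_one_div, div_le_one (QCode.den_pos d)]
    simpa using toFrac_mono hi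
  have h2 : (QCode.frac (d + 1) d).val = 1 := by
    rw [QCode.val_frac, map_add, map_one, mul_one_div_cancel (QCode.den_pos d).ne']
  refine ⟨d + 1, P, P, fun i hi => ?_, ?_, ?_, fun i hi => ?_⟩
  · rw [hP]; exact interval_point_ratReal (h0 i) (h1 i hi)
  · rw [hP, RealEq, RealZero, realLe_ratReal_iff, realLe_ratReal_iff]; simp
  · rw [hP, RealEq, RealOne, realLe_ratReal_iff, realLe_ratReal_iff, h2]; simp
  · obtain ⟨y, hy, hy'⟩ := he _ (h0 i) (h1 i hi.le)
    obtain ⟨q, hq, -⟩ := isReal_iff.1 hy.2.1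
    have h3 := hy' (.recip d) (by rw [QCode.val_recip])
    rw [(isSeq_ratReal _).realLe_iff hq, QCode.val_recip] at h3
    have h4 : (QCode.frac (i + 1) d).val = (QCode.frac i d).val + 1 / (toFrac d + 1) := by
      simp only [QCode.val_frac, map_add, map_one, add_mul, one_mul]
    rw [hP, hP]
    refine ⟨interval_point_ratReal (h0 i) (h1 i hi.le), realLe_ratReal_iff.2 le_rfl,
      realLe_ratReal_iff.2 (by rw [h4]; linarith), y, hy, ?_⟩
    rw [(isSeq_ratReal _).realLe_iff ((isSeq_ratReal _).realAdd hq)]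
    intro k
    -- `RealAdd` reads stage `k + 1` of the value.
    have h5 := h3 (k + 1)
    have := hhp k
    rw [hp_add_one] at h5
    rw [QCode.val_add, h4]
    linarith

end SOA


namespace SOA

open Model

variable {M : Model.{u}} [IsRCA0 M]

/-! ## Cantor space -/

/-- Any common length `n` with `2 ^ (-n) < r` will do in place of the first difference. This removes
the universal case distinction on equality and makes the distance relation `Σ⁰₁`. -/
theorem cantor_distLt_iff (x y : M.sets) {r : QCode M} :
    (Cantor M).distLt x.1 y.1 (RatReal r) ↔
      ∃ n, hp n < r.val ∧ ∀ i, i < n → (i ∈ x.1 ↔ i ∈ y.1) := by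
  change ((∀ i, i ∈ x.1 ↔ i ∈ y.1) ∧ RealLt RealZero (RatReal r)) ∨
    (∃ n, (∀ i, i < n → (i ∈ x.1 ↔ i ∈ y.1)) ∧ ¬ (n ∈ x.1 ↔ n ∈ y.1) ∧
      HalfPow n fun ε => RealLt (RatReal ε) (RatReal r)) ↔ _
  simp only [halfPow_iff, RealZero, realLt_ratReal_iff, val_halfCode, QCode.val_zero]
  constructor
  · rintro (⟨h, h0⟩ | ⟨n, h, -, hn⟩)
    · obtain ⟨n, hn⟩ := exists_hp_lt h0
      exact ⟨n, hn, fun i _ => h i⟩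
    · exact ⟨n, hn, h⟩
  · rintro ⟨n, hn, h⟩
    by_cases hxy : ∀ i, i ∈ x.1 ↔ i ∈ y.1
    · exact .inl ⟨hxy, (hp_pos n).trans hn⟩
    · obtain ⟨m, hm, hm'⟩ := exists_least (not_forall.1 hxy)
      refine .inr ⟨m, fun i hi => not_not.1 (hm' i hi), hm, (hp_anti ?_).trans_lt hn⟩
      by_contra! hmn
      exact hm (h m hmn)

theorem exists_eq_embed (a : QCode M) : ∃ A : M.sets, A.1 = (Cantor M).embed a := by
  obtain ⟨A, hA⟩ := exists_set fun i => i < a.a ∧ nbit a.b a.c i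
  exact ⟨A, Set.ext hA⟩

theorem cantor_distLt_embed_iff (x : M.sets) {a r : QCode M} :
    (Cantor M).distLt x.1 ((Cantor M).embed a) (RatReal r) ↔
      ∃ n, hp n < r.val ∧ ∀ i, i < n → (i ∈ x.1 ↔ i < a.a ∧ nbit a.b a.c i) := by
  obtain ⟨A, hA⟩ := exists_eq_embed a
  rw [← hA, cantor_distLt_iff, hA]
  rfl

theorem cantor_isRegular : (Cantor M).IsRegular where
  sigma1 x _ f g hf hg := by
    have key : ∀ a b c : (ℕ → M.N) → M.N, TermFn M a → TermFn M b → TermFn M c →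
        Sigma1 M fun v => ∃ n k, pw n = k + 1 ∧ (QCode.recip k).Lt (g v) ∧
          ∀ i, i < n → (i ∈ x.1 ↔ i < a v ∧ nbit (b v) (c v) i) := by
      intro a b c _ _ _
      infer_instance
    refine (key _ _ _ hf.a hf.b hf.c).of_iff fun v => ?_
    rw [cantor_distLt_embed_iff]
    refine exists_congr fun n => ?_
    rw [← val_halfCode, ← QCode.lt_iff]
    exact halfCode_iff (P := fun ε => ε.Lt (g v) ∧ _)
  inter x _ a r a' r' h h' := by
    obtain ⟨n, hn, h⟩ := (cantor_distLt_embed_iff x).1 h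
    obtain ⟨n', hn', h'⟩ := (cantor_distLt_embed_iff x).1 h'
    obtain ⟨b, c, hbc⟩ := exists_finite_code x (max n n')
    -- The new centre is an initial segment of `x`, long enough for both balls and continued by
    -- zeros; its radius is half the smaller of the two gaps `r - hp n` and `r' - hp n'`.
    obtain ⟨r'', hr⟩ := QCode.exists_val_eq (min (r.val - hp n) (r'.val - hp n') / 2)
    have h1 := min_le_left (r.val - hp n) (r'.val - hp n')
    have h2 := min_le_right (r.val - hp n) (r'.val - hp n')
    have h3 : 0 < min (r.val - hp n) (r'.val - hp n') := lt_min (by linarith) (by linarith)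
    obtain ⟨A, hA⟩ := exists_eq_embed (⟨max n n', b, c⟩ : QCode M)
    have hAx : ∀ i, i < max n n' → (i ∈ A.1 ↔ i ∈ x.1) := fun i hi => by
      rw [hA, ← hbc i hi]
      exact and_iff_right hi
    refine ⟨⟨max n n', b, c⟩, r'', rfl, ?_, ?_, ?_⟩
    · rw [QCode.lt_iff, hr, QCode.val_zero]
      exact half_pos h3
    · rw [← hA, cantor_distLt_embed_iff, QCode.val_sub, hr]
      exact ⟨n, by linarith, fun i hi => (hAx i (hi.trans_le (le_max_left _ _))).trans (h i hi)⟩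
    · rw [← hA, cantor_distLt_embed_iff, QCode.val_sub, hr]
      exact ⟨n', by linarith, fun i hi => (hAx i (hi.trans_le (le_max_right _ _))).trans (h' i hi)⟩

/-- `t` codes the information that a function has positive values, bounded from below, on a ball
containing all points that begin with the `k` digits of `w`. -/
def CantorBound (t k w e : M.N) : Prop :=
  ∃ n, n ≤ t ∧ ∃ a : QCode M, a.code ≤ t ∧ ∃ r : QCode M, r.code ≤ t ∧ ∃ b : QCode M, b.code ≤ t ∧
    ∃ s : QCode M, s.code ≤ t ∧ t = relCode n a r b s ∧ s.Lt b ∧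
      ∃ m, m ≤ k ∧ (∃ c, c ≤ e ∧ pw m = c + 1 ∧ (QCode.recip c).Lt r) ∧
        ∀ i, i < m → (Dig w k i ↔ i < a.a ∧ nbit a.b a.c i)

instance {f g h j : (ℕ → M.N) → M.N} [TermFn M f] [TermFn M g] [TermFn M h] [TermFn M j] :
    Delta0 M fun v => CantorBound (f v) (g v) (h v) (j v) := by
  unfold CantorBound; infer_instance

/-- A gauge on Cantor space is bounded away from `0`. -/
theorem exists_cantor_bound (hM : WeakKonig M) {Φ : M.sets} (hΦ : IsGauge (Cantor M) Φ.1) :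
    ∃ e : M.N, ∀ x : M.sets, ∃ y : M.sets, Value (Cantor M) Φ.1 x.1 y.1 ∧
      ∀ c : QCode M, c.val ≤ 1 / (toFrac e + 1) → RealLe (RatReal c) y.1 := by
  -- As on the interval, but here the string is read off the point itself, and its cone lies in the
  -- ball as soon as the first `m ≤ k` digits agree with the centre.
  let U (k w : M.N) : Prop := ∃ e, pw k = e + 1 ∧ ∃ t, t < k ∧ t ∈ Φ.1 ∧ CantorBound t k w e
  have i1 : Sigma1 M fun v => U (v 0) (v 1) := by
    dsimp only [U]
    infer_instance
  have i2 : Sigma1 M fun v => ¬ U (v 0) (v 1) := by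
    refine Sigma1.of_iff (P := fun v => ∃ e, pw (v 0) = e + 1 ∧ ¬ ∃ t, t < v 0 ∧ t ∈ Φ.1 ∧
      CantorBound t (v 0) (v 1) e) (by infer_instance) fun v => ?_
    obtain ⟨c, hc⟩ := exists_pw_eq (v 0)
    constructor
    · exact fun h => ⟨c, hc, fun h' => h ⟨c, hc, h'⟩⟩
    · rintro ⟨c, hc, h⟩ ⟨c', hc', h'⟩
      obtain rfl := add_right_cancel (hc.symm.trans hc')
      exact h h'
  have hU1 : ∀ k w b, b ≤ 1 → U k w → U (k + 1) (2 * w + b) := by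
    rintro k w b hb ⟨e, he, t, htk, ht, n, hn, a, ha, r, hr, b', hb', s, hs, rfl, hsb,
      m, hm, ⟨c, hc, hcm, hcr⟩, h⟩
    obtain ⟨e', he'⟩ := exists_pw_eq (k + 1)
    refine ⟨e', he', _, htk.trans_le le_self_add, ht, n, hn, a, ha, r, hr, b', hb', s, hs, rfl,
      hsb, m, hm.trans le_self_add, ⟨c, hc.trans ?_, hcm, hcr⟩, fun i hi => ?_⟩
    · have := pw_le_pw (le_self_add : k ≤ k + 1)
      rw [he, he'] at this
      exact le_of_add_le_add_right this
    · rw [dig_init hb (hi.trans_le hm), h i hi]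
  have hU2 : ∀ X : M.sets, ∃ k w, Matches (· ∈ X.1) k w ∧ U k w := by
    intro X
    obtain ⟨a, r, b, s, ⟨n, hn⟩, hnear, hsb⟩ := hΦ.exists_rel cantor_isRegular (x := X) rfl
    obtain ⟨m, hm, h⟩ := (cantor_distLt_embed_iff X).1 hnear
    let k := max m (relCode n a r b s + 1)
    obtain ⟨w, hw⟩ := exists_matches (· ∈ X.1) k
    obtain ⟨e, he⟩ := exists_pw_eq k
    obtain ⟨c, hc⟩ := exists_pw_eq m
    have hmk : m ≤ k := le_max_left _ _
    have hcode := codes_le_relCode n a r b s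
    refine ⟨k, w, hw, e, he, _, add_one_le_iff.1 (le_max_right _ _), hn, n, hcode.1, a, hcode.2.1,
      r, hcode.2.2.1, b, hcode.2.2.2.1, s, hcode.2.2.2.2, rfl, QCode.lt_iff.2 hsb, m, hmk,
      ⟨c, ?_, hc, ?_⟩, fun i hi => ?_⟩
    · have := pw_le_pw hmk
      rw [he, hc] at this
      exact le_of_add_le_add_right this
    · rw [QCode.lt_iff, val_recip_eq hc]
      exact hm
    · exact (hw.2 i (hi.trans_le hmk)).symm.trans (h i hi)
  obtain ⟨K, hK⟩ := hM.exists_uniform U hU1 hU2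
  have hK0 : K ≠ 0 := by
    rintro rfl
    obtain ⟨_, _, t, ht, _⟩ := hK 0 (pw_pos 0)
    exact not_lt_zero_raw _ ht
  obtain ⟨e, he⟩ := (eq_zero_or_eq_add_one (K * K)).resolve_left (mul_ne_zero hK0 hK0)
  refine ⟨e, fun x => ?_⟩
  obtain ⟨y, hy⟩ := exists_value cantor_isRegular hΦ.1 (x := x) rfl (hΦ.2 x rfl).1
  obtain ⟨w, hw⟩ := exists_matches (· ∈ x.1) K
  obtain ⟨_, _, t, htK, ht, n, -, a, -, r, -, b, hb, s, hs, rfl, hsb, m, hm, ⟨c, -, hc, hcr⟩, h⟩ :=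
    hK w hw.1
  refine ⟨y, hy, fun d hd => ?_⟩
  have h4 := QCode.le_sub_of_lt hsb ((s.c_le_code.trans hs).trans_lt htK)
    ((b.c_le_code.trans hb).trans_lt htK)
  rw [he, map_add, map_one] at h4
  refine hy.le ⟨n, ht⟩ ((cantor_distLt_embed_iff x).2 ⟨m, ?_, fun i hi => ?_⟩) (hd.trans h4)
  · rwa [QCode.lt_iff, val_recip_eq hc] at hcr
  · exact (hw.2 i (hi.trans_le hm)).trans (h i hi)

/-- The centres are all strings of a length `L` with `2 ^ (-L)` below the bound of the gauge,
continued by zeros. A point is covered by the centre that shares its first `L` digits, and distinct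
`w < 2 ^ L` give distinct centres by `dig_ext`. -/
theorem cantor_hasFineCover (hM : WeakKonig M) {Φ : M.sets}
    (hΦ : IsGauge (Cantor M) Φ.1) : HasFineCover (Cantor M) Φ.1 := by
  obtain ⟨e, he⟩ := exists_cantor_bound hM hΦ
  have he0 : (0 : M.K) < 1 / (toFrac e + 1) := one_div_pos.2 (QCode.den_pos e)
  obtain ⟨L, hL⟩ := exists_hp_lt he0
  obtain ⟨P, hP⟩ := exists_set (M := M) fun z => ∃ w, w ≤ z ∧ ∃ i, i ≤ z ∧ z = npair w i ∧
    i < L ∧ Dig w L i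
  have hP : ∀ w i, i ∈ nslice P.1 w ↔ i < L ∧ Dig w L i := by
    intro w i
    change npair w i ∈ P.1 ↔ _
    rw [hP]
    constructor
    · rintro ⟨w', -, i', -, h, h'⟩
      obtain ⟨rfl, rfl⟩ := npair_inj.1 h
      exact h'
    · exact fun h => ⟨w, left_le_npair _ _, i, right_le_npair _ _, rfl, h⟩
  obtain ⟨R, hR⟩ := exists_nslice_eq_ratReal fun _ => QCode.recip e
  refine ⟨pw L, P, R, fun w _ => ?_, fun w w' hw hw' h => ?_, fun x _ => ?_⟩
  · obtain ⟨x, hx⟩ := exists_eq_nslice P w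
    obtain ⟨y, hy, hy'⟩ := he x
    rw [← hx, hR]
    refine ⟨rfl, isReal_ratReal _, ?_, y, hy, hy' _ ?_⟩
    · rwa [RealZero, realLt_ratReal_iff, QCode.val_zero, QCode.val_recip]
    · rw [QCode.val_recip]
  · refine hw.ne (dig_ext L w w' (hw.trans hw') hw' fun i hi => ?_)
    have := h i
    rwa [hP, hP, and_iff_right hi, and_iff_right hi] at this
  · obtain ⟨w, hw⟩ := exists_matches (· ∈ x.1) L
    refine ⟨w, hw.1, ?_⟩
    obtain ⟨y, hy⟩ := exists_eq_nslice P w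
    rw [← hy, hR, cantor_distLt_iff, QCode.val_recip]
    refine ⟨L, hL, fun i hi => ?_⟩
    rw [hy, hP, and_iff_right hi]
    exact hw.2 i hi

end SOA

theorem mainTheorem6 :
    SOA.Entails.{u} SOA.WKL0 (SOA.cousin SOA.interval) ∧
    SOA.Entails.{u} SOA.WKL0 (SOA.cousin SOA.cantor) ∧
    SOA.Entails.{u} SOA.WKL0 SOA.cousinPartition := by
  have key : ∀ M : SOA.Model.{u}, (∀ ψ ∈ SOA.WKL0, M.Satisfies ψ) →
      ∃ _ : SOA.IsRCA0 M, SOA.WeakKonig M := fun M hM =>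
    have h : SOA.IsRCA0 M := ⟨fun ψ hψ => hM ψ (.inl hψ)⟩
    ⟨h, SOA.satisfies_weakKonig_iff.1 (hM _ (.inr rfl))⟩
  refine ⟨fun M hM => ?_, fun M hM => ?_, fun M hM => ?_⟩ <;> obtain ⟨h, hW⟩ := key M hM
  · exact (SOA.satisfies_cousin_iff _ (SOA.Interval M)).2 fun _ =>
      SOA.interval_hasFineCover hW
  · exact (SOA.satisfies_cousin_iff _ (SOA.Cantor M)).2 fun _ => SOA.cantor_hasFineCover hW
  · exact SOA.satisfies_cousinPartition_iff.2 fun _ => SOA.interval_hasFinePartition hW
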